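/- Let $\mathbf k$ be a field and let $B=\bigoplus_{i\ge 0}B_i$ be a connected graded (associative, not necessarily commutative) $\mathbf k$-algebra, i.e. $B_0=\mathbf k$. Let $W\in B_n$ be a central element of degree $n\ge 0$ that is not a zero-divisor: $Wb=bW$ for all $b\in B$, and $bW=0$ only for $b=0$. Put $J=WB=BW$ and let $A=B/J$ with the induced grading. For a graded algebra $R=\bigoplus_{i\ge0}R_i$ let $\operatorname{gr}\!-R$ be the category of finitely generated $\mathbb Z$-graded right $R$-modules with homomorphisms of degree $0$, with twists $M(p)_i=M_{p+i}$. Let $\mathbf D^b(\operatorname{gr}\!-R)$ be the Verdier quotient of the homotopy category $\mathbf K^b(\operatorname{gr}\!-R)$ of bounded complexes by the exact complexes (the bounded derived category of the abelian category $\operatorname{gr}\!-R$ if $R$ is right Noetherian), and let $\mathbf D^{\mathrm{gr}}_{\mathrm{Sg}}(R)$ be the Verdier quotient of $\mathbf D^b(\operatorname{gr}\!-R)$ by the triangulated subcategory of the objects isomorphic to bounded complexes of projective objects of $\operatorname{gr}\!-R$. The objects of the category $\operatorname{GrPair}(W)$ are the quadruples $\overline P=(P_1,P_0,p_1,p_0)$,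 where $P_1,P_0$ are free graded right $B$-modules of finite rank and $p_1:P_1\to P_0$, $p_0:P_0\to P_1(n)$ are morphisms in $\operatorname{gr}\!-B$ such that $p_0p_1$ and $p_1(n)p_0$ are multiplication by $W$. A morphism $f:\overline P\to\overline Q$ is a pair of morphisms $f_1:P_1\to Q_1$, $f_0:P_0\to Q_0$ in $\operatorname{gr}\!-B$ with $q_1f_1=f_0p_1$ and $f_1(n)p_0=q_0f_0$. It is null-homotopic if there are morphisms $s:P_0\to Q_1$ and $t:P_1\to Q_0(-n)$ in $\operatorname{gr}\!-B$ with $f_1=q_0(-n)\,t+s\,p_1$ and $f_0=t(n)\,p_0+q_1s$. The category $\operatorname{DGrB}(W)$ has the same objects, and its morphisms are the morphisms of $\operatorname{GrPair}(W)$ modulo the null-homotopic ones. Write $\overline P$ as the sequence $K^{\bullet}$ with $K^{2i-1}=P_1(in)$, $K^{2i}=P_0(in)$ and maps $k^{2i-1}=p_1(in)$, $k^{2i}=p_0(in)$. The translation functor is $K[1]^i=K^{i+1}$, with maps $-k^{i+1}$. The exact triangles of $\operatorname{DGrB}(W)$ are those isomorphic to a triangle $K\xrightarrow{f}L\to C(f)\to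 K[1]$, where $f$ is a morphism of $\operatorname{GrPair}(W)$, $C(f)^i=L^i\oplus K^{i+1}$ has maps $(x,y)\mapsto(l^ix+f^{i+1}y,\,-k^{i+1}y)$, and the other two maps are $(\mathrm{id},0)$ and $(0,-\mathrm{id})$. The cokernel of $k^{-1}=p_1:P_1\to P_0$ is annihilated by $W$; this gives a functor $\operatorname{Cok}:\operatorname{GrPair}(W)\to\operatorname{gr}\!-A$, $\overline P\mapsto\operatorname{Coker}p_1$. Then there is a functor $F:\operatorname{DGrB}(W)\to\mathbf D^{\mathrm{gr}}_{\mathrm{Sg}}(A)$ (necessarily unique) whose composition with the projection $\operatorname{GrPair}(W)\to\operatorname{DGrB}(W)$ equals the composition of $\operatorname{Cok}$ with the natural functor $\operatorname{gr}\!-A\to\mathbf D^{\mathrm{gr}}_{\mathrm{Sg}}(A)$. The functor $F$ is additive and exact (it commutes with the translation functors up to a natural isomorphism, through which it takes exact triangles to exact triangles), and it is fully faithful. -/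

import Mathlib

open CategoryTheory CategoryTheory.Limits MulOpposite

universe v u

namespace GradedBranes

section Verdier

variable {C : Type*} [Category C] [HasZeroObject C] [HasShift C ℤ] [Preadditive C]
  [∀ n : ℤ, (shiftFunctor C n).Additive] [Pretriangulated C] [IsTriangulated C]
  (P : ObjectProperty C) [P.IsTriangulated]

/-- The Verdier quotient of a triangulated category by a triangulated subcategory `P`: the
localization at the morphisms whose cone belongs to `P`. -/
def VerdierQuotient := P.trW.Localization

namespace VerdierQuotient

noncomputable instance : Category (VerdierQuotient P) :=
  inferInstanceAs (Category P.trW.Localization)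

/-- The quotient functor. -/
noncomputable def Q : C ⥤ VerdierQuotient P := P.trW.Q

instance : (Q P).IsLocalization P.trW := inferInstanceAs (P.trW.Q.IsLocalization P.trW)

noncomputable instance : Preadditive (VerdierQuotient P) := Localization.preadditive (Q P) P.trW

instance : (Q P).Additive := Localization.functor_additive (Q P) P.trW

instance : HasZeroObject (VerdierQuotient P) := (Q P).hasZeroObject_of_additive

noncomputable instance : HasShift (VerdierQuotient P) ℤ := HasShift.localized (Q P) P.trW ℤ

noncomputable instance : (Q P).CommShift ℤ := Functor.CommShift.localized (Q P) P.trW ℤ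

instance (n : ℤ) : (shiftFunctor (VerdierQuotient P) n).Additive := by
  rw [Localization.functor_additive_iff (Q P) P.trW]
  exact Functor.additive_of_iso ((Q P).commShiftIso n)

noncomputable instance : Pretriangulated (VerdierQuotient P) :=
  Triangulated.Localization.pretriangulated (Q P) P.trW

instance : (Q P).IsTriangulated := Triangulated.Localization.isTriangulated_functor (Q P) P.trW

instance : IsTriangulated (VerdierQuotient P) :=
  Triangulated.Localization.isTriangulated (Q P) P.trW

end VerdierQuotient

end Verdier


/-- `gr-R`: finitely generated `ℤ`-graded right modules over a ring `R` with an
`ℕ`-indexed grading `𝒜`.  Right `R`-modules are modules over `Rᵐᵒᵖ`. -/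
structure GrMod {k : Type v} [Field k] {R : Type u} [Ring R] [Algebra k R]
    (𝒜 : ℕ → Submodule k R) where
  carrier : Type u
  [addCommGroup : AddCommGroup carrier]
  [module : Module Rᵐᵒᵖ carrier]
  /-- the homogeneous components -/
  comp : ℤ → AddSubgroup carrier
  isInternal : DirectSum.IsInternal comp
  smul_mem : ∀ {i : ℤ} {j : ℕ} {x : carrier} {a : R},
    x ∈ comp i → a ∈ 𝒜 j → op a • x ∈ comp (i + j)
  fg : Module.Finite Rᵐᵒᵖ carrier

namespace GrMod

variable {k : Type v} [Field k] {R : Type u} [Ring R] [Algebra k R] {𝒜 : ℕ → Submodule k R}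

instance : CoeSort (GrMod 𝒜) (Type u) := ⟨carrier⟩

attribute [instance] addCommGroup module fg

/-- Morphisms of `gr-R`: homomorphisms of right modules of degree `0`. -/
@[ext]
structure Hom (M N : GrMod 𝒜) where
  lin : M →ₗ[Rᵐᵒᵖ] N
  map_mem : ∀ (i : ℤ) (x : M), x ∈ M.comp i → lin x ∈ N.comp i

instance : Category (GrMod 𝒜) where
  Hom := Hom
  id M := ⟨LinearMap.id, fun _ _ h => h⟩
  comp f g := ⟨g.lin.comp f.lin, fun i x h => g.map_mem i _ (f.map_mem i x h)⟩

@[ext]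
lemma hom_ext {M N : GrMod 𝒜} {f g : M ⟶ N} (h : ∀ x, f.lin x = g.lin x) : f = g :=
  Hom.ext (LinearMap.ext h)

@[simp] lemma id_lin (M : GrMod 𝒜) (x : M) : Hom.lin (𝟙 M) x = x := rfl
@[simp] lemma comp_lin {M N P : GrMod 𝒜} (f : M ⟶ N) (g : N ⟶ P) (x : M) :
    Hom.lin (f ≫ g) x = g.lin (f.lin x) := rfl

section Additive

variable {M N : GrMod 𝒜}

instance : Zero (M ⟶ N) := ⟨⟨0, fun i _ _ => (N.comp i).zero_mem⟩⟩
instance : Add (M ⟶ N) :=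
  ⟨fun f g => ⟨f.lin + g.lin, fun i x h => (N.comp i).add_mem (f.map_mem i x h) (g.map_mem i x h)⟩⟩
instance : Neg (M ⟶ N) :=
  ⟨fun f => ⟨-f.lin, fun i x h => (N.comp i).neg_mem (f.map_mem i x h)⟩⟩
instance : Sub (M ⟶ N) :=
  ⟨fun f g => ⟨f.lin - g.lin, fun i x h => (N.comp i).sub_mem (f.map_mem i x h) (g.map_mem i x h)⟩⟩
instance : SMul ℕ (M ⟶ N) :=
  ⟨fun n f => ⟨n • f.lin, fun i x h => (N.comp i).nsmul_mem (f.map_mem i x h) n⟩⟩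
instance : SMul ℤ (M ⟶ N) :=
  ⟨fun n f => ⟨n • f.lin, fun i x h => (N.comp i).zsmul_mem (f.map_mem i x h) n⟩⟩

instance : AddCommGroup (M ⟶ N) :=
  Function.Injective.addCommGroup (fun f : M ⟶ N => f.lin) (fun _ _ h => Hom.ext h)
    rfl (fun _ _ => rfl) (fun _ => rfl) (fun _ _ => rfl) (fun _ _ => rfl) (fun _ _ => rfl)

@[simp] lemma zero_lin (x : M) : Hom.lin (0 : M ⟶ N) x = 0 := rfl
@[simp] lemma add_lin (f g : M ⟶ N) (x : M) : Hom.lin (f + g) x = f.lin x + g.lin x := rfl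
@[simp] lemma neg_lin (f : M ⟶ N) (x : M) : Hom.lin (-f) x = -f.lin x := rfl
@[simp] lemma sub_lin (f g : M ⟶ N) (x : M) : Hom.lin (f - g) x = f.lin x - g.lin x := rfl

end Additive

instance : Preadditive (GrMod 𝒜) where
  add_comp _ _ _ f f' g := by ext x; simp
  comp_add _ _ _ f g g' := by ext x; simp

lemma isInternal_iff {M : Type*} [AddCommGroup M] (c : ℤ → AddSubgroup M) :
    DirectSum.IsInternal c ↔ iSupIndep c ∧ iSup c = ⊤ := by
  have e : DirectSum.IsInternal c ↔
      DirectSum.IsInternal (fun i => AddSubgroup.toIntSubmodule (c i)) := Iff.rfl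
  rw [e, DirectSum.isInternal_submodule_iff_iSupIndep_and_iSup_eq_top]
  refine and_congr ?_ ?_
  · exact iSupIndep_map_orderIso_iff (AddSubgroup.toIntSubmodule (M := M))
  · rw [← map_iSup (AddSubgroup.toIntSubmodule (M := M)), map_eq_top_iff]

section Components

variable {M N : Type*} [AddCommGroup M] [AddCommGroup N] {c : ℤ → AddSubgroup M}
  {c' : ℤ → AddSubgroup N} (g : M →+ N) (hg : ∀ i x, x ∈ c i → g x ∈ c' i)

/-- The map induced on direct sums by a map preserving given families of subgroups. -/
def compMap : DirectSum ℤ (fun i => c i) →+ DirectSum ℤ (fun i => c' i) :=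
  DirectSum.map fun i => (g.comp (c i).subtype).codRestrict (c' i) (fun x => hg i x x.2)

lemma compMap_apply (x : DirectSum ℤ (fun i => c i)) (i : ℤ) :
    ((compMap g hg x i : c' i) : N) = g (x i : c i) := by
  simp only [compMap, DirectSum.map_apply]; rfl

lemma coe_compMap (x : DirectSum ℤ (fun i => c i)) :
    DirectSum.coeAddMonoidHom c' (compMap g hg x) = g (DirectSum.coeAddMonoidHom c x) := by
  have : (DirectSum.coeAddMonoidHom c').comp (compMap g hg) =
      g.comp (DirectSum.coeAddMonoidHom c) := by
    ext i x; simp [compMap]; rfl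
  exact DFunLike.congr_fun this x

end Components

/-- The twist `M(p)`, with `M(p)_i = M_{p+i}`. -/
def twist (M : GrMod 𝒜) (p : ℤ) : GrMod 𝒜 where
  carrier := M
  comp i := M.comp (p + i)
  isInternal := by
    obtain ⟨h1, h2⟩ := (isInternal_iff _).1 M.isInternal
    refine (isInternal_iff _).2 ⟨h1.comp (add_right_injective p), ?_⟩
    rw [← h2]
    exact (Equiv.addLeft p).iSup_comp (g := M.comp)
  smul_mem := by
    intro i j x a hx ha
    have := M.smul_mem hx ha
    rwa [add_assoc] at this
  fg := M.fg

/-- The identity map from `M(p)` to `M`, which have the same underlying module. -/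
def untwist {M : GrMod 𝒜} {p : ℤ} : M.twist p →ₗ[Rᵐᵒᵖ] M := LinearMap.id (M := M)

/-- `f(p) : M(p) ⟶ N(p)` is the same map as `f`. -/
def twistMap {M N : GrMod 𝒜} (f : M ⟶ N) (p : ℤ) : M.twist p ⟶ N.twist p :=
  ⟨f.lin, fun i x h => f.map_mem (p + i) x h⟩

@[simp] lemma untwist_twistMap {M N : GrMod 𝒜} (f : M ⟶ N) (p : ℤ) (x : M.twist p) :
    untwist (Hom.lin (twistMap f p) x) = f.lin (untwist x) := rfl

/-- The direct sum of two graded modules. -/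
def dsum (M N : GrMod 𝒜) : GrMod 𝒜 where
  carrier := M × N
  comp i := (M.comp i).prod (N.comp i)
  isInternal := by
    obtain ⟨hM1, hM2⟩ := M.isInternal
    obtain ⟨hN1, hN2⟩ := N.isInternal
    constructor
    · rw [injective_iff_map_eq_zero]
      intro x hx
      have g1 : ∀ i y, y ∈ (M.comp i).prod (N.comp i) → AddMonoidHom.fst M N y ∈ M.comp i :=
        fun i y h => h.1
      have g2 : ∀ i y, y ∈ (M.comp i).prod (N.comp i) → AddMonoidHom.snd M N y ∈ N.comp i :=
        fun i y h => h.2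
      have h1 : compMap _ g1 x = 0 := hM1 (by rw [coe_compMap, hx]; rfl)
      have h2 : compMap _ g2 x = 0 := hN1 (by rw [coe_compMap, hx]; rfl)
      ext i
      · have := compMap_apply _ g1 x i
        rw [h1] at this
        exact this.symm
      · have := compMap_apply _ g2 x i
        rw [h2] at this
        exact this.symm
    · rintro ⟨x, y⟩
      obtain ⟨x, rfl⟩ := hM2 x
      obtain ⟨y, rfl⟩ := hN2 y
      have g1 : ∀ i z, z ∈ M.comp i → AddMonoidHom.inl M N z ∈ (M.comp i).prod (N.comp i) :=
        fun i z h => ⟨h, zero_mem _⟩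
      have g2 : ∀ i z, z ∈ N.comp i → AddMonoidHom.inr M N z ∈ (M.comp i).prod (N.comp i) :=
        fun i z h => ⟨zero_mem _, h⟩
      refine ⟨compMap _ g1 x + compMap _ g2 y, ?_⟩
      rw [map_add, coe_compMap, coe_compMap]
      simp
  smul_mem hx ha := ⟨M.smul_mem hx.1 ha, N.smul_mem hx.2 ha⟩
  fg := inferInstance

/-- The first inclusion into a direct sum. -/
def inl (M N : GrMod 𝒜) : M ⟶ M.dsum N := ⟨LinearMap.inl _ _ _, fun _ _ h => ⟨h, zero_mem _⟩⟩

/-- The second inclusion into a direct sum. -/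
def inr (M N : GrMod 𝒜) : N ⟶ M.dsum N := ⟨LinearMap.inr _ _ _, fun _ _ h => ⟨zero_mem _, h⟩⟩

/-- The first projection from a direct sum. -/
def fst (M N : GrMod 𝒜) : M.dsum N ⟶ M := ⟨LinearMap.fst _ _ _, fun _ _ h => h.1⟩

/-- The second projection from a direct sum. -/
def snd (M N : GrMod 𝒜) : M.dsum N ⟶ N := ⟨LinearMap.snd _ _ _, fun _ _ h => h.2⟩

/-- The morphism to a direct sum with given components. -/
def lift {P M N : GrMod 𝒜} (f : P ⟶ M) (g : P ⟶ N) : P ⟶ M.dsum N :=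
  ⟨f.lin.prod g.lin, fun i x h => ⟨f.map_mem i x h, g.map_mem i x h⟩⟩

/-- The identification `M(p) ⊕ N(p) = (M ⊕ N)(p)`. -/
def twistDsum (M N : GrMod 𝒜) (p : ℤ) : (M.twist p).dsum (N.twist p) ⟶ (M.dsum N).twist p :=
  ⟨LinearMap.id (M := M × N), fun _ _ h => h⟩

/-- The direct sum is a biproduct. -/
def dsumBicone (M N : GrMod 𝒜) : BinaryBicone M N where
  pt := dsum M N
  fst := fst M N
  snd := snd M N
  inl := inl M N
  inr := inr M N
  inl_fst := rfl
  inl_snd := rfl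
  inr_fst := rfl
  inr_snd := rfl

instance : HasBinaryBiproducts (GrMod 𝒜) where
  has_binary_biproduct M N := ⟨⟨⟨dsumBicone M N, isBinaryBilimitOfTotal _ (by
    refine hom_ext fun x => ?_
    exact Prod.ext (add_zero (x : M × N).1) (zero_add (x : M × N).2))⟩⟩⟩

/-- The image of a morphism, as a graded module. -/
def image {M N : GrMod 𝒜} (f : M ⟶ N) : GrMod 𝒜 where
  carrier := LinearMap.range f.lin
  comp i := (N.comp i).comap (LinearMap.range f.lin).subtype.toAddMonoidHom
  isInternal := by
    constructor
    · rw [injective_iff_map_eq_zero]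
      intro x hx
      have g1 : ∀ i y, y ∈ (N.comp i).comap (LinearMap.range f.lin).subtype.toAddMonoidHom →
        (LinearMap.range f.lin).subtype.toAddMonoidHom y ∈ N.comp i := fun i y h => h
      have h1 : compMap _ g1 x = 0 := N.isInternal.1 (by rw [coe_compMap, hx]; rfl)
      ext i
      have := compMap_apply _ g1 x i
      rw [h1] at this
      exact this.symm
    · intro y
      obtain ⟨x, rfl⟩ := f.lin.surjective_rangeRestrict y
      obtain ⟨x, rfl⟩ := M.isInternal.2 x
      exact ⟨compMap f.lin.rangeRestrict.toAddMonoidHom (fun i z h => f.map_mem i z h) x,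
        coe_compMap _ _ x⟩
  smul_mem hx ha := N.smul_mem hx ha
  fg := inferInstance

/-- The zero module. -/
def zeroObj : GrMod 𝒜 where
  carrier := PUnit
  comp _ := ⊥
  isInternal := by
    refine (isInternal_iff _).2 ⟨fun i => by simp, ?_⟩
    ext x; simp
  smul_mem _ _ := by simp
  fg := inferInstance

instance : HasZeroObject (GrMod 𝒜) :=
  ⟨zeroObj, (IsZero.iff_id_eq_zero _).2 rfl⟩

/-- The underlying abelian group. -/
def toAb : GrMod 𝒜 ⥤ AddCommGrpCat.{u} where
  obj M := AddCommGrpCat.of M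
  map f := AddCommGrpCat.ofHom f.lin.toAddMonoidHom

instance : (toAb (𝒜 := 𝒜)).Additive where

end GrMod

section Singularity

variable {k : Type v} [Field k] {R : Type u} [Ring R] [Algebra k R] (𝒜 : ℕ → Submodule k R)

open Pretriangulated ZeroObject

/-- Bounded complexes, in the homotopy category of complexes over `gr-R`. -/
def boundedComplexes : ObjectProperty (HomotopyCategory (GrMod 𝒜) (ComplexShape.up ℤ)) :=
  fun X => ∃ a b : ℤ, CochainComplex.IsStrictlyGE X.as a ∧ CochainComplex.IsStrictlyLE X.as b

lemma boundedComplexes_cone {K L : CochainComplex (GrMod 𝒜) ℤ} (f : K ⟶ L)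
    (hK : boundedComplexes 𝒜 ((HomotopyCategory.quotient _ _).obj K))
    (hL : boundedComplexes 𝒜 ((HomotopyCategory.quotient _ _).obj L)) :
    boundedComplexes 𝒜 ((HomotopyCategory.quotient _ _).obj (CochainComplex.mappingCone f)) := by
  obtain ⟨a, b, ha, hb⟩ := hK
  obtain ⟨c, d, hc, hd⟩ := hL
  change CochainComplex.IsStrictlyGE K a at ha
  change CochainComplex.IsStrictlyLE K b at hb
  change CochainComplex.IsStrictlyGE L c at hc
  change CochainComplex.IsStrictlyLE L d at hd
  refine ⟨min (a - 1) c, max b d,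
    (CochainComplex.isStrictlyGE_iff _ _).2 fun i hi => ?_,
    (CochainComplex.isStrictlyLE_iff _ _).2 fun i hi => ?_⟩
  · exact (CochainComplex.mappingCone.isZero_X_iff f i).2
      ⟨K.isZero_of_isStrictlyGE a _ (by lia), L.isZero_of_isStrictlyGE c _ (by lia)⟩
  · exact (CochainComplex.mappingCone.isZero_X_iff f i).2
      ⟨K.isZero_of_isStrictlyLE b _ (by lia), L.isZero_of_isStrictlyLE d _ (by lia)⟩

instance : (boundedComplexes 𝒜).ContainsZero where
  exists_zero :=
    ⟨(HomotopyCategory.quotient _ _).obj 0, Functor.map_isZero _ (isZero_zero _),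
      0, 0, inferInstanceAs (CochainComplex.IsStrictlyGE (0 : CochainComplex (GrMod 𝒜) ℤ) 0),
      inferInstanceAs (CochainComplex.IsStrictlyLE (0 : CochainComplex (GrMod 𝒜) ℤ) 0)⟩

instance : (boundedComplexes 𝒜).IsStableUnderShift ℤ where
  isStableUnderShiftBy n :=
    { le_shift X hX := by
        obtain ⟨K : CochainComplex _ _, rfl⟩ := X.quotient_obj_surjective
        obtain ⟨a, b, ha, hb⟩ := hX
        change CochainComplex.IsStrictlyGE K a at ha
        change CochainComplex.IsStrictlyLE K b at hb
        rw [ObjectProperty.prop_shift_iff, HomotopyCategory.shift_quotient_obj]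
        exact ⟨a - n, b - n, K.isStrictlyGE_shift a n (a - n) (by lia),
          K.isStrictlyLE_shift b n (b - n) (by lia)⟩ }

instance : (boundedComplexes 𝒜).IsTriangulatedClosed₃ where
  ext₃' T hT h₁ h₂ := by
    obtain ⟨f : T.obj₁.as ⟶ T.obj₂.as, hf⟩ :=
      (HomotopyCategory.quotient _ _).map_surjective T.mor₁
    refine ⟨_, boundedComplexes_cone 𝒜 f h₁ h₂,
      ⟨Triangle.π₃.mapIso (isoTriangleOfIso₁₂ T _ hT
        (HomotopyCategory.mappingCone_triangleh_distinguished f)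
        (Iso.refl _) (Iso.refl _) ?_)⟩⟩
    exact (Category.comp_id _).trans (hf.symm.trans (Category.id_comp _).symm)

instance : (boundedComplexes 𝒜).IsTriangulated where
  toIsTriangulatedClosed₂ := .of_isTriangulatedClosed₃

/-- `K^b(gr-R)`, the homotopy category of bounded complexes over `gr-R`. -/
abbrev HomotopyBounded := (boundedComplexes 𝒜).FullSubcategory

/-- The forgetful functor from `K^b(gr-R)` to the homotopy category of complexes of abelian
groups. -/
noncomputable abbrev HomotopyBounded.toAb :
    HomotopyBounded 𝒜 ⥤ HomotopyCategory AddCommGrpCat.{u} (ComplexShape.up ℤ) :=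
  (boundedComplexes 𝒜).ι ⋙ (GrMod.toAb (𝒜 := 𝒜)).mapHomotopyCategory (ComplexShape.up ℤ)

/-- The exact (acyclic) bounded complexes: those whose underlying complex of abelian groups has
zero cohomology. -/
def acyclicComplexes : ObjectProperty (HomotopyBounded 𝒜) :=
  (HomotopyCategory.subcategoryAcyclic AddCommGrpCat.{u}).inverseImage (HomotopyBounded.toAb 𝒜)

instance : (acyclicComplexes 𝒜).IsTriangulated := by
  dsimp only [acyclicComplexes]; infer_instance

instance : (acyclicComplexes 𝒜).IsClosedUnderIsomorphisms := by
  dsimp only [acyclicComplexes]; infer_instance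

/-- `D^b(gr-R)`, the Verdier quotient of `K^b(gr-R)` by the exact complexes.  (If `R` is
Noetherian then `gr-R` is abelian and this is its bounded derived category.) -/
abbrev DerivedBounded := VerdierQuotient (acyclicComplexes 𝒜)

/-- The localization functor `K^b(gr-R) ⥤ D^b(gr-R)`. -/
noncomputable abbrev DerivedBounded.Q : HomotopyBounded 𝒜 ⥤ DerivedBounded 𝒜 :=
  VerdierQuotient.Q (acyclicComplexes 𝒜)

/-- Bounded complexes of projective objects of `gr-R`. -/
def projectiveComplexes : ObjectProperty (HomotopyCategory (GrMod 𝒜) (ComplexShape.up ℤ)) :=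
  fun X => boundedComplexes 𝒜 X ∧ ∀ i : ℤ, Projective (X.as.X i)

instance : (projectiveComplexes 𝒜).ContainsZero where
  exists_zero := by
    refine ⟨(HomotopyCategory.quotient _ _).obj 0, Functor.map_isZero _ (isZero_zero _),
      ⟨0, 0, inferInstanceAs (CochainComplex.IsStrictlyGE (0 : CochainComplex (GrMod 𝒜) ℤ) 0),
      inferInstanceAs (CochainComplex.IsStrictlyLE (0 : CochainComplex (GrMod 𝒜) ℤ) 0)⟩, ?_⟩
    intro i
    have hz : IsZero ((0 : CochainComplex (GrMod 𝒜) ℤ).X i) :=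
      Functor.map_isZero (HomologicalComplex.eval (GrMod 𝒜) (ComplexShape.up ℤ) i) (isZero_zero _)
    exact ⟨fun _ _ => ⟨0, hz.eq_of_src _ _⟩⟩

instance : (projectiveComplexes 𝒜).IsStableUnderShift ℤ where
  isStableUnderShiftBy n :=
    { le_shift X hX := by
        refine ⟨(boundedComplexes 𝒜).le_shift n _ hX.1, ?_⟩
        obtain ⟨K : CochainComplex _ _, rfl⟩ := X.quotient_obj_surjective
        rw [HomotopyCategory.shift_quotient_obj]
        exact fun i => hX.2 (i + n) }

instance : (projectiveComplexes 𝒜).IsTriangulatedClosed₃ where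
  ext₃' T hT h₁ h₂ := by
    obtain ⟨f : T.obj₁.as ⟶ T.obj₂.as, hf⟩ :=
      (HomotopyCategory.quotient _ _).map_surjective T.mor₁
    refine ⟨_, ⟨boundedComplexes_cone 𝒜 f h₁.1 h₂.1, fun i => ?_⟩,
      ⟨Triangle.π₃.mapIso (isoTriangleOfIso₁₂ T _ hT
        (HomotopyCategory.mappingCone_triangleh_distinguished f)
        (Iso.refl _) (Iso.refl _) ?_)⟩⟩
    · have := h₁.2 (i + 1)
      have := h₂.2 i
      exact Projective.of_iso
        (HomologicalComplex.homotopyCofiber.XIsoBiprod f i (i + 1) rfl).symm inferInstance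
    · exact (Category.comp_id _).trans (hf.symm.trans (Category.id_comp _).symm)

instance : (projectiveComplexes 𝒜).IsTriangulated where
  toIsTriangulatedClosed₂ := .of_isTriangulatedClosed₃

/-- The objects of `K^b(gr-R)` which are homotopy equivalent to a bounded complex of projective
objects of `gr-R`. -/
def perfectHomotopy : ObjectProperty (HomotopyBounded 𝒜) :=
  (projectiveComplexes 𝒜).isoClosure.inverseImage (boundedComplexes 𝒜).ι

instance : (perfectHomotopy 𝒜).IsTriangulated := by
  dsimp only [perfectHomotopy]; infer_instance

lemma projective_lift {P Z Z' Z'' : GrMod 𝒜} [Projective P] (d : Z ⟶ Z') (d' : Z' ⟶ Z'')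
    (hex : ∀ z : Z', d'.lin z = 0 → ∃ y, d.lin y = z) (f : P ⟶ Z') (hf : f ≫ d' = 0) :
    ∃ l : P ⟶ Z, l ≫ d = f := by
  let d₁ : Z ⟶ GrMod.image d := ⟨d.lin.rangeRestrict, fun i x h => d.map_mem i x h⟩
  have hd₁ : Epi d₁ := ⟨fun u v huv => GrMod.hom_ext fun y => by
    obtain ⟨x, rfl⟩ := d.lin.surjective_rangeRestrict y
    exact congrArg (fun t => t.lin x) huv⟩
  let f₁ : P ⟶ GrMod.image d :=
    ⟨f.lin.codRestrict _ (fun x => by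
      obtain ⟨y, hy⟩ := hex (f.lin x) (congrArg (fun t => t.lin x) hf)
      exact ⟨y, hy⟩), fun i x h => f.map_mem i x h⟩
  refine ⟨Projective.factorThru f₁ d₁, GrMod.hom_ext fun x => ?_⟩
  have := congrArg (fun t => t.lin x) (Projective.factorThru_comp f₁ d₁)
  exact congrArg Subtype.val this

/-- A morphism from a bounded complex of projectives to an exact complex is null-homotopic. -/
lemma homotopic_zero {P Z : CochainComplex (GrMod 𝒜) ℤ} (a b : ℤ)
    (ha : P.IsStrictlyGE a) (hb : P.IsStrictlyLE b) (hP : ∀ i, Projective (P.X i))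
    (hZ : ∀ i (z : Z.X i), (Z.d i (i + 1)).lin z = 0 → ∃ y, (Z.d (i - 1) i).lin y = z)
    (f : P ⟶ Z) : Nonempty (Homotopy f 0) := by
  have key : ∀ m : ℕ, ∃ g : P ⟶ Z, Nonempty (Homotopy f g) ∧ ∀ i, b - m < i → g.f i = 0 := by
    intro m
    induction m with
    | zero =>
      exact ⟨f, ⟨Homotopy.refl f⟩, fun i hi =>
        (P.isZero_of_isStrictlyLE b i (by simpa using hi)).eq_of_src _ _⟩
    | succ m ih =>
      obtain ⟨g, ⟨hg⟩, hg0⟩ := ih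
      obtain ⟨l, hl⟩ : ∃ l : P.X (b - m) ⟶ Z.X (b - m - 1),
          l ≫ Z.d (b - m - 1) (b - m) = g.f (b - m) := by
        have := hP (b - m)
        refine projective_lift 𝒜 _ _ (hZ (b - m)) _ ?_
        rw [g.comm, hg0 _ (by lia), comp_zero]
      let h : ∀ i j, (ComplexShape.up ℤ).Rel j i → (P.X i ⟶ Z.X j) := fun i j hij =>
        if hi : i = b - m then
          (P.XIsoOfEq hi).hom ≫ l ≫ (Z.XIsoOfEq (by
            simp only [ComplexShape.up_Rel] at hij; lia)).hom
        else 0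
      refine ⟨g - Homotopy.nullHomotopicMap' h,
        ⟨hg.trans ((Homotopy.equivSubZero).symm ((Homotopy.ofEq (by abel)).trans
          (Homotopy.nullHomotopy' h)))⟩, fun i hi => ?_⟩
      rw [HomologicalComplex.sub_f_apply, Homotopy.nullHomotopicMap'_f (k₂ := i - 1) (k₁ := i) (k₀ := i + 1)
        (by simp) (by simp)]
      have e1 : h (i + 1) i (by simp) = 0 := dif_neg (by lia)
      rw [e1, comp_zero, zero_add]
      by_cases hi' : i = b - m
      · subst hi'
        rw [← hl]
        simp [h]
      · have e2 : h i (i - 1) (by simp) = 0 := dif_neg hi'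
        rw [e2, hg0 i (by lia)]
        simp
  obtain ⟨g, ⟨hg⟩, hg0⟩ := key (b - a + 1).toNat
  refine ⟨hg.trans (Homotopy.ofEq ?_)⟩
  ext1 i
  by_cases hi : i < a
  · exact (P.isZero_of_isStrictlyGE a i hi).eq_of_src _ _
  · exact hg0 i (by lia)

lemma acyclic_exact {Z : CochainComplex (GrMod 𝒜) ℤ}
    (hb : boundedComplexes 𝒜 ((HomotopyCategory.quotient _ _).obj Z))
    (hZ : acyclicComplexes 𝒜 ⟨(HomotopyCategory.quotient _ _).obj Z, hb⟩) (i : ℤ) (z : Z.X i)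
    (hz : (Z.d i (i + 1)).lin z = 0) : ∃ y, (Z.d (i - 1) i).lin y = z := by
  have h : HomotopyCategory.subcategoryAcyclic AddCommGrpCat.{u}
      ((HomotopyCategory.quotient _ _).obj
        ((GrMod.toAb.mapHomologicalComplex (ComplexShape.up ℤ)).obj Z)) := hZ
  rw [HomotopyCategory.quotient_obj_mem_subcategoryAcyclic_iff_exactAt] at h
  have h' := h i
  rw [HomologicalComplex.exactAt_iff' _ (i - 1) i (i + 1) (by simp) (by simp),
    ShortComplex.ab_exact_iff] at h'
  exact h' z hz

lemma hom_eq_zero (X Z : HomotopyBounded 𝒜) (hX : perfectHomotopy 𝒜 X)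
    (hZ : acyclicComplexes 𝒜 Z) (f : X ⟶ Z) : f = 0 := by
  obtain ⟨P, ⟨⟨a, b, ha, hb⟩, hP⟩, ⟨e⟩⟩ := hX
  obtain ⟨Z, hbZ⟩ := Z
  obtain ⟨K : CochainComplex _ _, rfl⟩ := P.quotient_obj_surjective
  obtain ⟨L : CochainComplex _ _, rfl⟩ := Z.quotient_obj_surjective
  obtain ⟨g : K ⟶ L, hg⟩ := (HomotopyCategory.quotient _ _).map_surjective
    (e.inv ≫ (boundedComplexes 𝒜).ι.map f)
  obtain ⟨h⟩ := homotopic_zero 𝒜 a b ha hb hP (acyclic_exact 𝒜 hbZ hZ) g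
  have h0 : e.inv ≫ (boundedComplexes 𝒜).ι.map f = 0 :=
    hg.symm.trans ((HomotopyCategory.eq_of_homotopy _ _ h).trans
      (Functor.map_zero (HomotopyCategory.quotient _ _) _ _))
  apply (boundedComplexes 𝒜).ι.map_injective
  rw [CategoryTheory.Functor.map_zero]
  exact (cancel_epi e.inv).1 (h0.trans comp_zero.symm)

instance : ((perfectHomotopy 𝒜).ι ⋙ DerivedBounded.Q 𝒜).Full where
  map_surjective {X Y} f := by
    obtain ⟨φ, hφ⟩ := Localization.exists_rightFraction (DerivedBounded.Q 𝒜)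
      (acyclicComplexes 𝒜).trW f
    obtain ⟨C, g, h, hT, hC⟩ := φ.hs
    have hg : g = 0 := hom_eq_zero 𝒜 _ _ X.property hC g
    obtain ⟨σ, hσ⟩ : ∃ σ : X.obj ⟶ φ.X', 𝟙 X.obj = σ ≫ φ.s :=
      Triangle.coyoneda_exact₂ _ hT (𝟙 _) (by
        change 𝟙 X.obj ≫ g = 0
        rw [hg, comp_zero])
    refine ⟨ObjectProperty.homMk (σ ≫ φ.f), ?_⟩
    change (DerivedBounded.Q 𝒜).map (σ ≫ φ.f) = f
    have e1 := φ.map_s_comp_map (DerivedBounded.Q 𝒜)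
      (Localization.inverts _ (acyclicComplexes 𝒜).trW)
    rw [← hφ] at e1
    rw [CategoryTheory.Functor.map_comp, ← e1]
    have e2 : (DerivedBounded.Q 𝒜).map σ ≫ (DerivedBounded.Q 𝒜).map φ.s = 𝟙 _ := by
      rw [← CategoryTheory.Functor.map_comp, ← hσ, CategoryTheory.Functor.map_id]
    exact (Category.assoc _ _ _).symm.trans ((congrArg (· ≫ f) e2).trans (Category.id_comp f))

/-- The subcategory of perfect complexes in `D^b(gr-R)`: the objects which are isomorphic, in
`D^b(gr-R)`, to a bounded complex of projective objects of `gr-R`. -/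
def perfectComplexes : ObjectProperty (DerivedBounded 𝒜) :=
  (perfectHomotopy 𝒜).map (DerivedBounded.Q 𝒜)

instance : (perfectComplexes 𝒜).IsTriangulated := by
  rw [perfectComplexes, ← Functor.essImage_ι_comp]
  infer_instance

/-- The graded triangulated category of singularities `D_sg^gr(R) = D^b(gr-R)/D^b(grproj-R)`. -/
abbrev SingularityCategory := VerdierQuotient (perfectComplexes 𝒜)

/-- The localization functor `D^b(gr-R) ⥤ D_sg^gr(R)`. -/
noncomputable abbrev SingularityCategory.Q : DerivedBounded 𝒜 ⥤ SingularityCategory 𝒜 :=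
  VerdierQuotient.Q (perfectComplexes 𝒜)

/-- The functor `gr-R ⥤ K^b(gr-R)` sending a module to the complex concentrated in degree `0`. -/
noncomputable def HomotopyBounded.single : GrMod 𝒜 ⥤ HomotopyBounded 𝒜 :=
  (boundedComplexes 𝒜).lift (HomotopyCategory.singleFunctor (GrMod 𝒜) 0) (fun M =>
    ⟨0, 0, inferInstanceAs
        (CochainComplex.IsStrictlyGE ((CochainComplex.singleFunctor (GrMod 𝒜) 0).obj M) 0),
      inferInstanceAs
        (CochainComplex.IsStrictlyLE ((CochainComplex.singleFunctor (GrMod 𝒜) 0).obj M) 0)⟩)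

/-- The natural functor `gr-R ⥤ D_sg^gr(R)`. -/
noncomputable def toSingularityCategory : GrMod 𝒜 ⥤ SingularityCategory 𝒜 :=
  HomotopyBounded.single 𝒜 ⋙ DerivedBounded.Q 𝒜 ⋙ SingularityCategory.Q 𝒜


end Singularity

section LandauGinzburg

variable {k : Type v} [Field k] {B : Type u} [Ring B] [Algebra k B]

/-- A graded algebra `B = ⨁_{i ≥ 0} B_i` over `k` is connected if `B_0 = k`. -/
def IsConnectedGraded (ℬ : ℕ → Submodule k B) : Prop :=
  Function.Injective (algebraMap k B) ∧ LinearMap.range (Algebra.linearMap k B) = ℬ 0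

/-- The quotient `B/J` by the two-sided ideal `J` generated by `W`; if `W` is central then
`J = WB = BW`. -/
abbrev QuotAlg (W : B) : Type u := (TwoSidedIdeal.span {W}).ringCon.Quotient

/-- The quotient map `B → B/J`. -/
abbrev QuotAlg.mk (W : B) : B →+* QuotAlg W := (TwoSidedIdeal.span {W}).ringCon.mk'

/-- The grading of `B/J` induced from that of `B`: `(B/J)_i` is the image of `B_i`. -/
def quotGrading (ℬ : ℕ → Submodule k B) (W : B) (i : ℕ) : Submodule k (QuotAlg W) :=
  (ℬ i).map ((TwoSidedIdeal.span {W}).ringCon.mkₐ k).toLinearMap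

variable {ℬ : ℕ → Submodule k B}

/-- A graded module is free (of finite rank) if it has a finite basis of homogeneous elements. -/
def GrMod.IsFree (M : GrMod ℬ) : Prop :=
  ∃ (r : ℕ) (b : Module.Basis (Fin r) Bᵐᵒᵖ M), ∀ i, ∃ d : ℤ, b i ∈ M.comp d

lemma GrMod.IsFree.twist {M : GrMod ℬ} (hM : M.IsFree) (p : ℤ) : (M.twist p).IsFree := by
  obtain ⟨r, b, hb⟩ := hM
  refine ⟨r, b, fun i => ?_⟩
  obtain ⟨d, hd⟩ := hb i
  refine ⟨d - p, ?_⟩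
  change b i ∈ M.comp (p + (d - p))
  rwa [add_sub_cancel]

lemma GrMod.IsFree.dsum {M N : GrMod ℬ} (hM : M.IsFree) (hN : N.IsFree) :
    (M.dsum N).IsFree := by
  obtain ⟨r, b, hb⟩ := hM
  obtain ⟨s, c, hc⟩ := hN
  have key : ∀ i, ∃ d, ((b.prod c).reindex finSumFinEquiv) i ∈ (M.comp d).prod (N.comp d) := by
    intro i
    obtain ⟨i, rfl⟩ := finSumFinEquiv.surjective i
    rw [Module.Basis.reindex_apply, Equiv.symm_apply_apply]
    rcases i with i | i
    · obtain ⟨d, hd⟩ := hb i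
      exact ⟨d, by simpa [AddSubgroup.mem_prod] using hd⟩
    · obtain ⟨d, hd⟩ := hc i
      exact ⟨d, by simpa [AddSubgroup.mem_prod] using hd⟩
  exact ⟨r + s, (b.prod c).reindex finSumFinEquiv, key⟩

variable (ℬ) in
/-- Objects of the category `GrPair(W)`: pairs of finitely generated free graded right
`B`-modules with maps `p₁ : P₁ ⟶ P₀` and `p₀ : P₀ ⟶ P₁(n)` such that both compositions
`p₀ p₁` and `p₁(n) p₀` are multiplication by `W`. -/
structure GrPair (n : ℕ) (W : B) where
  P₁ : GrMod ℬ
  P₀ : GrMod ℬ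
  free₁ : P₁.IsFree
  free₀ : P₀.IsFree
  p₁ : P₁ ⟶ P₀
  p₀ : P₀ ⟶ P₁.twist n
  p₀_p₁ : ∀ x : P₁, GrMod.untwist (p₀.lin (p₁.lin x)) = op W • x
  p₁_p₀ : ∀ x : P₀, p₁.lin (GrMod.untwist (p₀.lin x)) = op W • x

namespace GrPair

variable {n : ℕ} {W : B}

/-- Morphisms of `GrPair(W)`. -/
@[ext]
structure Hom (P Q : GrPair ℬ n W) where
  f₁ : P.P₁ ⟶ Q.P₁
  f₀ : P.P₀ ⟶ Q.P₀
  comm₁ : P.p₁ ≫ f₀ = f₁ ≫ Q.p₁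
  comm₀ : P.p₀ ≫ GrMod.twistMap f₁ n = f₀ ≫ Q.p₀

lemma twistMap_comp {M N P : GrMod ℬ} (f : M ⟶ N) (g : N ⟶ P) (p : ℤ) :
    GrMod.twistMap (f ≫ g) p = GrMod.twistMap f p ≫ GrMod.twistMap g p := rfl

lemma Hom.comm₁_apply {P Q : GrPair ℬ n W} (f : Hom P Q) (x : P.P₁) :
    f.f₀.lin (P.p₁.lin x) = Q.p₁.lin (f.f₁.lin x) :=
  congrArg (fun t => t.lin x) f.comm₁

lemma Hom.untwist_comm₀ {P Q : GrPair ℬ n W} (f : Hom P Q) (x : P.P₀) :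
    f.f₁.lin (GrMod.untwist (P.p₀.lin x)) = GrMod.untwist (Q.p₀.lin (f.f₀.lin x)) :=
  congrArg (fun t => t.lin x) f.comm₀

instance : Category (GrPair ℬ n W) where
  Hom := Hom
  id P := ⟨𝟙 _, 𝟙 _, by simp, by
    exact (Category.comp_id _).trans (Category.id_comp _).symm⟩
  comp f g := ⟨f.f₁ ≫ g.f₁, f.f₀ ≫ g.f₀,
    by rw [← Category.assoc, f.comm₁, Category.assoc, g.comm₁, Category.assoc],
    by rw [twistMap_comp, ← Category.assoc, f.comm₀, Category.assoc, g.comm₀, Category.assoc]⟩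
  id_comp f := Hom.ext (Category.id_comp _) (Category.id_comp _)
  comp_id f := Hom.ext (Category.comp_id _) (Category.comp_id _)
  assoc f g h := Hom.ext (Category.assoc _ _ _) (Category.assoc _ _ _)

@[ext]
lemma hom_ext {P Q : GrPair ℬ n W} {f g : P ⟶ Q} (h₁ : f.f₁ = g.f₁) (h₀ : f.f₀ = g.f₀) : f = g :=
  Hom.ext h₁ h₀

@[simp] lemma id_f₁ (P : GrPair ℬ n W) : Hom.f₁ (𝟙 P) = 𝟙 _ := rfl
@[simp] lemma id_f₀ (P : GrPair ℬ n W) : Hom.f₀ (𝟙 P) = 𝟙 _ := rfl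
@[simp] lemma comp_f₁ {P Q R : GrPair ℬ n W} (f : P ⟶ Q) (g : Q ⟶ R) :
    Hom.f₁ (f ≫ g) = f.f₁ ≫ g.f₁ := rfl
@[simp] lemma comp_f₀ {P Q R : GrPair ℬ n W} (f : P ⟶ Q) (g : Q ⟶ R) :
    Hom.f₀ (f ≫ g) = f.f₀ ≫ g.f₀ := rfl

section Additive

variable {P Q : GrPair ℬ n W}

lemma twistMap_zero (M N : GrMod ℬ) (p : ℤ) : GrMod.twistMap (0 : M ⟶ N) p = 0 := rfl
lemma twistMap_add {M N : GrMod ℬ} (f g : M ⟶ N) (p : ℤ) :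
    GrMod.twistMap (f + g) p = GrMod.twistMap f p + GrMod.twistMap g p := rfl
lemma twistMap_neg {M N : GrMod ℬ} (f : M ⟶ N) (p : ℤ) :
    GrMod.twistMap (-f) p = -GrMod.twistMap f p := rfl
lemma twistMap_sub {M N : GrMod ℬ} (f g : M ⟶ N) (p : ℤ) :
    GrMod.twistMap (f - g) p = GrMod.twistMap f p - GrMod.twistMap g p := rfl
lemma twistMap_nsmul {M N : GrMod ℬ} (m : ℕ) (f : M ⟶ N) (p : ℤ) :
    GrMod.twistMap (m • f) p = m • GrMod.twistMap f p := rfl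
lemma twistMap_zsmul {M N : GrMod ℬ} (m : ℤ) (f : M ⟶ N) (p : ℤ) :
    GrMod.twistMap (m • f) p = m • GrMod.twistMap f p := rfl

instance : Zero (P ⟶ Q) := ⟨⟨0, 0, by simp, by simp [twistMap_zero]⟩⟩
instance : Add (P ⟶ Q) := ⟨fun f g => ⟨f.f₁ + g.f₁, f.f₀ + g.f₀,
  by simp [f.comm₁, g.comm₁], by simp [twistMap_add, f.comm₀, g.comm₀]⟩⟩
instance : Neg (P ⟶ Q) := ⟨fun f => ⟨-f.f₁, -f.f₀,
  by simp [f.comm₁], by simp [twistMap_neg, f.comm₀]⟩⟩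
instance : Sub (P ⟶ Q) := ⟨fun f g => ⟨f.f₁ - g.f₁, f.f₀ - g.f₀,
  by simp [f.comm₁, g.comm₁], by simp [twistMap_sub, f.comm₀, g.comm₀]⟩⟩
instance : SMul ℕ (P ⟶ Q) := ⟨fun m f => ⟨m • f.f₁, m • f.f₀,
  by simp [f.comm₁], by simp [twistMap_nsmul, f.comm₀]⟩⟩
instance : SMul ℤ (P ⟶ Q) := ⟨fun m f => ⟨m • f.f₁, m • f.f₀,
  by simp [f.comm₁], by simp [twistMap_zsmul, f.comm₀]⟩⟩

instance : AddCommGroup (P ⟶ Q) :=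
  Function.Injective.addCommGroup
    (fun f : P ⟶ Q => ((f.f₁, f.f₀) : (P.P₁ ⟶ Q.P₁) × (P.P₀ ⟶ Q.P₀)))
    (fun _ _ h => Hom.ext (congrArg Prod.fst h) (congrArg Prod.snd h))
    rfl (fun _ _ => rfl) (fun _ => rfl) (fun _ _ => rfl) (fun _ _ => rfl) (fun _ _ => rfl)

@[simp] lemma zero_f₁ : Hom.f₁ (0 : P ⟶ Q) = 0 := rfl
@[simp] lemma zero_f₀ : Hom.f₀ (0 : P ⟶ Q) = 0 := rfl
@[simp] lemma add_f₁ (f g : P ⟶ Q) : Hom.f₁ (f + g) = f.f₁ + g.f₁ := rfl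
@[simp] lemma add_f₀ (f g : P ⟶ Q) : Hom.f₀ (f + g) = f.f₀ + g.f₀ := rfl
@[simp] lemma neg_f₁ (f : P ⟶ Q) : Hom.f₁ (-f) = -f.f₁ := rfl
@[simp] lemma neg_f₀ (f : P ⟶ Q) : Hom.f₀ (-f) = -f.f₀ := rfl
@[simp] lemma sub_f₁ (f g : P ⟶ Q) : Hom.f₁ (f - g) = f.f₁ - g.f₁ := rfl
@[simp] lemma sub_f₀ (f g : P ⟶ Q) : Hom.f₀ (f - g) = f.f₀ - g.f₀ := rfl

end Additive

instance : Preadditive (GrPair ℬ n W) where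
  add_comp _ _ _ f f' g := hom_ext (Preadditive.add_comp _ _ _ _ _ _) (Preadditive.add_comp _ _ _ _ _ _)
  comp_add _ _ _ f g g' := hom_ext (Preadditive.comp_add _ _ _ _ _ _) (Preadditive.comp_add _ _ _ _ _ _)

/-- A morphism `f = (f₁, f₀)` is null-homotopic if there are degree-zero maps `s : P₀ ⟶ Q₁` and
`t : P₁ ⟶ Q₀(-n)` with `f₁ = q₀(-n) t + s p₁` and `f₀ = t(n) p₀ + q₁ s`. -/
def NullHomotopic {P Q : GrPair ℬ n W} (f : P ⟶ Q) : Prop :=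
  ∃ (s : P.P₀ ⟶ Q.P₁) (t : P.P₁ ⟶ Q.P₀.twist (-n)),
    (∀ x : P.P₁, f.f₁.lin x = GrMod.untwist (Q.p₀.lin (GrMod.untwist (t.lin x))) + s.lin (P.p₁.lin x)) ∧
    (∀ x : P.P₀, f.f₀.lin x = GrMod.untwist (t.lin (GrMod.untwist (P.p₀.lin x))) + Q.p₁.lin (s.lin x))


lemma NullHomotopic.zero (P Q : GrPair ℬ n W) : NullHomotopic (0 : P ⟶ Q) :=
  ⟨0, 0, fun _ => by simp, fun _ => by simp⟩

lemma NullHomotopic.add {P Q : GrPair ℬ n W} {f g : P ⟶ Q} (hf : NullHomotopic f)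
    (hg : NullHomotopic g) : NullHomotopic (f + g) := by
  obtain ⟨s, t, h₁, h₀⟩ := hf
  obtain ⟨s', t', h₁', h₀'⟩ := hg
  refine ⟨s + s', t + t', fun x => ?_, fun x => ?_⟩
  · simp [h₁, h₁']; abel
  · simp [h₀, h₀']; abel

lemma NullHomotopic.neg {P Q : GrPair ℬ n W} {f : P ⟶ Q} (hf : NullHomotopic f) :
    NullHomotopic (-f) := by
  obtain ⟨s, t, h₁, h₀⟩ := hf
  refine ⟨-s, -t, fun x => ?_, fun x => ?_⟩
  · simp [h₁]; abel
  · simp [h₀]; abel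

lemma NullHomotopic.comp {P Q R : GrPair ℬ n W} {f : P ⟶ Q} (hf : NullHomotopic f)
    (g : Q ⟶ R) : NullHomotopic (f ≫ g) := by
  obtain ⟨s, t, h₁, h₀⟩ := hf
  refine ⟨s ≫ g.f₁, t ≫ GrMod.twistMap g.f₀ (-n), fun x => ?_, fun x => ?_⟩
  · simp [h₁, g.untwist_comm₀]
  · simp [h₀, g.comm₁_apply]

lemma NullHomotopic.precomp {P Q R : GrPair ℬ n W} (f : P ⟶ Q) {g : Q ⟶ R}
    (hg : NullHomotopic g) : NullHomotopic (f ≫ g) := by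
  obtain ⟨s, t, h₁, h₀⟩ := hg
  refine ⟨f.f₀ ≫ s, f.f₁ ≫ t, fun x => ?_, fun x => ?_⟩
  · simp [h₁, f.comm₁_apply]
  · simp [h₀, f.untwist_comm₀]

variable (ℬ n W) in
/-- Two morphisms are homotopic if their difference is null-homotopic. -/
def homotopic : HomRel (GrPair ℬ n W) := fun _ _ f g => NullHomotopic (f - g)

instance : Congruence (homotopic ℬ n W) where
  equivalence := {
    refl := fun f => by
      change NullHomotopic (f - f)
      rw [sub_self]; exact NullHomotopic.zero _ _
    symm := fun {f g} h => by
      change NullHomotopic (g - f)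
      rw [← neg_sub]; exact NullHomotopic.neg h
    trans := fun {f g h} h₁ h₂ => by
      change NullHomotopic (f - h)
      rw [← sub_add_sub_cancel f g h]; exact NullHomotopic.add h₁ h₂ }
  comp_left f _ _ h := by
    change NullHomotopic _
    rw [← Preadditive.comp_sub]; exact NullHomotopic.precomp f h
  comp_right g h := by
    change NullHomotopic _
    rw [← Preadditive.sub_comp]; exact NullHomotopic.comp h g

lemma homotopic_add {P Q : GrPair ℬ n W} (f₁ f₂ g₁ g₂ : P ⟶ Q) (hf : homotopic ℬ n W f₁ f₂)
    (hg : homotopic ℬ n W g₁ g₂) : homotopic ℬ n W (f₁ + g₁) (f₂ + g₂) := by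
  change NullHomotopic _
  rw [add_sub_add_comm]
  exact NullHomotopic.add hf hg

/-- The translation `P[1]` of a pair: in terms of the quasi-periodic sequence `K` with
`K^{-1} = P₁`, `K^0 = P₀`, `K^{i+2} = K^i(n)`, it is given by `K[1]^i = K^{i+1}` with the
opposite differential. -/
def shiftObj (P : GrPair ℬ n W) : GrPair ℬ n W where
  P₁ := P.P₀
  P₀ := P.P₁.twist n
  free₁ := P.free₀
  free₀ := P.free₁.twist n
  p₁ := -P.p₀
  p₀ := -GrMod.twistMap P.p₁ n
  p₀_p₁ x := by
    simp [P.p₁_p₀]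
  p₁_p₀ x := by
    have h := P.p₀_p₁ (GrMod.untwist x)
    simp only [GrMod.neg_lin, map_neg, neg_neg, GrMod.untwist_twistMap]
    exact h

/-- The translation functor on `GrPair(W)`. -/
def shift : GrPair ℬ n W ⥤ GrPair ℬ n W where
  obj := shiftObj
  map {P Q} f :=
    { f₁ := f.f₀
      f₀ := GrMod.twistMap f.f₁ n
      comm₁ := GrMod.hom_ext fun (x : P.P₀) => by
        change f.f₁.lin (-GrMod.untwist (P.p₀.lin x)) = -GrMod.untwist (Q.p₀.lin (f.f₀.lin x))
        rw [map_neg, f.untwist_comm₀]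
      comm₀ := GrMod.hom_ext fun (x : P.P₁) => by
        change f.f₀.lin (-P.p₁.lin x) = -Q.p₁.lin (f.f₁.lin x)
        rw [map_neg, f.comm₁_apply] }

lemma NullHomotopic.shift {P Q : GrPair ℬ n W} {f : P ⟶ Q} (hf : NullHomotopic f) :
    NullHomotopic (shift.map f) := by
  obtain ⟨s, t, h₁, h₀⟩ := hf
  refine ⟨⟨(-(GrMod.untwist.comp t.lin)).comp GrMod.untwist, ?_⟩,
    ⟨LinearMap.id (M := Q.P₁) ∘ₗ (-s.lin), ?_⟩, fun (x : P.P₀) => ?_, fun (x : P.P₁) => ?_⟩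
  · intro i x hx
    have h := neg_mem (t.map_mem _ _ hx)
    change _ ∈ Q.P₀.comp (-n + (n + i)) at h
    rwa [neg_add_cancel_left] at h
  · intro i x hx
    have h := neg_mem (s.map_mem _ _ hx)
    change _ ∈ Q.P₁.comp (n + (-n + i))
    rwa [add_neg_cancel_left]
  · change f.f₀.lin x = -Q.p₁.lin (-s.lin x) +
      -GrMod.untwist (t.lin (-GrMod.untwist (P.p₀.lin x)))
    rw [h₀]; simp only [map_neg, neg_neg]; abel
  · change f.f₁.lin x = -s.lin (-P.p₁.lin x) +
      -GrMod.untwist (Q.p₀.lin (-GrMod.untwist (t.lin x)))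
    rw [h₁]; simp only [map_neg, neg_neg]; abel

/-- The mapping cone of a morphism `f : P ⟶ Q`. In terms of the quasi-periodic sequences `K` and
`L` of `P` and `Q`, its terms are `L^i ⊕ K^{i+1}` and its differential is
`(x, y) ↦ (l^i x + f^{i+1} y, - k^{i+1} y)`. -/
def cone {P Q : GrPair ℬ n W} (f : P ⟶ Q) : GrPair ℬ n W where
  P₁ := Q.P₁.dsum P.P₀
  P₀ := Q.P₀.dsum (P.P₁.twist n)
  free₁ := Q.free₁.dsum P.free₀
  free₀ := Q.free₀.dsum (P.free₁.twist n)
  p₁ := GrMod.lift (GrMod.fst _ _ ≫ Q.p₁ + GrMod.snd _ _ ≫ f.f₀) (-(GrMod.snd _ _ ≫ P.p₀))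
  p₀ := GrMod.lift (GrMod.fst _ _ ≫ Q.p₀ + GrMod.snd _ _ ≫ GrMod.twistMap f.f₁ n)
    (-(GrMod.snd _ _ ≫ GrMod.twistMap P.p₁ n)) ≫ GrMod.twistDsum _ _ n
  p₀_p₁ := fun (x : Q.P₁ × P.P₀) => by
    refine Prod.ext ?_ ?_
    · change GrMod.untwist (Q.p₀.lin (Q.p₁.lin x.1 + f.f₀.lin x.2)) +
        f.f₁.lin (-GrMod.untwist (P.p₀.lin x.2)) = op W • x.1
      rw [map_add, map_add, map_neg, f.untwist_comm₀, Q.p₀_p₁]; abel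
    · change -P.p₁.lin (-GrMod.untwist (P.p₀.lin x.2)) = op W • x.2
      rw [map_neg, neg_neg, P.p₁_p₀]
  p₁_p₀ := fun (x : Q.P₀ × P.P₁) => by
    refine Prod.ext ?_ ?_
    · change Q.p₁.lin (GrMod.untwist (Q.p₀.lin x.1) + f.f₁.lin x.2) +
        f.f₀.lin (-P.p₁.lin x.2) = op W • x.1
      rw [map_add, map_neg, f.comm₁_apply, Q.p₁_p₀]; abel
    · change -GrMod.untwist (P.p₀.lin (-P.p₁.lin x.2)) = op W • x.2
      rw [map_neg, map_neg, neg_neg, P.p₀_p₁]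

/-- The morphism `(id, 0) : Q ⟶ C(f)`. -/
def toCone {P Q : GrPair ℬ n W} (f : P ⟶ Q) : Q ⟶ cone f where
  f₁ := GrMod.inl _ _
  f₀ := GrMod.inl _ _
  comm₁ := GrMod.hom_ext fun (x : Q.P₁) => by
    refine Prod.ext ?_ ?_
    · change Q.p₁.lin x = Q.p₁.lin x + f.f₀.lin 0
      rw [map_zero, add_zero]
    · change (0 : P.P₁) = -GrMod.untwist (P.p₀.lin 0)
      rw [map_zero, map_zero, neg_zero]
  comm₀ := GrMod.hom_ext fun (x : Q.P₀) => by
    refine Prod.ext ?_ ?_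
    · change GrMod.untwist (Q.p₀.lin x) = GrMod.untwist (Q.p₀.lin x) + f.f₁.lin 0
      rw [map_zero, add_zero]
    · change (0 : P.P₀) = -P.p₁.lin 0
      rw [map_zero, neg_zero]

/-- The morphism `(0, -id) : C(f) ⟶ P[1]`. -/
def fromCone {P Q : GrPair ℬ n W} (f : P ⟶ Q) : cone f ⟶ shift.obj P where
  f₁ := -GrMod.snd _ _
  f₀ := -GrMod.snd _ _
  comm₁ := GrMod.hom_ext fun (x : Q.P₁ × P.P₀) => by
    change -(-GrMod.untwist (P.p₀.lin x.2)) = -GrMod.untwist (P.p₀.lin (-x.2))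
    rw [map_neg, map_neg]
  comm₀ := GrMod.hom_ext fun (x : Q.P₀ × P.P₁) => by
    change -(-P.p₁.lin x.2) = -P.p₁.lin (-x.2)
    rw [map_neg]

end GrPair

variable (ℬ) in
/-- The category `DGrB(W)` of graded D-branes of type B: pairs, with morphisms of pairs modulo
null-homotopic morphisms. -/
abbrev DGrB (n : ℕ) (W : B) := CategoryTheory.Quotient (GrPair.homotopic ℬ n W)

namespace DGrB

variable {n : ℕ} {W : B}

variable (ℬ n W) in
/-- The quotient functor `GrPair(W) ⥤ DGrB(W)`. -/
abbrev quotient : GrPair ℬ n W ⥤ DGrB ℬ n W :=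
  CategoryTheory.Quotient.functor (GrPair.homotopic ℬ n W)

instance : Preadditive (DGrB ℬ n W) :=
  CategoryTheory.Quotient.preadditive _ (fun _ _ => GrPair.homotopic_add)

variable (ℬ n W) in
/-- The translation functor `[1]` of `DGrB(W)`. -/
def shift : DGrB ℬ n W ⥤ DGrB ℬ n W :=
  CategoryTheory.Quotient.lift _ (GrPair.shift ⋙ quotient ℬ n W) (fun P Q f g h => by
    refine CategoryTheory.Quotient.sound _ ?_
    change GrPair.NullHomotopic (GrPair.shift.map f - GrPair.shift.map g)
    exact GrPair.NullHomotopic.shift h)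

/-- The exact (distinguished) triangles of `DGrB(W)`: those which are isomorphic to a standard
triangle `P ⟶ Q ⟶ C(f) ⟶ P[1]`. -/
def IsDistinguished {X Y Z : DGrB ℬ n W} (u : X ⟶ Y) (v : Y ⟶ Z) (w : Z ⟶ (shift ℬ n W).obj X) :
    Prop :=
  ∃ (P Q : GrPair ℬ n W) (f : P ⟶ Q) (a : X ≅ (quotient ℬ n W).obj P)
    (b : Y ≅ (quotient ℬ n W).obj Q) (c : Z ≅ (quotient ℬ n W).obj (GrPair.cone f)),
    u ≫ b.hom = a.hom ≫ (quotient ℬ n W).map f ∧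
    v ≫ c.hom = b.hom ≫ (quotient ℬ n W).map (GrPair.toCone f) ∧
    w ≫ (shift ℬ n W).map a.hom = c.hom ≫ (quotient ℬ n W).map (GrPair.fromCone f)

/-- A functor from `DGrB(W)` to a triangulated category is exact if it commutes with the
translation functors and sends exact triangles to exact triangles. -/
def IsExact {D : Type*} [Category D] [HasZeroObject D] [HasShift D ℤ] [Preadditive D]
    [∀ n : ℤ, (shiftFunctor D n).Additive] [Pretriangulated D] (F : DGrB ℬ n W ⥤ D) : Prop :=
  ∃ e : shift ℬ n W ⋙ F ≅ F ⋙ shiftFunctor D (1 : ℤ),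
    ∀ (X Y Z : DGrB ℬ n W) (u : X ⟶ Y) (v : Y ⟶ Z) (w : Z ⟶ (shift ℬ n W).obj X),
      IsDistinguished u v w →
        Pretriangulated.Triangle.mk (F.map u) (F.map v) (F.map w ≫ e.hom.app X) ∈
          Pretriangulated.distinguishedTriangles

end DGrB
end LandauGinzburg

section Cokernel

variable {k : Type v} [Field k] {B : Type u} [Ring B] [Algebra k B] {ℬ : ℕ → Submodule k B}
  {n : ℕ} {W : B}

namespace GrPair

variable (P : GrPair ℬ n W)

/-- The cokernel of `p₁ : P₁ ⟶ P₀`, as a `B`-module. -/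
abbrev CokCarrier : Type u := P.P₀ ⧸ LinearMap.range P.p₁.lin

/-- The right action of `B` on the cokernel of `p₁`. -/
def cokAction : B →+* (AddMonoid.End P.CokCarrier)ᵐᵒᵖ :=
  (Module.toAddMonoidEnd Bᵐᵒᵖ P.CokCarrier).op.comp (RingEquiv.opOp B).toRingHom

lemma cokAction_apply (b : B) (x : P.CokCarrier) : (P.cokAction b).unop x = op b • x := rfl

lemma span_le_ker : TwoSidedIdeal.span {W} ≤ TwoSidedIdeal.ker P.cokAction := by
  rw [TwoSidedIdeal.span_le, Set.singleton_subset_iff]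
  change W ∈ TwoSidedIdeal.ker P.cokAction
  rw [TwoSidedIdeal.mem_ker]
  apply unop_injective
  ext x
  obtain ⟨x, rfl⟩ := Submodule.mkQ_surjective _ x
  rw [cokAction_apply, ← map_smul, ← P.p₁_p₀ x]
  exact (Submodule.Quotient.mk_eq_zero _).2 ⟨_, rfl⟩

/-- `W` annihilates the cokernel of `p₁`, so that the action of `B` on it descends to `B/J`. -/
def cokActionQuot : QuotAlg W →+* (AddMonoid.End P.CokCarrier)ᵐᵒᵖ :=
  RingCon.lift _ P.cokAction (by
    intro a b hab
    have h := P.span_le_ker ((TwoSidedIdeal.rel_iff _ a b).1 hab)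
    rw [TwoSidedIdeal.mem_ker, map_sub, sub_eq_zero] at h
    exact h)

instance cokModule : Module (QuotAlg W)ᵐᵒᵖ P.CokCarrier :=
  Module.compHom _ ((RingEquiv.opOp (AddMonoid.End P.CokCarrier)).symm.toRingHom.comp
    P.cokActionQuot.op)

lemma mk_smul (b : B) (x : P.CokCarrier) : op (QuotAlg.mk W b) • x = op b • x := rfl

/-- The cokernel of `p₁`, as a finitely generated graded right `B/J`-module. -/
def cok : GrMod (quotGrading ℬ W) where
  carrier := P.CokCarrier
  comp i := (P.P₀.comp i).map (LinearMap.range P.p₁.lin).mkQ.toAddMonoidHom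
  isInternal := by
    have hq : ∀ i z, z ∈ P.P₀.comp i → (LinearMap.range P.p₁.lin).mkQ.toAddMonoidHom z ∈
        (P.P₀.comp i).map (LinearMap.range P.p₁.lin).mkQ.toAddMonoidHom :=
      fun i z h => ⟨z, h, rfl⟩
    constructor
    · rw [injective_iff_map_eq_zero]
      intro x hx
      obtain ⟨x, rfl⟩ : ∃ y, GrMod.compMap _ hq y = x := by
        refine (DirectSum.map_surjective _).2 (fun i => ?_) x
        rintro ⟨_, z, hz, rfl⟩
        exact ⟨⟨z, hz⟩, rfl⟩
      rw [GrMod.coe_compMap] at hx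
      obtain ⟨y, hy⟩ := (Submodule.Quotient.mk_eq_zero _).1 hx
      obtain ⟨y, rfl⟩ := P.P₁.isInternal.2 y
      have h : GrMod.compMap P.p₁.lin.toAddMonoidHom P.p₁.map_mem y = x :=
        P.P₀.isInternal.1 ((GrMod.coe_compMap _ _ _).trans hy)
      ext i
      have e₁ := GrMod.compMap_apply _ hq x i
      have e₂ := GrMod.compMap_apply P.p₁.lin.toAddMonoidHom P.p₁.map_mem y i
      rw [h] at e₂
      exact e₁.trans ((Submodule.Quotient.mk_eq_zero _).2 ⟨_, e₂.symm⟩)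
    · intro x
      obtain ⟨x, rfl⟩ := Submodule.mkQ_surjective _ x
      obtain ⟨x, rfl⟩ := P.P₀.isInternal.2 x
      exact ⟨GrMod.compMap _ hq x, GrMod.coe_compMap _ _ x⟩
  smul_mem := by
    rintro i j _ _ ⟨x, hx, rfl⟩ ⟨b, hb, rfl⟩
    exact ⟨op b • x, P.P₀.smul_mem hx hb, rfl⟩
  fg := by
    obtain ⟨s, hs⟩ : Module.Finite Bᵐᵒᵖ P.CokCarrier := inferInstance
    refine ⟨⟨s, ?_⟩⟩
    rw [eq_top_iff]
    intro x _
    have hx : x ∈ Submodule.span Bᵐᵒᵖ (s : Set P.CokCarrier) := hs ▸ Submodule.mem_top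
    induction hx using Submodule.span_induction with
    | mem x h => exact Submodule.subset_span h
    | zero => exact zero_mem _
    | add x y _ _ hx hy => exact add_mem (hx trivial) (hy trivial)
    | smul a x _ hx =>
      exact Submodule.smul_mem _ (op (QuotAlg.mk W a.unop)) (hx trivial)

variable (ℬ n W) in
/-- The cokernel functor `Cok : GrPair(W) ⥤ gr-B/J`. -/
def Cok : GrPair ℬ n W ⥤ GrMod (quotGrading ℬ W) where
  obj P := P.cok
  map {P Q} f :=
    let g : P.CokCarrier →ₗ[Bᵐᵒᵖ] Q.CokCarrier :=
      Submodule.mapQ _ _ f.f₀.lin (by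
        rintro _ ⟨x, rfl⟩
        exact ⟨f.f₁.lin x, (f.comm₁_apply x).symm⟩)
    { lin :=
        { toFun := g
          map_add' := g.map_add
          map_smul' := fun a x => by
            obtain ⟨a⟩ := a
            obtain ⟨b, rfl⟩ := RingCon.mk'_surjective (c := (TwoSidedIdeal.span {W}).ringCon) a
            exact g.map_smul (op b) x }
      map_mem := by
        rintro i _ ⟨x, hx, rfl⟩
        exact ⟨f.f₀.lin x, f.f₀.map_mem i x hx, rfl⟩ }
  map_id P := GrMod.hom_ext fun x => by
    obtain ⟨x, rfl⟩ := Submodule.mkQ_surjective _ x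
    rfl
  map_comp f g := GrMod.hom_ext fun x => by
    obtain ⟨x, rfl⟩ := Submodule.mkQ_surjective _ x
    rfl

end GrPair

end Cokernel
end GradedBranes

open GradedBranes

set_option linter.unusedSectionVars false

namespace GradedBranes

namespace GrMod

/-! ### Graded modules: homogeneous lifts, cokernels, epimorphisms. -/

section Basic

variable {k : Type v} [Field k] {R : Type u} [Ring R] [Algebra k R] {𝒜 : ℕ → Submodule k R}

/-! Since `W` is not a zero-divisor, both maps of a pair are injective, and `p₁ : P₁ ⟶ P₀` is a
two-term free resolution of `Cok P` over `B`. Lifting along such resolutions shows that `Cok` is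
full and that a morphism of pairs killed by `Cok` is null-homotopic (`Cok_full`,
`nullHomotopic_of_Cok_map_eq_zero`). Contractible pairs correspond to projective modules: their
cokernels are projective (`projective_cok`), and each projective `A`-module is a retract of the
cokernel of some contractible pair `(L(-n), L, W, id)` (`exists_retract_cok`). Hence `f` is
null-homotopic exactly when `Cok f` factors through a projective module: `DGrB(W)` is a stable
category of cokernels.

To reach the singularity category, one uses the exact sequences `0 ⟶ Cok Q ⟶ Cok C(f) ⟶ Cok P[1] ⟶
0`. For `f = 𝟙` the middle term is projective, and every morphism from `Cok P` to a projective
module extends to it. As every pair is a translation, dimension shifting makes all higher extensions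
of `Cok P` by projective modules vanish; the form needed is that in `D^b` there is no nonzero
morphism from `Cok P` to a bounded complex of projectives in negative degrees
(`hom_eq_zero_of_projective`).

A morphism `Cok P ⟶ N` in the singularity category is a fraction whose cone is a perfect complex
`E`. Cut `E` by stupid truncation at degree `0`. The part in degrees `≥ 0` has no morphisms to
`N⟦1⟧`, and the part in negative degrees receives none from `Cok P`, so the fraction is an honest
morphism. Likewise, a morphism of modules that becomes zero factors through a perfect complex, then
through its part in degrees `≥ 0`, and finally through the projective term in degree `0`; it is
therefore null-homotopic on pairs.

For exactness, the connecting morphism of the sequence of `𝟙 P` is invertible in the singularity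
category, because the middle term vanishes there. It is the translation isomorphism, and naturality
expresses the connecting morphism of every `f` through it.

The ring `A` need not be Noetherian, so kernels may fail to be finitely generated. Exactness is
therefore tested on underlying abelian groups, and the constructions use only images and cokernels.
-/

lemma congr_lin {M N : GrMod 𝒜} {f g : M ⟶ N} (h : f = g) (x : M) : f.lin x = g.lin x := by rw [h]

/-- A homogeneous element of the image has a homogeneous preimage. -/
lemma exists_homogeneous_preimage {M N : GrMod 𝒜} (f : M ⟶ N) (x : M) (i : ℤ)
    (hx : f.lin x ∈ N.comp i) : ∃ y ∈ M.comp i, f.lin y = f.lin x := by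
  obtain ⟨x, rfl⟩ := M.isInternal.2 x
  have e := compMap_apply f.lin.toAddMonoidHom f.map_mem x i
  -- The components of `f x` are the images of those of `x`, and `f x` has only its `i`-th one; so
  -- the component `x i` is the wanted preimage.
  have h : compMap f.lin.toAddMonoidHom f.map_mem x =
      DirectSum.of (fun i => N.comp i) i ⟨_, hx⟩ := by
    apply N.isInternal.1
    exact (coe_compMap f.lin.toAddMonoidHom f.map_mem x).trans
      (DirectSum.coeAddMonoidHom_of N.comp i ⟨_, hx⟩).symm
  rw [h, DirectSum.of_eq_same] at e
  exact ⟨x i, (x i).2, e.symm⟩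

/-- Factorization of a morphism through an injective one. -/
lemma exists_lift_of_injective {L M N : GrMod 𝒜} (f : M ⟶ N) (hf : Function.Injective f.lin)
    (u : L ⟶ N) (h : ∀ x, ∃ y, f.lin y = u.lin x) : ∃ l : L ⟶ M, l ≫ f = u := by
  let e := LinearEquiv.ofInjective f.lin hf
  let w : L →ₗ[Rᵐᵒᵖ] LinearMap.range f.lin := u.lin.codRestrict _ h
  have hw : ∀ x, f.lin (e.symm (w x)) = u.lin x := fun x => by
    have := congrArg Subtype.val (e.apply_symm_apply (w x))
    exact this
  refine ⟨⟨e.symm.toLinearMap.comp w, fun i x hx => ?_⟩, hom_ext hw⟩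
  obtain ⟨y, hy, e'⟩ := exists_homogeneous_preimage f (e.symm (w x)) i
    (by rw [hw]; exact u.map_mem i x hx)
  exact hf e' ▸ hy

/-- An additive map preserves degrees if it does so on a generating family. -/
lemma mem_comp_of_closure {M N : GrMod 𝒜} (g : M →+ N) (S : Set M)
    (hS : AddSubgroup.closure S = ⊤) (h : ∀ x ∈ S, ∃ i, x ∈ M.comp i ∧ g x ∈ N.comp i)
    (i : ℤ) (x : M) (hx : x ∈ M.comp i) : g x ∈ N.comp i := by
  -- `T i` consists of the elements of degree `i` whose image also has degree `i`. The generators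
  -- lie in the `T i`, so every element decomposes along `T`; by uniqueness of components in `M`, a
  -- homogeneous element is its own `T`-component.
  let T : ℤ → AddSubgroup M := fun i => M.comp i ⊓ (N.comp i).comap g
  have hT : (DirectSum.coeAddMonoidHom T).range = ⊤ := by
    rw [eq_top_iff, ← hS, AddSubgroup.closure_le]
    intro x hx
    obtain ⟨i, hi⟩ := h x hx
    exact ⟨DirectSum.of (fun i => T i) i ⟨x, hi⟩, DirectSum.coeAddMonoidHom_of _ _ _⟩
  obtain ⟨t, rfl⟩ : x ∈ (DirectSum.coeAddMonoidHom T).range := by rw [hT]; trivial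
  have hid : ∀ i y, y ∈ T i → AddMonoidHom.id M y ∈ M.comp i := fun i y hy => hy.1
  have e : compMap _ hid t = DirectSum.of (fun i => M.comp i) i ⟨_, hx⟩ :=
    M.isInternal.1 ((coe_compMap _ hid t).trans
      (DirectSum.coeAddMonoidHom_of M.comp i ⟨_, hx⟩).symm)
  have e' := compMap_apply _ hid t i
  rw [e, DirectSum.of_eq_same] at e'
  change DirectSum.coeAddMonoidHom T t = (t i : M) at e'
  rw [e']
  exact (t i).2.2

lemma isIso_of_bijective {M N : GrMod 𝒜} (f : M ⟶ N) (hf : Function.Bijective f.lin) :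
    IsIso f := by
  obtain ⟨l, hl⟩ := exists_lift_of_injective f hf.1 (𝟙 N) (fun x => hf.2 x)
  refine ⟨l, hom_ext fun x => hf.1 ?_, hl⟩
  exact congr_lin hl (f.lin x)

/-- The cokernel of a morphism, as a graded module. -/
def coker {M N : GrMod 𝒜} (f : M ⟶ N) : GrMod 𝒜 where
  carrier := N ⧸ LinearMap.range f.lin
  comp i := (N.comp i).map (LinearMap.range f.lin).mkQ.toAddMonoidHom
  isInternal := by
    have hq : ∀ i z, z ∈ N.comp i → (LinearMap.range f.lin).mkQ.toAddMonoidHom z ∈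
        (N.comp i).map (LinearMap.range f.lin).mkQ.toAddMonoidHom :=
      fun i z h => ⟨z, h, rfl⟩
    constructor
    · rw [injective_iff_map_eq_zero]
      intro x hx
      obtain ⟨x, rfl⟩ : ∃ y, compMap _ hq y = x := by
        refine (DirectSum.map_surjective _).2 (fun i => ?_) x
        rintro ⟨_, z, hz, rfl⟩
        exact ⟨⟨z, hz⟩, rfl⟩
      rw [coe_compMap] at hx
      obtain ⟨y, hy⟩ := (Submodule.Quotient.mk_eq_zero _).1 hx
      obtain ⟨y, rfl⟩ := M.isInternal.2 y
      have h : compMap f.lin.toAddMonoidHom f.map_mem y = x :=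
        N.isInternal.1 ((coe_compMap _ _ _).trans hy)
      ext i
      have e₁ := compMap_apply _ hq x i
      have e₂ := compMap_apply f.lin.toAddMonoidHom f.map_mem y i
      rw [h] at e₂
      exact e₁.trans ((Submodule.Quotient.mk_eq_zero _).2 ⟨_, e₂.symm⟩)
    · intro x
      obtain ⟨x, rfl⟩ := Submodule.mkQ_surjective _ x
      obtain ⟨x, rfl⟩ := N.isInternal.2 x
      exact ⟨compMap _ hq x, coe_compMap _ _ x⟩
  smul_mem := by
    rintro i j _ a ⟨x, hx, rfl⟩ ha
    exact ⟨op a • x, N.smul_mem hx ha, rfl⟩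
  fg := inferInstance

/-- The projection to the cokernel. -/
def cokerπ {M N : GrMod 𝒜} (f : M ⟶ N) : N ⟶ coker f :=
  ⟨(LinearMap.range f.lin).mkQ, fun _ x h => ⟨x, h, rfl⟩⟩

lemma cokerπ_surjective {M N : GrMod 𝒜} (f : M ⟶ N) : Function.Surjective (cokerπ f).lin :=
  Submodule.mkQ_surjective _

lemma cokerπ_eq_zero_iff {M N : GrMod 𝒜} (f : M ⟶ N) (x : N) :
    (cokerπ f).lin x = 0 ↔ ∃ y, f.lin y = x :=
  Submodule.Quotient.mk_eq_zero _

lemma comp_cokerπ {M N : GrMod 𝒜} (f : M ⟶ N) : f ≫ cokerπ f = 0 :=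
  hom_ext fun x => (cokerπ_eq_zero_iff f _).2 ⟨x, rfl⟩

/-- The morphism from the cokernel induced by a morphism which vanishes on the image. -/
def cokerDesc {M N L : GrMod 𝒜} (f : M ⟶ N) (g : N ⟶ L) (h : f ≫ g = 0) : coker f ⟶ L :=
  ⟨(LinearMap.range f.lin).liftQ g.lin (by rintro _ ⟨x, rfl⟩; exact congr_lin h x), by
    rintro i _ ⟨x, hx, rfl⟩
    exact g.map_mem i x hx⟩

lemma cokerπ_desc {M N L : GrMod 𝒜} (f : M ⟶ N) (g : N ⟶ L) (h : f ≫ g = 0) :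
    cokerπ f ≫ cokerDesc f g h = g := rfl

lemma cokerπ_desc_assoc {M N L L' : GrMod 𝒜} (f : M ⟶ N) (g : N ⟶ L) (h : f ≫ g = 0)
    (g' : L ⟶ L') : cokerπ f ≫ cokerDesc f g h ≫ g' = g ≫ g' := rfl

lemma epi_of_surjective {M N : GrMod 𝒜} (f : M ⟶ N) (hf : Function.Surjective f.lin) : Epi f :=
  ⟨fun u v huv => hom_ext fun y => by
    obtain ⟨x, rfl⟩ := hf y
    exact congr_lin huv x⟩

/-- An epimorphism cancels against its cokernel projection. This turns categorical projectivity into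
the usual lifting property along surjections. -/
lemma surjective_of_epi {M N : GrMod 𝒜} (f : M ⟶ N) [Epi f] : Function.Surjective f.lin := by
  have h : cokerπ f = 0 := by rw [← cancel_epi f, comp_cokerπ, comp_zero]
  exact fun x => (cokerπ_eq_zero_iff f x).1 (congr_lin h x)

/-- The morphism from a direct sum with given components. -/
def desc {M N P : GrMod 𝒜} (f : M ⟶ P) (g : N ⟶ P) : M.dsum N ⟶ P := fst M N ≫ f + snd M N ≫ g

lemma desc_lin {M N P : GrMod 𝒜} (f : M ⟶ P) (g : N ⟶ P) (x : M) (y : N) :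
    (desc f g).lin (x, y) = f.lin x + g.lin y := rfl

end Basic

/-! ### Free graded modules: lifting and finite free covers. -/

section Free

variable {k : Type v} [Field k] {B : Type u} [Ring B] [Algebra k B] {ℬ : ℕ → Submodule k B}

variable [GradedAlgebra ℬ]

/-- Splitting scalars into homogeneous parts turns `B`-generators into additive generators, the form
that `mem_comp_of_closure` asks for. -/
lemma closure_smul_homogeneous (M : GrMod ℬ) (s : Set M) (hs : Submodule.span Bᵐᵒᵖ s = ⊤) :
    AddSubgroup.closure {x : M | ∃ y ∈ s, ∃ j, ∃ a ∈ ℬ j, x = op a • y} = ⊤ := by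
  rw [eq_top_iff]
  intro x _
  have hx : x ∈ Submodule.span Bᵐᵒᵖ s := hs ▸ Submodule.mem_top
  induction hx using Submodule.closure_induction with
  | zero => exact zero_mem _
  | add x y _ _ hx hy => exact add_mem (hx trivial) (hy trivial)
  | smul_mem c y hy =>
    obtain ⟨c, rfl⟩ := op_surjective c
    induction c using DirectSum.Decomposition.inductionOn ℬ with
    | zero => rw [MulOpposite.op_zero, zero_smul]; exact zero_mem _
    | homogeneous a => exact AddSubgroup.subset_closure ⟨y, hy, _, a, a.2, rfl⟩
    | add a b ha hb =>
      rw [MulOpposite.op_add, add_smul]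
      exact add_mem (ha trivial) (hb trivial)

/-- Morphisms from a free graded module lift along morphisms with large enough image. -/
lemma IsFree.exists_lift {L M N : GrMod ℬ}
    (hL : L.IsFree) (f : M ⟶ N) (u : L ⟶ N)
    (h : ∀ x, ∃ y, f.lin y = u.lin x) : ∃ l : L ⟶ M, l ≫ f = u := by
  obtain ⟨r, b, hb⟩ := hL
  choose d hd using hb
  have h' : ∀ i, ∃ y ∈ M.comp (d i), f.lin y = u.lin (b i) := fun i => by
    obtain ⟨y, hy⟩ := h (b i)
    obtain ⟨z, hz, e⟩ := exists_homogeneous_preimage f y (d i)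
      (by rw [hy]; exact u.map_mem _ _ (hd i))
    exact ⟨z, hz, e.trans hy⟩
  choose y hy e using h'
  let l : L →ₗ[Bᵐᵒᵖ] M := b.constr ℕ y
  have hl : ∀ i, l (b i) = y i := fun i => b.constr_basis ℕ y i
  refine ⟨⟨l, mem_comp_of_closure l.toAddMonoidHom _
    (closure_smul_homogeneous L (Set.range b) b.span_eq) ?_⟩, hom_ext fun x => ?_⟩
  · rintro _ ⟨_, ⟨i, rfl⟩, j, a, ha, rfl⟩
    refine ⟨d i + j, L.smul_mem (hd i) ha, ?_⟩
    change l (op a • b i) ∈ _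
    rw [map_smul, hl]
    exact M.smul_mem (hy i) ha
  · have : f.lin ∘ₗ l = u.lin := b.ext fun i => by simp [hl, e]
    exact LinearMap.congr_fun this x

variable (B) in
/-- `B` as a right module over itself, as the left module `Bᵐᵒᵖ` over itself. -/
def unopLinearEquiv : Bᵐᵒᵖ ≃ₗ[Bᵐᵒᵖ] B :=
  { opAddEquiv.symm with map_smul' := fun _ _ => rfl }

/-- The grading of `B` indexed by `ℤ`. -/
def intGrading (ℬ : ℕ → Submodule k B) : ℤ → AddSubgroup B
  | Int.ofNat j => (ℬ j).toAddSubgroup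
  | Int.negSucc _ => ⊥

/-- `B` as a graded right module over itself. -/
def regular : GrMod ℬ where
  carrier := B
  comp := intGrading ℬ
  isInternal := by
    refine (isInternal_iff _).2 ⟨?_, ?_⟩
    · intro i
      cases i with
      | negSucc i => exact disjoint_bot_left
      | ofNat i =>
        rw [AddSubgroup.disjoint_def]
        intro x hx hx'
        have h := (DirectSum.Decomposition.isInternal ℬ).submodule_iSupIndep i
        refine (Submodule.disjoint_def.1 h) x hx ?_
        have h' : (⨆ (j : ℤ) (_ : j ≠ Int.ofNat i), intGrading ℬ j) ≤
            (⨆ (j : ℕ) (_ : j ≠ i), ℬ j).toAddSubgroup := by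
          refine iSup₂_le fun j hj => ?_
          cases j with
          | negSucc j => exact bot_le
          | ofNat j =>
            exact fun y hy => Submodule.mem_iSup_of_mem j
              (Submodule.mem_iSup_of_mem (fun e => hj (by rw [e])) hy)
        exact h' hx'
    · rw [eq_top_iff]
      intro x _
      induction x using DirectSum.Decomposition.inductionOn ℬ with
      | zero => exact zero_mem _
      | homogeneous a => exact AddSubgroup.mem_iSup_of_mem (Int.ofNat _) a.2
      | add a b ha hb => exact add_mem (ha trivial) (hb trivial)
  smul_mem := by
    intro i j x a hx ha
    cases i with
    | ofNat i => exact SetLike.mul_mem_graded (A := ℬ) hx ha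
    | negSucc i =>
      obtain rfl : x = 0 := hx
      rw [smul_zero]
      exact zero_mem _
  fg := Module.Finite.equiv (unopLinearEquiv B)

lemma regular_isFree : (regular : GrMod ℬ).IsFree :=
  ⟨1, (Module.Basis.singleton (Fin 1) Bᵐᵒᵖ).map (unopLinearEquiv B), fun i => ⟨0, by
    have e : (Module.Basis.singleton (Fin 1) Bᵐᵒᵖ).map (unopLinearEquiv B) i = 1 := by
      rw [Module.Basis.map_apply, Module.Basis.singleton_apply]; rfl
    refine (congrArg (· ∈ intGrading ℬ 0) e).mpr ?_
    exact SetLike.GradedOne.one_mem (A := ℬ)⟩⟩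

/-- The morphism `B(-d) ⟶ M` given by an element of degree `d`. -/
def regularDesc (M : GrMod ℬ) (d : ℤ) (x : M) (hx : x ∈ M.comp d) :
    (regular : GrMod ℬ).twist (-d) ⟶ M where
  lin := (LinearMap.toSpanSingleton Bᵐᵒᵖ M x).comp (unopLinearEquiv B).symm.toLinearMap
  map_mem := by
    intro i (b : B) hb
    change op b • x ∈ _
    change b ∈ intGrading ℬ (-d + i) at hb
    generalize hj : -d + i = j at hb
    cases j with
    | ofNat j =>
      have := M.smul_mem hx hb
      rwa [show d + (j : ℤ) = i by rw [Int.ofNat_eq_natCast] at hj; lia] at this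
    | negSucc j =>
      obtain rfl : b = 0 := hb
      rw [MulOpposite.op_zero, zero_smul]
      exact zero_mem _

lemma regularDesc_one (M : GrMod ℬ) (d : ℤ) (x : M) (hx : x ∈ M.comp d) :
    (regularDesc M d x hx).lin (1 : B) = x := one_smul _ x

lemma zeroObj_isFree : (zeroObj : GrMod ℬ).IsFree :=
  ⟨0, Module.Basis.empty (M := PUnit.{u + 1}) (R := Bᵐᵒᵖ), fun i => i.elim0⟩

/-- Every finitely generated graded module is a quotient of a free one of finite rank. -/
lemma exists_free_cover (M : GrMod ℬ) :
    ∃ (L : GrMod ℬ) (_ : L.IsFree) (f : L ⟶ M), Function.Surjective f.lin := by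
  have key : ∀ s : List M, (∀ x ∈ s, ∃ d, x ∈ M.comp d) →
      ∃ (L : GrMod ℬ) (_ : L.IsFree) (f : L ⟶ M), ∀ x ∈ s, x ∈ LinearMap.range f.lin := by
    intro s
    induction s with
    | nil => exact fun _ => ⟨zeroObj, zeroObj_isFree, 0, by simp⟩
    | cons x s ih =>
      intro hs
      obtain ⟨L, hL, f, hf⟩ := ih fun y hy => hs y (List.mem_cons_of_mem _ hy)
      obtain ⟨d, hd⟩ := hs x List.mem_cons_self
      refine ⟨(regular.twist (-d)).dsum L, (regular_isFree.twist _).dsum hL,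
        desc (regularDesc M d x hd) f, fun y hy => ?_⟩
      rcases List.mem_cons.1 hy with rfl | hy
      · refine ⟨((1 : B), (0 : L)), (desc_lin _ _ _ _).trans ?_⟩
        rw [map_zero, add_zero]
        exact regularDesc_one _ _ _ _
      · obtain ⟨z, hz⟩ := hf y hy
        refine ⟨((0 : B), z), (desc_lin _ _ _ _).trans ?_⟩
        rw [hz]
        erw [map_zero]
        rw [zero_add]
  -- Homogeneous elements span, so finite generation allows a finite set of homogeneous generators.
  have hspan : Submodule.span Bᵐᵒᵖ {x : M | ∃ d, x ∈ M.comp d} = ⊤ := by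
    rw [eq_top_iff]
    intro x _
    obtain ⟨x, rfl⟩ := M.isInternal.2 x
    induction x using DirectSum.induction_on with
    | zero => rw [map_zero]; exact zero_mem _
    | of i x => rw [DirectSum.coeAddMonoidHom_of]; exact Submodule.subset_span ⟨i, x.2⟩
    | add x y hx hy => rw [map_add]; exact add_mem (hx trivial) (hy trivial)
  have hfg := M.fg.fg_top
  rw [← hspan, Submodule.fg_span_iff_fg_span_finset_subset] at hfg
  obtain ⟨s, hs, e⟩ := hfg
  obtain ⟨L, hL, f, hf⟩ := key s.toList fun x hx => hs (Finset.mem_toList.1 hx)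
  refine ⟨L, hL, f, ?_⟩
  rw [← LinearMap.range_eq_top, eq_top_iff, ← hspan, e, Submodule.span_le]
  exact fun x hx => hf x (Finset.mem_toList.2 hx)

end Free
end GrMod
end GradedBranes

namespace GradedBranes

/-! ### Pairs, their cokernels, contractibility and projectivity. -/

section Pairs

variable {k : Type v} [Field k] {B : Type u} [Ring B] [Algebra k B] {ℬ : ℕ → Submodule k B}

/-- In the coordinates of a basis, the action of `op W` is right multiplication by `W` on `B`. -/
lemma GrMod.IsFree.smul_injective {L : GrMod ℬ} (hL : L.IsFree) {W : B}
    (hreg : ∀ b : B, b * W = 0 → b = 0) (x : L) (hx : op W • x = 0) : x = 0 := by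
  obtain ⟨r, b, -⟩ := hL
  refine b.ext_elem fun i => ?_
  rw [map_zero, Finsupp.zero_apply]
  apply unop_injective
  refine hreg _ (op_injective ?_)
  have := congrArg (fun z => b.repr z i) hx
  rwa [map_smul, map_zero] at this

namespace GrPair

variable {n : ℕ} {W : B}

section Injective

variable (hreg : ∀ b : B, b * W = 0 → b = 0) (P : GrPair ℬ n W)
include hreg

/-- Followed by `p₀` this is multiplication by `W`, which is injective on a free module; the same
argument works for `p₀`. -/
lemma p₁_injective : Function.Injective P.p₁.lin := by
  rw [injective_iff_map_eq_zero]
  intro x hx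
  refine P.free₁.smul_injective hreg x ?_
  rw [← P.p₀_p₁, hx, map_zero, map_zero]

lemma p₀_injective (x : P.P₀) (hx : GrMod.untwist (P.p₀.lin x) = 0) : x = 0 := by
  refine P.free₀.smul_injective hreg x ?_
  rw [← P.p₁_p₀, hx, map_zero]

end Injective

lemma quotAlg_mk_self : QuotAlg.mk W W = 0 := by
  change ((W : B) : QuotAlg W) = ((0 : B) : QuotAlg W)
  rw [RingCon.eq]
  exact (TwoSidedIdeal.rel_iff _ _ _).2 (by
    rw [sub_zero]; exact TwoSidedIdeal.subset_span (Set.mem_singleton W))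

/-- A graded `B/J`-module, considered as a graded `B`-module. -/
def restrict (M : GrMod (quotGrading ℬ W)) : GrMod ℬ where
  carrier := M
  module := Module.compHom M (QuotAlg.mk W).op
  comp := M.comp
  isInternal := M.isInternal
  smul_mem {i j x a} hx ha := M.smul_mem (a := QuotAlg.mk W a) hx ⟨a, ha, rfl⟩
  fg := by
    let _ : Module Bᵐᵒᵖ M := Module.compHom M (QuotAlg.mk W).op
    obtain ⟨s, hs⟩ := M.fg.fg_top
    refine ⟨⟨s, ?_⟩⟩
    rw [eq_top_iff]
    intro x _
    have hx : x ∈ Submodule.span (QuotAlg W)ᵐᵒᵖ (s : Set M) := hs ▸ Submodule.mem_top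
    induction hx using Submodule.span_induction with
    | mem x h => exact Submodule.subset_span h
    | zero => exact zero_mem _
    | add x y _ _ hx hy => exact add_mem (hx trivial) (hy trivial)
    | smul a x _ hx =>
      obtain ⟨b, hb⟩ := RingCon.mk'_surjective (c := (TwoSidedIdeal.span {W}).ringCon) a.unop
      have e : a • x = op b • x := by
        change a • x = op (QuotAlg.mk W b) • x
        rw [show op (QuotAlg.mk W b) = a from congrArg op hb]
      rw [e]
      exact Submodule.smul_mem _ (op b) (hx trivial)

lemma restrict_smul (M : GrMod (quotGrading ℬ W)) (x : restrict M) : op W • x = 0 := by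
  have h : op (QuotAlg.mk W W) • (show M.carrier from x) = 0 := by
    rw [quotAlg_mk_self, MulOpposite.op_zero, zero_smul]
  exact h

/-- A morphism of graded `B/J`-modules, considered as a morphism of graded `B`-modules. -/
def restrictMap {M N : GrMod (quotGrading ℬ W)} (f : M ⟶ N) : restrict M ⟶ restrict N where
  lin :=
    { toFun := f.lin
      map_add' := f.lin.map_add
      map_smul' := fun a x => f.lin.map_smul (op (QuotAlg.mk W a.unop)) x }
  map_mem := f.map_mem

/-- The projection `P₀ ⟶ Cok P`. -/
def cokProj (P : GrPair ℬ n W) : P.P₀ ⟶ restrict P.cok where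
  lin :=
    { toFun := (LinearMap.range P.p₁.lin).mkQ
      map_add' := map_add _
      map_smul' := fun a x => map_smul (LinearMap.range P.p₁.lin).mkQ a x }
  map_mem _ x hx := ⟨x, hx, rfl⟩

lemma cokProj_surjective (P : GrPair ℬ n W) (x : P.cok) : ∃ y, P.cokProj.lin y = x :=
  Submodule.mkQ_surjective _ x

lemma cokProj_eq_zero_iff (P : GrPair ℬ n W) (x : P.P₀) :
    P.cokProj.lin x = 0 ↔ ∃ y, P.p₁.lin y = x :=
  Submodule.Quotient.mk_eq_zero _

lemma Cok_map_cokProj {P Q : GrPair ℬ n W} (f : P ⟶ Q) (x : P.P₀) :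
    ((Cok ℬ n W).map f).lin (P.cokProj.lin x) = Q.cokProj.lin (f.f₀.lin x) := rfl

lemma Cok_hom_ext {P : GrPair ℬ n W} {M : GrMod (quotGrading ℬ W)} {f g : P.cok ⟶ M}
    (h : ∀ x, f.lin (P.cokProj.lin x) = g.lin (P.cokProj.lin x)) : f = g :=
  GrMod.hom_ext fun x => by
    obtain ⟨y, rfl⟩ := P.cokProj_surjective x
    exact h y

instance : (Cok ℬ n W).Additive where
  map_add {P Q f g} := Cok_hom_ext fun x => by
    exact map_add Q.cokProj.lin (f.f₀.lin x) (g.f₀.lin x)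

/-- The morphism from the cokernel induced by a morphism which vanishes on the image of `p₁`. -/
def cokDesc {P : GrPair ℬ n W} {M : GrMod (quotGrading ℬ W)} (v : P.P₀ ⟶ restrict M)
    (hv : ∀ x, v.lin (P.p₁.lin x) = 0) : P.cok ⟶ M :=
  let g : P.CokCarrier →ₗ[Bᵐᵒᵖ] restrict M :=
    (LinearMap.range P.p₁.lin).liftQ v.lin (by rintro _ ⟨x, rfl⟩; exact hv x)
  { lin :=
      { toFun := g
        map_add' := g.map_add
        map_smul' := fun a x => by
          obtain ⟨a⟩ := a
          obtain ⟨b, rfl⟩ := RingCon.mk'_surjective (c := (TwoSidedIdeal.span {W}).ringCon) a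
          exact g.map_smul (op b) x }
    map_mem := by
      rintro i _ ⟨x, hx, rfl⟩
      exact v.map_mem i x hx }

lemma NullHomotopic.of_id_right {P Q : GrPair ℬ n W} (h : NullHomotopic (𝟙 Q)) (f : P ⟶ Q) :
    NullHomotopic f := by
  rw [← Category.comp_id f]; exact h.precomp f

/-- A null-homotopic morphism extends to the cone of the identity. -/
lemma NullHomotopic.exists_extension {P Q : GrPair ℬ n W} {f : P ⟶ Q} (h : NullHomotopic f) :
    ∃ g : cone (𝟙 P) ⟶ Q, toCone (𝟙 P) ≫ g = f := by
  obtain ⟨s, t, h₁, h₀⟩ := h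
  -- A morphism out of `C(𝟙)` extending `f` is `f` on the first summands together with a homotopy
  -- from `f` to zero on the second ones; `t'` is `t(n)`.
  let t' : P.P₁.twist n ⟶ Q.P₀ :=
    ⟨(GrMod.untwist.comp t.lin).comp GrMod.untwist, fun i x hx => by
      have h := t.map_mem _ _ hx
      change _ ∈ Q.P₀.comp (-n + (n + i)) at h
      rwa [neg_add_cancel_left] at h⟩
  refine ⟨⟨GrMod.desc f.f₁ s, GrMod.desc f.f₀ t', GrMod.hom_ext fun (x : P.P₁ × P.P₀) => ?_,
    GrMod.hom_ext fun (x : P.P₀ × P.P₁) => ?_⟩, GrPair.hom_ext (GrMod.hom_ext fun x => ?_)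
    (GrMod.hom_ext fun x => ?_)⟩
  · change f.f₀.lin (P.p₁.lin x.1 + x.2) +
      GrMod.untwist (t.lin (-GrMod.untwist (P.p₀.lin x.2))) = Q.p₁.lin (f.f₁.lin x.1 + s.lin x.2)
    rw [map_add, map_add, f.comm₁_apply, h₀, map_neg, map_neg]
    abel
  · change f.f₁.lin (GrMod.untwist (P.p₀.lin x.1) + x.2) +
      s.lin (-P.p₁.lin x.2) = GrMod.untwist (Q.p₀.lin (f.f₀.lin x.1 + GrMod.untwist (t.lin x.2)))
    rw [map_add, map_add, map_add, f.untwist_comm₀, h₁, map_neg]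
    abel
  · change f.f₁.lin x + s.lin 0 = f.f₁.lin x
    rw [map_zero, add_zero]
  · change f.f₀.lin x + GrMod.untwist (t.lin 0) = f.f₀.lin x
    rw [map_zero, map_zero, add_zero]

/-- The contraction sends the `P` summand identically onto the `P[1]` summand and kills the latter.
-/
lemma cone_id_contractible (P : GrPair ℬ n W) : NullHomotopic (𝟙 (cone (𝟙 P))) := by
  refine ⟨GrMod.fst _ _ ≫ GrMod.inr _ _, ⟨(LinearMap.inr Bᵐᵒᵖ P.P₀ P.P₁).comp
    (LinearMap.fst Bᵐᵒᵖ P.P₁ P.P₀), fun i (x : P.P₁ × P.P₀) hx => ?_⟩,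
    fun (x : P.P₁ × P.P₀) => ?_, fun (x : P.P₀ × P.P₁) => ?_⟩
  · refine ⟨zero_mem _, ?_⟩
    change x.1 ∈ P.P₁.comp (n + (-n + i))
    rw [add_neg_cancel_left]
    exact hx.1
  · refine Prod.ext ?_ ?_
    · change x.1 = (GrMod.untwist (P.p₀.lin 0) + x.1) + (0 : P.P₁)
      rw [map_zero, map_zero, zero_add, add_zero]
    · change x.2 = -P.p₁.lin x.1 + (P.p₁.lin x.1 + x.2)
      abel
  · refine Prod.ext ?_ ?_
    · change x.1 = (0 : P.P₀) + (P.p₁.lin 0 + x.1)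
      rw [map_zero, zero_add, zero_add]
    · change x.2 = (GrMod.untwist (P.p₀.lin x.1) + x.2) + -GrMod.untwist (P.p₀.lin x.1)
      abel

section Graded

variable [GradedAlgebra ℬ]

/-- A lift `u` of `T.cokProj ≫ g` over `B` need not vanish on the image of `p₁`. The contraction
corrects it: `1 - p₁ s` is the identity modulo `p₁`, and it sends `p₁ x` to a multiple of `W`, which
dies in any `B/J`-module. -/
lemma projective_cok {T : GrPair ℬ n W} (hT : NullHomotopic (𝟙 T)) :
    Projective ((Cok ℬ n W).obj T) where
  factors {Y X} g e he := by
    obtain ⟨s, t, -, h₀⟩ := hT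
    have hs := GrMod.surjective_of_epi e
    obtain ⟨u, hu⟩ := T.free₀.exists_lift (restrictMap e) (T.cokProj ≫ restrictMap g)
      (fun x => hs _)
    have hu' : ∀ x, e.lin (u.lin x) = g.lin (T.cokProj.lin x) := fun x => GrMod.congr_lin hu x
    refine ⟨cokDesc ((𝟙 _ - s ≫ T.p₁) ≫ u) fun x => ?_, Cok_hom_ext fun x => ?_⟩
    -- The contraction identity at `p₁ x` reads `p₁ x - p₁ s p₁ x = t p₀ p₁ x = W t x`.
    · have h := h₀ (T.p₁.lin x)
      rw [T.p₀_p₁, map_smul, map_smul] at h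
      change u.lin (T.p₁.lin x - T.p₁.lin (s.lin (T.p₁.lin x))) = 0
      change T.p₁.lin x = _ at h
      rw [← sub_eq_iff_eq_add] at h
      rw [h, map_smul]
      exact restrict_smul _ _
    · change e.lin (u.lin (x - T.p₁.lin (s.lin x))) = g.lin (T.cokProj.lin x)
      rw [hu', map_sub, (T.cokProj_eq_zero_iff _).2 ⟨_, rfl⟩, sub_zero]

/-- Freeness lifts a morphism of cokernels to `f₀`, then to `f₁`, giving the first square. The
second square holds after composing with the injective `q₁`, since both sides become multiplication
by `W` followed by `f₀`. -/
lemma Cok_full (hreg : ∀ b : B, b * W = 0 → b = 0) : (Cok ℬ n W).Full where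
  map_surjective {P Q} g := by
    obtain ⟨f₀, h₀⟩ := P.free₀.exists_lift Q.cokProj (P.cokProj ≫ restrictMap g)
      (fun x => Q.cokProj_surjective _)
    have h₀' : ∀ x, Q.cokProj.lin (f₀.lin x) = g.lin (P.cokProj.lin x) :=
      fun x => GrMod.congr_lin h₀ x
    obtain ⟨f₁, h₁⟩ := P.free₁.exists_lift Q.p₁ (P.p₁ ≫ f₀) (fun x => by
      refine (Q.cokProj_eq_zero_iff _).1 ?_
      refine (h₀' _).trans ?_
      rw [(P.cokProj_eq_zero_iff _).2 ⟨x, rfl⟩]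
      exact map_zero g.lin)
    have h₁' : ∀ x, Q.p₁.lin (f₁.lin x) = f₀.lin (P.p₁.lin x) := fun x => GrMod.congr_lin h₁ x
    refine ⟨⟨f₁, f₀, h₁.symm, GrMod.hom_ext fun x => ?_⟩, Cok_hom_ext fun x => h₀' x⟩
    refine Q.p₁_injective hreg ?_
    change Q.p₁.lin (f₁.lin (GrMod.untwist (P.p₀.lin x))) =
      Q.p₁.lin (GrMod.untwist (Q.p₀.lin (f₀.lin x)))
    rw [h₁', P.p₁_p₀, Q.p₁_p₀, map_smul]

/-- The map `f₀` lands in the image of `q₁`, hence equals `q₁ s` by freeness of `P₀`. Then `t = 0`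
suffices: `f₁ = s p₁` follows on cancelling `q₁`. -/
lemma nullHomotopic_of_Cok_map_eq_zero (hreg : ∀ b : B, b * W = 0 → b = 0) {P Q : GrPair ℬ n W}
    (f : P ⟶ Q) (hf : (Cok ℬ n W).map f = 0) : NullHomotopic f := by
  obtain ⟨s, hs⟩ := P.free₀.exists_lift Q.p₁ f.f₀ (fun x =>
    (Q.cokProj_eq_zero_iff _).1 (GrMod.congr_lin hf (P.cokProj.lin x)))
  have hs' : ∀ x, Q.p₁.lin (s.lin x) = f.f₀.lin x := fun x => GrMod.congr_lin hs x
  refine ⟨s, 0, fun x => ?_, fun x => ?_⟩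
  · refine Q.p₁_injective hreg ?_
    rw [GrMod.zero_lin, map_zero, map_zero, map_zero, zero_add, hs', f.comm₁_apply]
  · rw [GrMod.zero_lin, map_zero, zero_add, hs']

section Trivial

variable (hcentral : ∀ b : B, W * b = b * W) (hWn : W ∈ ℬ n)

/-- The contractible pair `(L(-n), L, W, 1)`. -/
def trivialPair (L : GrMod ℬ) (hL : L.IsFree) : GrPair ℬ n W where
  P₁ := L.twist (-n)
  P₀ := L
  free₁ := hL.twist _
  free₀ := hL
  p₁ :=
    { lin :=
        { toFun := fun x => op W • GrMod.untwist x
          map_add' := fun x y => by rw [map_add, smul_add]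
          map_smul' := fun a x => by
            rw [map_smul, smul_smul, RingHom.id_apply, smul_smul]
            congr 1
            exact unop_injective (hcentral a.unop).symm }
      map_mem := fun i x hx => by
        have := L.smul_mem (x := GrMod.untwist x) hx hWn
        rwa [neg_add_cancel_comm] at this }
  p₀ := ⟨LinearMap.id (M := L), fun i x hx => by
    change x ∈ L.comp (-n + (n + i))
    rwa [neg_add_cancel_left]⟩
  p₀_p₁ _ := rfl
  p₁_p₀ _ := rfl

lemma trivialPair_contractible (L : GrMod ℬ) (hL : L.IsFree) :
    NullHomotopic (𝟙 (trivialPair hcentral hWn L hL)) :=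
  ⟨0, 𝟙 _, fun (x : L) => (add_zero x).symm, fun (x : L) => by
    change x = x + op W • (0 : L)
    rw [smul_zero, add_zero]⟩

include hcentral hWn in
/-- Projective graded `B/J`-modules are retracts of cokernels of contractible pairs. -/
lemma exists_retract_cok (E : GrMod (quotGrading ℬ W)) [Projective E] :
    ∃ (T : GrPair ℬ n W) (_ : NullHomotopic (𝟙 T)) (i : E ⟶ (Cok ℬ n W).obj T)
      (r : (Cok ℬ n W).obj T ⟶ E), i ≫ r = 𝟙 E := by
  obtain ⟨L, hL, f, hf⟩ := GrMod.exists_free_cover (restrict E)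
  let T := trivialPair hcentral hWn L hL
  let r : (Cok ℬ n W).obj T ⟶ E := cokDesc (P := T) f fun x => by
    change f.lin (op W • GrMod.untwist x) = 0
    rw [map_smul]
    exact restrict_smul _ _
  have : Epi r := GrMod.epi_of_surjective r fun x => by
    obtain ⟨y, rfl⟩ := hf x
    exact ⟨T.cokProj.lin y, rfl⟩
  exact ⟨T, trivialPair_contractible hcentral hWn L hL, Projective.factorThru (𝟙 E) r, r,
    Projective.factorThru_comp _ _⟩

include hcentral hWn in
/-- Morphisms from `Cok P` to a projective object extend along `Cok P ⟶ Cok (cone (𝟙 P))`. -/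
lemma exists_extension_to_projective (hreg : ∀ b : B, b * W = 0 → b = 0) (P : GrPair ℬ n W)
    (E : GrMod (quotGrading ℬ W)) [Projective E] (g : (Cok ℬ n W).obj P ⟶ E) :
    ∃ h : (Cok ℬ n W).obj (cone (𝟙 P)) ⟶ E, (Cok ℬ n W).map (toCone (𝟙 P)) ≫ h = g := by
  obtain ⟨T, hT, i, r, hir⟩ := exists_retract_cok hcentral hWn E
  have := Cok_full (ℬ := ℬ) (n := n) hreg
  -- The morphism `g ≫ i` lifts to a morphism of pairs into the contractible `T`; this is
  -- null-homotopic, so it extends to `C(𝟙)`, and `r` brings the extension back to `E`.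
  obtain ⟨γ, hγ⟩ := (Cok ℬ n W).map_surjective (g ≫ i)
  obtain ⟨γ', rfl⟩ := (hT.of_id_right γ).exists_extension
  refine ⟨(Cok ℬ n W).map γ' ≫ r, ?_⟩
  rw [← Category.assoc, ← Functor.map_comp, hγ, Category.assoc, hir, Category.comp_id]

include hcentral hWn in
-- Replacing `E` by the cokernel of a contractible pair lifts the factorization to `γ₁ ≫ γ₂`. This
-- is null-homotopic, and the difference `f - γ₁ ≫ γ₂` is killed by `Cok`.
lemma nullHomotopic_of_Cok_map_eq (hreg : ∀ b : B, b * W = 0 → b = 0) {P Q : GrPair ℬ n W}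
    (f : P ⟶ Q) (E : GrMod (quotGrading ℬ W)) [Projective E] (a : (Cok ℬ n W).obj P ⟶ E)
    (b : E ⟶ (Cok ℬ n W).obj Q)
    (hf : (Cok ℬ n W).map f = a ≫ b) : NullHomotopic f := by
  obtain ⟨T, hT, i, r, hir⟩ := exists_retract_cok hcentral hWn E
  have := Cok_full (ℬ := ℬ) (n := n) hreg
  obtain ⟨γ₁, h₁⟩ := (Cok ℬ n W).map_surjective (a ≫ i)
  obtain ⟨γ₂, h₂⟩ := (Cok ℬ n W).map_surjective (r ≫ b)
  rw [← sub_add_cancel f (γ₁ ≫ γ₂)]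
  refine (nullHomotopic_of_Cok_map_eq_zero hreg _ ?_).add ((hT.of_id_right γ₁).comp γ₂)
  rw [Functor.map_sub, Functor.map_comp, h₁, h₂, hf, Category.assoc, reassoc_of% hir, sub_self]

end Trivial

end Graded

/-! ### The exact sequence of cokernels of a mapping cone. -/

/-- The morphism `(0, id) : C(f) ⟶ P[1]`. -/
def coneπ {P Q : GrPair ℬ n W} (f : P ⟶ Q) : cone f ⟶ shift.obj P := -fromCone f

lemma Cok_toCone_comp_coneπ {P Q : GrPair ℬ n W} (f : P ⟶ Q) :
    (Cok ℬ n W).map (toCone f) ≫ (Cok ℬ n W).map (coneπ f) = 0 :=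
  Cok_hom_ext fun x => by
    refine (congrArg (shift.obj P).cokProj.lin (?_ : -(-(0 : P.P₁)) = 0)).trans (map_zero _)
    rw [neg_zero, neg_zero]

lemma Cok_coneπ_surjective {P Q : GrPair ℬ n W} (f : P ⟶ Q) :
    Function.Surjective ((Cok ℬ n W).map (coneπ f)).lin := fun x => by
  obtain ⟨y : P.P₁, rfl⟩ := (shift.obj P).cokProj_surjective x
  refine ⟨(cone f).cokProj.lin ((0 : Q.P₀), y), ?_⟩
  refine (Cok_map_cokProj _ _).trans (congrArg (shift.obj P).cokProj.lin ?_)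
  exact neg_neg y

/-- If `(x, 0)` is the image of `(a, b)` under the differential of the cone, then `p₀ b = 0`, so `b
= 0` and `x = q₁ a`. -/
lemma Cok_toCone_injective (hreg : ∀ b : B, b * W = 0 → b = 0) {P Q : GrPair ℬ n W} (f : P ⟶ Q) :
    Function.Injective ((Cok ℬ n W).map (toCone f)).lin := by
  rw [injective_iff_map_eq_zero]
  intro x hx
  obtain ⟨x : Q.P₀, rfl⟩ := Q.cokProj_surjective x
  obtain ⟨⟨a, b⟩ : Q.P₁ × P.P₀, hab⟩ := ((cone f).cokProj_eq_zero_iff _).1 hx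
  have h₁ : Q.p₁.lin a + f.f₀.lin b = x := congrArg Prod.fst hab
  have h₂ : -GrMod.untwist (P.p₀.lin b) = 0 := congrArg Prod.snd hab
  have hb := P.p₀_injective hreg b (neg_eq_zero.1 h₂)
  rw [hb, map_zero, add_zero] at h₁
  exact (Q.cokProj_eq_zero_iff x).2 ⟨a, h₁⟩

lemma Cok_cone_exact {P Q : GrPair ℬ n W} (f : P ⟶ Q) (x : (cone f).cok)
    (hx : ((Cok ℬ n W).map (coneπ f)).lin x = 0) :
    ∃ y, ((Cok ℬ n W).map (toCone f)).lin y = x := by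
  obtain ⟨⟨x, y⟩ : Q.P₀ × P.P₁, rfl⟩ := (cone f).cokProj_surjective x
  obtain ⟨b : P.P₀, hb⟩ := ((shift.obj P).cokProj_eq_zero_iff _).1 hx
  have hb' : -GrMod.untwist (P.p₀.lin b) = -(-y) := hb
  -- Here `p₀ b = -y`, so adding the boundary of `(0, -b)` to `(x, y)` removes the second component
  -- and leaves `(x - f₀ b, 0)`.
  refine ⟨Q.cokProj.lin (x - f.f₀.lin b), ?_⟩
  refine (Cok_map_cokProj _ _).trans (sub_eq_zero.1 ?_)
  refine (map_sub (cone f).cokProj.lin _ _).symm.trans (((cone f).cokProj_eq_zero_iff _).2 ?_)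
  refine ⟨(((0 : Q.P₁), -b) : Q.P₁ × P.P₀), Prod.ext ?_ ?_⟩
  · change Q.p₁.lin 0 + f.f₀.lin (-b) = (x - f.f₀.lin b) - x
    rw [map_zero, map_neg]; abel
  · change -GrMod.untwist (P.p₀.lin (-b)) = 0 - y
    rw [map_neg, map_neg, hb']; abel

/-- Functoriality of the cone. -/
def coneMap {P Q P' Q' : GrPair ℬ n W} (f : P ⟶ Q) (f' : P' ⟶ Q') (φ : P ⟶ P') (ψ : Q ⟶ Q')
    (h : f ≫ ψ = φ ≫ f') : cone f ⟶ cone f' where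
  f₁ := GrMod.lift (GrMod.fst _ _ ≫ ψ.f₁) (GrMod.snd _ _ ≫ φ.f₀)
  f₀ := GrMod.lift (GrMod.fst _ _ ≫ ψ.f₀) (GrMod.snd _ _ ≫ GrMod.twistMap φ.f₁ n)
  comm₁ := GrMod.hom_ext fun (x : Q.P₁ × P.P₀) => by
    have h' : ψ.f₀.lin (f.f₀.lin x.2) = f'.f₀.lin (φ.f₀.lin x.2) :=
      GrMod.congr_lin (congrArg Hom.f₀ h) x.2
    refine Prod.ext ?_ ?_
    · change ψ.f₀.lin (Q.p₁.lin x.1 + f.f₀.lin x.2) =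
        Q'.p₁.lin (ψ.f₁.lin x.1) + f'.f₀.lin (φ.f₀.lin x.2)
      rw [map_add, ψ.comm₁_apply, h']
    · change φ.f₁.lin (-GrMod.untwist (P.p₀.lin x.2)) =
        -GrMod.untwist (P'.p₀.lin (φ.f₀.lin x.2))
      rw [map_neg, φ.untwist_comm₀]
  comm₀ := GrMod.hom_ext fun (x : Q.P₀ × P.P₁) => by
    have h' : ψ.f₁.lin (f.f₁.lin x.2) = f'.f₁.lin (φ.f₁.lin x.2) :=
      GrMod.congr_lin (congrArg Hom.f₁ h) x.2
    refine Prod.ext ?_ ?_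
    · change ψ.f₁.lin (GrMod.untwist (Q.p₀.lin x.1) + f.f₁.lin x.2) =
        GrMod.untwist (Q'.p₀.lin (ψ.f₀.lin x.1)) + f'.f₁.lin (φ.f₁.lin x.2)
      rw [map_add, ψ.untwist_comm₀, h']
    · change φ.f₀.lin (-P.p₁.lin x.2) = -P'.p₁.lin (φ.f₁.lin x.2)
      rw [map_neg, φ.comm₁_apply]

lemma toCone_coneMap {P Q P' Q' : GrPair ℬ n W} (f : P ⟶ Q) (f' : P' ⟶ Q') (φ : P ⟶ P')
    (ψ : Q ⟶ Q') (h : f ≫ ψ = φ ≫ f') : toCone f ≫ coneMap f f' φ ψ h = ψ ≫ toCone f' :=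
  GrPair.hom_ext
    (GrMod.hom_ext fun _ => Prod.ext rfl (map_zero φ.f₀.lin))
    (GrMod.hom_ext fun _ => Prod.ext rfl (map_zero φ.f₁.lin))

lemma coneMap_coneπ {P Q P' Q' : GrPair ℬ n W} (f : P ⟶ Q) (f' : P' ⟶ Q') (φ : P ⟶ P')
    (ψ : Q ⟶ Q') (h : f ≫ ψ = φ ≫ f') :
    coneMap f f' φ ψ h ≫ coneπ f' = coneπ f ≫ shift.map φ :=
  GrPair.hom_ext
    (GrMod.hom_ext fun (x : Q.P₁ × P.P₀) => by
      change -(-φ.f₀.lin x.2) = φ.f₀.lin (-(-x.2))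
      rw [neg_neg, neg_neg])
    (GrMod.hom_ext fun (x : Q.P₀ × P.P₁) => by
      change -(-φ.f₁.lin x.2) = φ.f₁.lin (-(-x.2))
      rw [neg_neg, neg_neg])

/-- The translation `P[-1]`. -/
def unshift (P : GrPair ℬ n W) : GrPair ℬ n W where
  P₁ := P.P₀.twist (-n)
  P₀ := P.P₁
  free₁ := P.free₀.twist _
  free₀ := P.free₁
  p₁ := ⟨-(GrMod.untwist.comp (P.p₀.lin.comp GrMod.untwist)), fun i x hx => by
    have h := neg_mem (P.p₀.map_mem _ _ hx)
    change _ ∈ P.P₁.comp (n + (-n + i)) at h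
    rwa [add_neg_cancel_left] at h⟩
  p₀ := ⟨LinearMap.id (M := P.P₀) ∘ₗ (-P.p₁.lin), fun i x hx => by
    have h := neg_mem (P.p₁.map_mem _ _ hx)
    change _ ∈ P.P₀.comp (-n + (n + i))
    rwa [neg_add_cancel_left]⟩
  p₀_p₁ := fun (x : P.P₀) => by
    change -P.p₁.lin (-GrMod.untwist (P.p₀.lin x)) = op W • x
    rw [map_neg, neg_neg, P.p₁_p₀]
  p₁_p₀ x := by
    change -GrMod.untwist (P.p₀.lin (-P.p₁.lin x)) = op W • x
    rw [map_neg, map_neg, neg_neg, P.p₀_p₁]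

/-- `P[-1][1] ≅ P`. -/
def shiftUnshiftIso (P : GrPair ℬ n W) : shift.obj (unshift P) ≅ P where
  hom :=
    { f₁ := 𝟙 P.P₁
      f₀ := ⟨LinearMap.id (M := P.P₀), fun i x hx => by
        change x ∈ P.P₀.comp (-n + (n + i)) at hx
        rwa [neg_add_cancel_left] at hx⟩
      comm₁ := GrMod.hom_ext fun x => neg_neg (P.p₁.lin x)
      comm₀ := GrMod.hom_ext fun x => neg_neg (GrMod.untwist (P.p₀.lin x)) }
  inv :=
    { f₁ := 𝟙 P.P₁
      f₀ := ⟨LinearMap.id (M := P.P₀), fun i x hx => by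
        change x ∈ P.P₀.comp (-n + (n + i))
        rwa [neg_add_cancel_left]⟩
      comm₁ := GrMod.hom_ext fun x => (neg_neg (P.p₁.lin x)).symm
      comm₀ := GrMod.hom_ext fun x => (neg_neg (GrMod.untwist (P.p₀.lin x))).symm }
  hom_inv_id := rfl
  inv_hom_id := rfl

end GrPair

end Pairs

end GradedBranes

namespace GradedBranes

open Pretriangulated ZeroObject

/-! ### Morphisms in a Verdier quotient. -/

section Fractions

variable {C : Type*} [Category C] [HasZeroObject C] [HasShift C ℤ] [Preadditive C]
  [∀ n : ℤ, (shiftFunctor C n).Additive] [Pretriangulated C] [IsTriangulated C]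
  (P : ObjectProperty C) [P.IsTriangulated] {D : Type*} [Category D] (L : C ⥤ D)
  [L.IsLocalization P.trW]

/-- In a left fraction `M ⟶ Y ⟵ N` let `E` be the cone of the denominator. Pushing the triangle
along `p : E ⟶ E'` gives an equivalent fraction with cone `E'`. As `M` has no nonzero morphism to
`E'`, the new numerator factors through the denominator. -/
lemma exists_map_eq_of_factors {M N : C}
    (h : ∀ E, P E → ∀ v : E ⟶ N⟦(1 : ℤ)⟧, ∃ (E' : C) (_ : P E') (p : E ⟶ E')
      (v' : E' ⟶ N⟦(1 : ℤ)⟧), p ≫ v' = v ∧ ∀ w : M ⟶ E', w = 0)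
    (f : L.obj M ⟶ L.obj N) : ∃ g, L.map g = f := by
  obtain ⟨φ, hφ⟩ := Localization.exists_leftFraction L P.trW f
  obtain ⟨E, g, v, hT, hE⟩ := φ.hs
  obtain ⟨E', hE', p, v', hv, hw⟩ := h E hE v
  obtain ⟨Y', s', g', hT'⟩ := distinguished_cocone_triangle₂ v'
  obtain ⟨b, hb, -⟩ : ∃ b : φ.Y' ⟶ Y', φ.s ≫ b = 𝟙 N ≫ s' ∧ g ≫ p = b ≫ g' :=
    complete_distinguished_triangle_morphism₂ _ _ hT hT' (𝟙 N) p (by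
      change v ≫ (𝟙 N)⟦(1 : ℤ)⟧' = p ≫ v'
      rw [CategoryTheory.Functor.map_id, Category.comp_id, hv])
  rw [Category.id_comp] at hb
  obtain ⟨σ, hσ⟩ : ∃ σ : M ⟶ N, φ.f ≫ b = σ ≫ s' := Triangle.coyoneda_exact₂ _ hT' _ (by
    change (φ.f ≫ b) ≫ g' = 0
    rw [Category.assoc]
    exact hw _)
  have : IsIso (L.map s') := Localization.inverts L P.trW s' ⟨_, _, _, hT', hE'⟩
  refine ⟨σ, ?_⟩
  rw [← cancel_mono (L.map s'), ← L.map_comp, ← hσ, L.map_comp, ← hb, L.map_comp, hφ,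
    φ.map_comp_map_s_assoc]

/-- A morphism that becomes zero is killed by some `s` with cone in `P`, hence factors through the
fibre of `s`. -/
lemma exists_factorization_of_map_eq_zero [Preadditive D] [L.Additive] {M N : C} (f : M ⟶ N)
    (hf : L.map f = 0) : ∃ (E : C) (_ : P E) (a : M ⟶ E) (b : E ⟶ N), a ≫ b = f := by
  rw [← L.map_zero, MorphismProperty.map_eq_iff_postcomp L P.trW] at hf
  obtain ⟨Z, s, hs, e⟩ := hf
  rw [zero_comp] at e
  obtain ⟨E, b, h, hT, hE⟩ := (P.trW_iff' s).1 hs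
  obtain ⟨a, ha⟩ := Triangle.coyoneda_exact₂ _ hT f e
  exact ⟨E, hE, a, b, ha.symm⟩

lemma isZero_obj_of_prop [Preadditive D] [L.Additive] {X : C} (hX : P X) : IsZero (L.obj X) := by
  have : IsIso (L.map (0 : X ⟶ 0)) :=
    Localization.inverts L P.trW _ ((P.trW_iff' _).2 ⟨_, _, _, contractible_distinguished X, hX⟩)
  exact (L.map_isZero (isZero_zero C)).of_iso (asIso (L.map (0 : X ⟶ 0)))

end Fractions

/-! ### Comparing a mapping cone with a degreewise cokernel. -/

section MappingCone

variable {C D : Type*} [Category C] [Preadditive C] [HasBinaryBiproducts C]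
  [Category D] [Abelian D]

/-- The canonical morphism `mappingCone S.f ⟶ S.X₃`. -/
noncomputable def mappingConeDesc (S : ShortComplex (CochainComplex C ℤ)) :
    CochainComplex.mappingCone S.f ⟶ S.X₃ :=
  CochainComplex.mappingCone.desc S.f 0 S.g (by simp)

lemma inr_mappingConeDesc (S : ShortComplex (CochainComplex C ℤ)) :
    CochainComplex.mappingCone.inr S.f ≫ mappingConeDesc S = S.g :=
  CochainComplex.mappingCone.inr_desc _ _ _ _

lemma mappingConeDesc_naturality {S₁ S₂ : ShortComplex (CochainComplex C ℤ)} (f : S₁ ⟶ S₂) :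
    CochainComplex.mappingCone.map S₁.f S₂.f f.τ₁ f.τ₂ f.comm₁₂.symm ≫ mappingConeDesc S₂ =
      mappingConeDesc S₁ ≫ f.τ₃ := by
  ext i
  refine CochainComplex.mappingCone.ext_from _ (i + 1) i rfl ?_ ?_
  · simp [mappingConeDesc, CochainComplex.mappingCone.map]
  · simp [mappingConeDesc, CochainComplex.mappingCone.map, ← HomologicalComplex.comp_f, f.comm₂₃]

lemma map_mappingConeDesc (F : C ⥤ D) [F.Additive] (S : ShortComplex (CochainComplex C ℤ)) :
    (CochainComplex.mappingCone.mapHomologicalComplexIso S.f F).hom ≫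
      CochainComplex.mappingCone.descShortComplex (S.map (F.mapHomologicalComplex (.up ℤ))) =
    (F.mapHomologicalComplex (.up ℤ)).map (mappingConeDesc S) := by
  ext n
  let S' := S.map (F.mapHomologicalComplex (.up ℤ))
  have h : (mappingConeDesc S).f n =
      (CochainComplex.mappingCone.snd S.f).v n n (add_zero n) ≫ S.g.f n := by
    rw [mappingConeDesc, CochainComplex.mappingCone.desc_f _ _ _ _ n (n + 1) rfl]
    simp
  change (F.map ((CochainComplex.mappingCone.fst S.f).1.v n (n + 1) (by lia)) ≫
      (CochainComplex.mappingCone.inl S'.f).v (n + 1) n (by lia) +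
      F.map ((CochainComplex.mappingCone.snd S.f).v n n (add_zero n)) ≫
        (CochainComplex.mappingCone.inr S'.f).f n) ≫
      (CochainComplex.mappingCone.descShortComplex S').f n = F.map ((mappingConeDesc S).f n)
  refine (Preadditive.add_comp _ _ _ _ _ _).trans ?_
  have e₁ := CochainComplex.mappingCone.inl_v_descShortComplex_f S' (n + 1) n (by lia)
  have e₂ := CochainComplex.mappingCone.inr_f_descShortComplex_f S' n
  refine (congrArg₂ (· + ·) ((Category.assoc _ _ _).trans ((congrArg (_ ≫ ·) e₁).trans comp_zero))
    ((Category.assoc _ _ _).trans (congrArg (_ ≫ ·) e₂))).trans ?_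
  refine (zero_add _).trans ?_
  rw [h, F.map_comp]
  rfl

/-- The source category is not assumed abelian. An additive functor preserves mapping cones, so the
comparison can be tested in the abelian target, where the image sequence is short exact. -/
lemma quasiIso_map_mappingConeDesc (F : C ⥤ D) [F.Additive]
    (S : ShortComplex (CochainComplex C ℤ))
    (hS : (S.map (F.mapHomologicalComplex (.up ℤ))).ShortExact) :
    QuasiIso ((F.mapHomologicalComplex (.up ℤ)).map (mappingConeDesc S)) := by
  have := CochainComplex.mappingCone.quasiIso_descShortComplex hS
  rw [← map_mappingConeDesc]
  have h := quasiIso_comp (CochainComplex.mappingCone.mapHomologicalComplexIso S.f F).hom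
    (CochainComplex.mappingCone.descShortComplex (S.map (F.mapHomologicalComplex (.up ℤ))))
    (hφ' := this)
  exact h

end MappingCone

/-! ### Bounded complexes and the triangle of a short exact sequence. -/

section Bounded

variable {k : Type v} [Field k] {R : Type u} [Ring R] [Algebra k R] (𝒜 : ℕ → Submodule k R)

/-- Bounded complexes. -/
abbrev Bounded : Type _ :=
  ((boundedComplexes 𝒜).inverseImage
    (HomotopyCategory.quotient (GrMod 𝒜) (ComplexShape.up ℤ))).FullSubcategory

namespace Bounded

/-- The functor from bounded complexes to the homotopy category. -/
noncomputable def toK : Bounded 𝒜 ⥤ HomotopyBounded 𝒜 :=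
  (boundedComplexes 𝒜).lift (ObjectProperty.ι _ ⋙ HomotopyCategory.quotient _ _)
    (fun X => X.property)

instance : (toK 𝒜).Full where
  map_surjective {X Y} f := by
    obtain ⟨g, hg⟩ := (HomotopyCategory.quotient _ _).map_surjective f.hom
    exact ⟨ObjectProperty.homMk g, ObjectProperty.hom_ext _ hg⟩

instance : (toK 𝒜).Additive where
  map_add := ObjectProperty.hom_ext _ (Functor.map_add (HomotopyCategory.quotient _ _))

variable {𝒜}

/-- The shift of a bounded complex. -/
noncomputable def shiftObj (X : Bounded 𝒜) (n : ℤ) : Bounded 𝒜 :=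
  ⟨X.obj⟦n⟧, by
    have h := (boundedComplexes 𝒜).le_shift n _ X.property
    rwa [ObjectProperty.prop_shift_iff, HomotopyCategory.shift_quotient_obj] at h⟩

/-- The localization functor commutes with the shift. -/
noncomputable def toKShiftIso (X : Bounded 𝒜) (n : ℤ) :
    (toK 𝒜).obj (X.shiftObj n) ≅ ((toK 𝒜).obj X)⟦n⟧ :=
  (boundedComplexes 𝒜).fullyFaithfulι.preimageIso
    (((HomotopyCategory.quotient _ _).commShiftIso n).app X.obj ≪≫
      (((boundedComplexes 𝒜).ι.commShiftIso n).app ((toK 𝒜).obj X)).symm)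

/-- The localization functor commutes with the shift. -/
noncomputable def toDShiftIso (X : Bounded 𝒜) (n : ℤ) :
    (DerivedBounded.Q 𝒜).obj ((toK 𝒜).obj (X.shiftObj n)) ≅
      ((DerivedBounded.Q 𝒜).obj ((toK 𝒜).obj X))⟦n⟧ :=
  (DerivedBounded.Q 𝒜).mapIso (X.toKShiftIso n) ≪≫
    ((DerivedBounded.Q 𝒜).commShiftIso n).app ((toK 𝒜).obj X)


/-- Degreewise short exact sequences of bounded complexes. -/
structure IsShortExact (S : ShortComplex (Bounded 𝒜)) : Prop where
  injective (i : ℤ) : Function.Injective (S.f.hom.f i).lin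
  exact (i : ℤ) (x : S.X₂.obj.X i) : (S.g.hom.f i).lin x = 0 → ∃ y, (S.f.hom.f i).lin y = x
  surjective (i : ℤ) : Function.Surjective (S.g.hom.f i).lin

/-- The mapping cone of a morphism of bounded complexes. -/
noncomputable def cone {X Y : Bounded 𝒜} (f : X ⟶ Y) : Bounded 𝒜 :=
  ⟨CochainComplex.mappingCone f.hom, boundedComplexes_cone 𝒜 f.hom X.property Y.property⟩

/-- The inclusion of the target in the mapping cone. -/
noncomputable def coneInr {X Y : Bounded 𝒜} (f : X ⟶ Y) : Y ⟶ cone f :=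
  ObjectProperty.homMk (CochainComplex.mappingCone.inr f.hom)

/-- The morphism from the mapping cone of `S.f` to `S.X₃`. -/
noncomputable def coneDesc (S : ShortComplex (Bounded 𝒜)) : cone S.f ⟶ S.X₃ :=
  ObjectProperty.homMk (mappingConeDesc (S.map (ObjectProperty.ι _)))

/-- The connecting morphism of the mapping cone. -/
noncomputable def coneδ {X Y : Bounded 𝒜} (f : X ⟶ Y) :
    (toK 𝒜).obj (cone f) ⟶ ((toK 𝒜).obj X)⟦(1 : ℤ)⟧ :=
  (boundedComplexes 𝒜).fullyFaithfulι.preimage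
    ((CochainComplex.mappingCone.triangleh f.hom).mor₃ ≫
      ((boundedComplexes 𝒜).ι.commShiftIso (1 : ℤ)).inv.app ((toK 𝒜).obj X))

lemma ι_map_coneδ {X Y : Bounded 𝒜} (f : X ⟶ Y) :
    (boundedComplexes 𝒜).ι.map (coneδ f) ≫
      ((boundedComplexes 𝒜).ι.commShiftIso (1 : ℤ)).hom.app ((toK 𝒜).obj X) =
        (CochainComplex.mappingCone.triangleh f.hom).mor₃ := by
  refine (congrArg (· ≫ ((boundedComplexes 𝒜).ι.commShiftIso (1 : ℤ)).hom.app ((toK 𝒜).obj X))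
    ((boundedComplexes 𝒜).fullyFaithfulι.map_preimage _)).trans ?_
  refine (Category.assoc _ _ _).trans ?_
  refine (congrArg ((CochainComplex.mappingCone.triangleh f.hom).mor₃ ≫ ·)
    (Iso.inv_hom_id_app ((boundedComplexes 𝒜).ι.commShiftIso (1 : ℤ)) ((toK 𝒜).obj X))).trans ?_
  exact Category.comp_id _

lemma coneTriangle_distinguished {X Y : Bounded 𝒜} (f : X ⟶ Y) :
    Triangle.mk ((toK 𝒜).map f) ((toK 𝒜).map (coneInr f)) (coneδ f) ∈ distinguishedTriangles := by
  refine isomorphic_distinguished _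
    (HomotopyCategory.mappingCone_triangleh_distinguished f.hom) _ ?_
  refine Triangle.isoMk _ _ (Iso.refl _) (Iso.refl _) (Iso.refl _) ?_ ?_ ?_
  · exact (Category.comp_id _).trans (Category.id_comp _).symm
  · exact (Category.comp_id _).trans (Category.id_comp _).symm
  · have e := ι_map_coneδ f
    refine Eq.trans (congrArg (((boundedComplexes 𝒜).ι.map (coneδ f) ≫
      ((boundedComplexes 𝒜).ι.commShiftIso (1 : ℤ)).hom.app ((toK 𝒜).obj X)) ≫ ·)
        (CategoryTheory.Functor.map_id _ _)) ?_
    exact (Category.comp_id _).trans (e.trans (Category.id_comp _).symm)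

lemma quasiIso_coneDesc (S : ShortComplex (Bounded 𝒜)) (hS : IsShortExact S) :
    QuasiIso ((GrMod.toAb.mapHomologicalComplex (ComplexShape.up ℤ)).map (coneDesc S).hom) := by
  let S₀ := S.map (ObjectProperty.ι _)
  have hS' : (S₀.map (GrMod.toAb.mapHomologicalComplex (ComplexShape.up ℤ))).ShortExact := by
    refine HomologicalComplex.shortExact_of_degreewise_shortExact _ fun i => ?_
    refine ShortComplex.ShortExact.mk' ?_ ?_ ?_
    · rw [ShortComplex.ab_exact_iff]
      exact hS.exact i
    · exact (AddCommGrpCat.mono_iff_injective _).2 (hS.injective i)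
    · exact (AddCommGrpCat.epi_iff_surjective _).2 (hS.surjective i)
  exact quasiIso_map_mappingConeDesc GrMod.toAb S₀ hS'

lemma toK_coneDesc_mem (S : ShortComplex (Bounded 𝒜)) (hS : IsShortExact S) :
    (acyclicComplexes 𝒜).trW ((toK 𝒜).map (coneDesc S)) := by
  refine (ObjectProperty.inverseImage_trW_iff _ (HomotopyBounded.toAb 𝒜) _).2 ?_
  rw [← HomotopyCategory.quasiIso_eq_trW_subcategoryAcyclic]
  have := quasiIso_coneDesc S hS
  exact (HomotopyCategory.quotient_map_mem_quasiIso_iff _).2 this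

/-- A morphism of short exact sequences induces a chain map of cones compatible with both the
comparison maps and the connecting maps. Working with chain maps rather than homotopy classes makes
this strict. -/
lemma coneδ_naturality {S₁ S₂ : ShortComplex (Bounded 𝒜)} (φ : S₁ ⟶ S₂) :
    ∃ c : cone S₁.f ⟶ cone S₂.f,
      (toK 𝒜).map (coneDesc S₁) ≫ (toK 𝒜).map φ.τ₃ = (toK 𝒜).map c ≫ (toK 𝒜).map (coneDesc S₂) ∧
      coneδ S₁.f ≫ ((toK 𝒜).map φ.τ₁)⟦(1 : ℤ)⟧' = (toK 𝒜).map c ≫ coneδ S₂.f := by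
  have h₁₂ : S₁.f.hom ≫ φ.τ₂.hom = φ.τ₁.hom ≫ S₂.f.hom :=
    congrArg (fun t => t.hom) φ.comm₁₂.symm
  have h₂₃ : S₁.g.hom ≫ φ.τ₃.hom = φ.τ₂.hom ≫ S₂.g.hom :=
    congrArg (fun t => t.hom) φ.comm₂₃.symm
  refine ⟨ObjectProperty.homMk (CochainComplex.mappingCone.map S₁.f.hom S₂.f.hom
    φ.τ₁.hom φ.τ₂.hom h₁₂), ?_, ?_⟩
  · rw [← Functor.map_comp, ← Functor.map_comp]
    congr 1
    exact ObjectProperty.hom_ext _ (mappingConeDesc_naturality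
      ((ObjectProperty.ι _).mapShortComplex.map φ)).symm
  · apply (boundedComplexes 𝒜).ι.map_injective
    rw [← cancel_mono (((boundedComplexes 𝒜).ι.commShiftIso (1 : ℤ)).hom.app ((toK 𝒜).obj S₂.X₁)),
      Functor.map_comp, Functor.map_comp, Category.assoc, Category.assoc, ι_map_coneδ,
      Functor.commShiftIso_hom_naturality, reassoc_of% (ι_map_coneδ S₁.f)]
    exact ((HomotopyCategory.quotient _ _).mapTriangle.map
      (CochainComplex.mappingCone.triangleMap S₁.f.hom S₂.f.hom φ.τ₁.hom φ.τ₂.hom h₁₂)).comm₃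

namespace IsShortExact

variable {S : ShortComplex (Bounded 𝒜)} (hS : IsShortExact S)

include hS in
lemma isIso_toD_coneDesc : IsIso ((DerivedBounded.Q 𝒜).map ((toK 𝒜).map (coneDesc S))) :=
  Localization.inverts (DerivedBounded.Q 𝒜) (acyclicComplexes 𝒜).trW _ (toK_coneDesc_mem S hS)

/-- The connecting morphism of a short exact sequence of bounded complexes. -/
noncomputable def δ : (DerivedBounded.Q 𝒜).obj ((toK 𝒜).obj S.X₃) ⟶
    ((DerivedBounded.Q 𝒜).obj ((toK 𝒜).obj S.X₁))⟦(1 : ℤ)⟧ :=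
  haveI := hS.isIso_toD_coneDesc
  inv ((DerivedBounded.Q 𝒜).map ((toK 𝒜).map (coneDesc S))) ≫ (DerivedBounded.Q 𝒜).map (coneδ S.f) ≫
    ((DerivedBounded.Q 𝒜).commShiftIso (1 : ℤ)).hom.app ((toK 𝒜).obj S.X₁)

lemma coneDesc_δ : (DerivedBounded.Q 𝒜).map ((toK 𝒜).map (coneDesc S)) ≫ hS.δ =
    (DerivedBounded.Q 𝒜).map (coneδ S.f) ≫
    ((DerivedBounded.Q 𝒜).commShiftIso (1 : ℤ)).hom.app ((toK 𝒜).obj S.X₁) := by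
  have := hS.isIso_toD_coneDesc
  rw [δ, IsIso.hom_inv_id_assoc]

lemma distinguished :
    Triangle.mk ((DerivedBounded.Q 𝒜).map ((toK 𝒜).map S.f))
      ((DerivedBounded.Q 𝒜).map ((toK 𝒜).map S.g)) hS.δ ∈ distinguishedTriangles := by
  have := hS.isIso_toD_coneDesc
  refine isomorphic_distinguished _ ((DerivedBounded.Q 𝒜).map_distinguished _
    (coneTriangle_distinguished S.f)) _ (Iso.symm ?_)
  refine Triangle.isoMk _ _ (Iso.refl _) (Iso.refl _)
    (@asIso _ _ _ _ ((DerivedBounded.Q 𝒜).map ((toK 𝒜).map (coneDesc S))) this) ?_ ?_ ?_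
  · exact (Category.comp_id _).trans (Category.id_comp _).symm
  · have e : coneInr S.f ≫ coneDesc S = S.g := ObjectProperty.hom_ext _
      (inr_mappingConeDesc (S.map (ObjectProperty.ι _)))
    refine Eq.trans ?_ (Category.id_comp _).symm
    exact (((toK 𝒜 ⋙ DerivedBounded.Q 𝒜).map_comp _ _).symm.trans
      (congrArg (toK 𝒜 ⋙ DerivedBounded.Q 𝒜).map e))
  · refine Eq.trans ?_ hS.coneDesc_δ.symm
    refine (congrArg (_ ≫ ·) (CategoryTheory.Functor.map_id _ _)).trans ?_
    exact Category.comp_id _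

/-- Precomposition with the invertible `coneDesc S₁` reduces the claim to the naturality of `coneδ`
in the homotopy category. -/
lemma δ_naturality {S₁ S₂ : ShortComplex (Bounded 𝒜)} (h₁ : IsShortExact S₁)
    (h₂ : IsShortExact S₂) (φ : S₁ ⟶ S₂) :
    h₁.δ ≫ ((DerivedBounded.Q 𝒜).map ((toK 𝒜).map φ.τ₁))⟦(1 : ℤ)⟧' =
      (DerivedBounded.Q 𝒜).map ((toK 𝒜).map φ.τ₃) ≫ h₂.δ := by
  have := h₁.isIso_toD_coneDesc
  obtain ⟨c, hc, hc'⟩ := coneδ_naturality φ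
  rw [← cancel_epi ((DerivedBounded.Q 𝒜).map ((toK 𝒜).map (coneDesc S₁))),
    reassoc_of% h₁.coneDesc_δ,
    ← Functor.map_comp_assoc, hc, Functor.map_comp_assoc, h₂.coneDesc_δ]
  rw [← Functor.commShiftIso_hom_naturality, ← Functor.map_comp_assoc, hc',
    Functor.map_comp_assoc]

end IsShortExact

end Bounded

end Bounded
end GradedBranes

namespace GradedBranes

open Pretriangulated

/-! ### Subcomplexes and quotient complexes generated by families of morphisms. -/

section Bounded

variable {k : Type v} [Field k] {R : Type u} [Ring R] [Algebra k R] {𝒜 : ℕ → Submodule k R}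

namespace GrMod

lemma isZero_of_forall {M : GrMod 𝒜} (h : ∀ x : M, x = 0) : IsZero M :=
  (IsZero.iff_id_eq_zero _).2 (hom_ext h)

lemma eq_zero_of_isZero {M : GrMod 𝒜} (h : IsZero M) (x : M) : x = 0 :=
  congr_lin ((IsZero.iff_id_eq_zero _).1 h) x

lemma projective_of_isZero {M : GrMod 𝒜} (h : IsZero M) : Projective M :=
  ⟨fun _ _ => ⟨0, h.eq_of_src _ _⟩⟩

/-- The inclusion of the image. -/
def imageι {M N : GrMod 𝒜} (f : M ⟶ N) : image f ⟶ N :=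
  ⟨(LinearMap.range f.lin).subtype, fun _ _ h => h⟩

lemma imageι_injective {M N : GrMod 𝒜} (f : M ⟶ N) : Function.Injective (imageι f).lin :=
  Subtype.val_injective

lemma exists_imageι_eq_iff {M N : GrMod 𝒜} (f : M ⟶ N) (x : N) :
    (∃ y, (imageι f).lin y = x) ↔ ∃ y, f.lin y = x :=
  ⟨by rintro ⟨⟨_, ⟨y, rfl⟩⟩, rfl⟩; exact ⟨y, rfl⟩, by
    rintro ⟨y, rfl⟩; exact ⟨(⟨_, y, rfl⟩ : LinearMap.range f.lin), rfl⟩⟩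

/-- The morphism induced on images. -/
def imageMap {M N M' N' : GrMod 𝒜} (f : M ⟶ N) (f' : M' ⟶ N') (g : N ⟶ N')
    (h : f ≫ g ≫ cokerπ f' = 0) : image f ⟶ image f' :=
  ⟨g.lin.restrict (by
    rintro _ ⟨x, rfl⟩
    exact (cokerπ_eq_zero_iff f' _).1 (congr_lin h x)),
    fun i x hx => g.map_mem i (x : LinearMap.range f.lin).1 hx⟩

lemma imageMap_ι {M N M' N' : GrMod 𝒜} (f : M ⟶ N) (f' : M' ⟶ N') (g : N ⟶ N')
    (h : f ≫ g ≫ cokerπ f' = 0) : imageMap f f' g h ≫ imageι f' = imageι f ≫ g := rfl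

lemma isZero_image_of_eq_zero {M N : GrMod 𝒜} {f : M ⟶ N} (h : f = 0) : IsZero (image f) :=
  isZero_of_forall fun x => imageι_injective f (by
    obtain ⟨y, hy⟩ := (exists_imageι_eq_iff f _).1 ⟨x, rfl⟩
    rw [← hy, h, map_zero, zero_lin])

lemma isIso_imageι {M N : GrMod 𝒜} {f : M ⟶ N} (h : Function.Surjective f.lin) :
    IsIso (imageι f) :=
  isIso_of_bijective _ ⟨imageι_injective f, fun x => (exists_imageι_eq_iff f x).2 (h x)⟩

lemma isZero_coker_of_surjective {M N : GrMod 𝒜} {f : M ⟶ N} (h : Function.Surjective f.lin) :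
    IsZero (coker f) :=
  isZero_of_forall fun x => by
    obtain ⟨y, rfl⟩ := cokerπ_surjective f x
    exact (cokerπ_eq_zero_iff f y).2 (h y)

lemma isIso_cokerπ {M N : GrMod 𝒜} {f : M ⟶ N} (h : f = 0) : IsIso (cokerπ f) :=
  isIso_of_bijective _ ⟨(injective_iff_map_eq_zero _).2 fun x hx => by
    obtain ⟨y, rfl⟩ := (cokerπ_eq_zero_iff f x).1 hx
    rw [h, zero_lin], cokerπ_surjective f⟩

lemma cokerHom_ext {M N L : GrMod 𝒜} (f : M ⟶ N) {g g' : coker f ⟶ L}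
    (h : cokerπ f ≫ g = cokerπ f ≫ g') : g = g' :=
  hom_ext fun x => by
    obtain ⟨y, rfl⟩ := cokerπ_surjective f x
    exact congr_lin h y

lemma imageHom_ext {M N L : GrMod 𝒜} (f : M ⟶ N) {g g' : L ⟶ image f}
    (h : g ≫ imageι f = g' ≫ imageι f) : g = g' :=
  hom_ext fun x => imageι_injective f (congr_lin h x)

end GrMod

open GrMod

section Quotient

variable (Z : CochainComplex (GrMod 𝒜) ℤ) {T : ℤ → GrMod 𝒜} (ψ : ∀ i, T i ⟶ Z.X i)
  (h : ∀ i j, ψ i ≫ Z.d i j ≫ cokerπ (ψ j) = 0)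

/-- The quotient of a complex by the image of a family of morphisms. -/
def quotComplex : CochainComplex (GrMod 𝒜) ℤ where
  X i := coker (ψ i)
  d i j := cokerDesc (ψ i) (Z.d i j ≫ cokerπ (ψ j)) (h i j)
  shape i j hij := cokerHom_ext _ (by rw [cokerπ_desc, Z.shape i j hij, zero_comp, comp_zero])
  d_comp_d' i j l _ _ := cokerHom_ext _ (by
    rw [cokerπ_desc_assoc, Category.assoc, cokerπ_desc, Z.d_comp_d_assoc, zero_comp, comp_zero])

/-- The projection to the quotient complex. -/
def quotComplexπ : Z ⟶ quotComplex Z ψ h where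
  f i := cokerπ (ψ i)
  comm' i j _ := cokerπ_desc _ _ (h i j)

/-- The morphism from the quotient complex induced by a morphism. -/
def quotComplexDesc {Y : CochainComplex (GrMod 𝒜) ℤ} (f : Z ⟶ Y) (hf : ∀ i, ψ i ≫ f.f i = 0) :
    quotComplex Z ψ h ⟶ Y where
  f i := cokerDesc (ψ i) (f.f i) (hf i)
  comm' i j _ := hom_ext fun x => by
    obtain ⟨y, rfl⟩ := cokerπ_surjective (ψ i) x
    exact congr_lin (f.comm i j) y

lemma quotComplexπ_desc {Y : CochainComplex (GrMod 𝒜) ℤ} (f : Z ⟶ Y)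
    (hf : ∀ i, ψ i ≫ f.f i = 0) : quotComplexπ Z ψ h ≫ quotComplexDesc Z ψ h f hf = f :=
  HomologicalComplex.hom_ext _ _ fun _ => rfl

/-- The subcomplex of the images of a family of morphisms. -/
def imageComplex : CochainComplex (GrMod 𝒜) ℤ where
  X i := image (ψ i)
  d i j := imageMap (ψ i) (ψ j) (Z.d i j) (h i j)
  shape i j hij := imageHom_ext _ (by rw [imageMap_ι, Z.shape i j hij, zero_comp, comp_zero])
  d_comp_d' i j l _ _ := imageHom_ext _ (by
    rw [Category.assoc, imageMap_ι, ← Category.assoc, imageMap_ι, Category.assoc, Z.d_comp_d,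
      zero_comp, comp_zero])

/-- The inclusion of the subcomplex of images. -/
def imageComplexι : imageComplex Z ψ h ⟶ Z where
  f i := imageι (ψ i)
  comm' i j _ := (imageMap_ι _ _ _ (h i j)).symm

lemma imageComplexι_π : imageComplexι Z ψ h ≫ quotComplexπ Z ψ h = 0 :=
  HomologicalComplex.hom_ext _ _ fun i => hom_ext fun x =>
    (cokerπ_eq_zero_iff (ψ i) _).2 ((exists_imageι_eq_iff (ψ i) _).1 ⟨x, rfl⟩)

end Quotient

namespace Bounded

lemma boundedComplexes_of_isZero {K L : CochainComplex (GrMod 𝒜) ℤ}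
    (hK : boundedComplexes 𝒜 ((HomotopyCategory.quotient _ _).obj K))
    (h : ∀ i, IsZero (K.X i) → IsZero (L.X i)) :
    boundedComplexes 𝒜 ((HomotopyCategory.quotient _ _).obj L) := by
  obtain ⟨a, b, ha, hb⟩ := hK
  change CochainComplex.IsStrictlyGE K a at ha
  change CochainComplex.IsStrictlyLE K b at hb
  exact ⟨a, b, (CochainComplex.isStrictlyGE_iff _ _).2 fun i hi =>
      h i (K.isZero_of_isStrictlyGE a i hi),
    (CochainComplex.isStrictlyLE_iff _ _).2 fun i hi => h i (K.isZero_of_isStrictlyLE b i hi)⟩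

section

variable (Z : Bounded 𝒜) {T : ℤ → GrMod 𝒜} (ψ : ∀ i, T i ⟶ Z.obj.X i)
  (h : ∀ i j, ψ i ≫ Z.obj.d i j ≫ cokerπ (ψ j) = 0)

/-- The quotient of a bounded complex by the image of a family of morphisms. -/
def quot : Bounded 𝒜 := ⟨quotComplex Z.obj ψ h, boundedComplexes_of_isZero Z.property fun _ hi =>
  isZero_coker_of_surjective fun x => ⟨0, by rw [eq_zero_of_isZero hi x, map_zero]⟩⟩

/-- The bounded subcomplex of the images of a family of morphisms. -/
def sub : Bounded 𝒜 := ⟨imageComplex Z.obj ψ h, boundedComplexes_of_isZero Z.property fun _ hi =>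
  isZero_image_of_eq_zero (hi.eq_of_tgt _ _)⟩

/-- The short exact sequence of a subcomplex and its quotient. -/
def subQuot : ShortComplex (Bounded 𝒜) where
  X₁ := sub Z ψ h
  X₂ := Z
  X₃ := quot Z ψ h
  f := ObjectProperty.homMk (imageComplexι Z.obj ψ h)
  g := ObjectProperty.homMk (quotComplexπ Z.obj ψ h)
  zero := ObjectProperty.hom_ext _ (imageComplexι_π Z.obj ψ h)

lemma subQuot_isShortExact : IsShortExact (subQuot Z ψ h) where
  injective i := imageι_injective (ψ i)
  exact i _ hx := (exists_imageι_eq_iff (ψ i) _).2 ((cokerπ_eq_zero_iff (ψ i) _).1 hx)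
  surjective i := cokerπ_surjective (ψ i)

end

lemma toK_obj_surjective (E : HomotopyBounded 𝒜) : ∃ Z, (toK 𝒜).obj Z = E :=
  ⟨⟨E.obj.as, E.property⟩, rfl⟩

lemma acyclic_exact (Z : Bounded 𝒜) (hZ : acyclicComplexes 𝒜 ((toK 𝒜).obj Z)) (i : ℤ)
    (z : Z.obj.X i) (hz : (Z.obj.d i (i + 1)).lin z = 0) : ∃ y, (Z.obj.d (i - 1) i).lin y = z :=
  GradedBranes.acyclic_exact 𝒜 Z.property hZ i z hz

lemma acyclic_of_exact (Z : Bounded 𝒜)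
    (hZ : ∀ (i : ℤ) (z : Z.obj.X i), (Z.obj.d i (i + 1)).lin z = 0 →
      ∃ y, (Z.obj.d (i - 1) i).lin y = z) : acyclicComplexes 𝒜 ((toK 𝒜).obj Z) := by
  have h : HomotopyCategory.subcategoryAcyclic AddCommGrpCat.{u}
      ((HomotopyCategory.quotient _ _).obj
        ((GrMod.toAb.mapHomologicalComplex (ComplexShape.up ℤ)).obj Z.obj)) := by
    rw [HomotopyCategory.quotient_obj_mem_subcategoryAcyclic_iff_exactAt]
    intro i
    rw [HomologicalComplex.exactAt_iff' _ (i - 1) i (i + 1) (by simp) (by simp),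
      ShortComplex.ab_exact_iff]
    exact hZ i
  exact h

end Bounded

end Bounded
end GradedBranes

/-! ### Truncations, and full faithfulness of modules in the derived category. -/

namespace GradedBranes

open Pretriangulated

variable {k : Type v} [Field k] {R : Type u} [Ring R] [Algebra k R] {𝒜 : ℕ → Submodule k R}

open GrMod

/-- A morphism of complexes which is zero except in one degree, where it factors through the
differential, is null-homotopic. -/
lemma homotopic_zero_of_factors {K L : CochainComplex (GrMod 𝒜) ℤ} (f : K ⟶ L) (c : ℤ)
    (hf : ∀ i, i ≠ c → f.f i = 0) (l : K.X c ⟶ L.X (c - 1)) (hl : l ≫ L.d (c - 1) c = f.f c)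
    (hl' : ∀ i, K.d i c ≫ l = 0) : Nonempty (Homotopy f 0) := by
  let h : ∀ i j, (ComplexShape.up ℤ).Rel j i → (K.X i ⟶ L.X j) := fun i j hij =>
    if hi : i = c then
      (K.XIsoOfEq hi).hom ≫ l ≫ (L.XIsoOfEq (by
        simp only [ComplexShape.up_Rel] at hij; lia)).hom
    else 0
  refine ⟨(Homotopy.ofEq ?_).trans (Homotopy.nullHomotopy' h)⟩
  ext1 i
  rw [Homotopy.nullHomotopicMap'_f (k₂ := i - 1) (k₁ := i) (k₀ := i + 1) (by simp) (by simp)]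
  by_cases hi : i = c
  · subst hi
    have e1 : h (i + 1) i (by simp) = 0 := dif_neg (by lia)
    rw [e1, comp_zero, zero_add, ← hl]
    simp [h]
  · have e2 : h i (i - 1) (by simp) = 0 := dif_neg hi
    rw [e2, zero_comp, add_zero, hf i hi]
    -- Degree `c - 1` is the only other degree where the homotopy can contribute, by `d ≫ l`; it
    -- vanishes by `hl'`.
    by_cases hi' : i + 1 = c
    · subst hi'
      simp only [h, dif_pos]
      rw [HomologicalComplex.XIsoOfEq_rfl, Iso.refl_hom, Category.id_comp,
        ← Category.assoc]
      rw [hl' i, zero_comp]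
    · have e1 : h (i + 1) i (by simp) = 0 := dif_neg hi'
      rw [e1, comp_zero]

namespace Bounded

variable (𝒜) in
/-- The functor sending a module to the bounded complex concentrated in degree `0`. -/
noncomputable def single : GrMod 𝒜 ⥤ Bounded 𝒜 :=
  ObjectProperty.lift _ (HomologicalComplex.single (GrMod 𝒜) (ComplexShape.up ℤ) 0)
    (fun M => ((HomotopyBounded.single 𝒜).obj M).property)

/-- The functor sending a module to the complex concentrated in degree `0`. -/
noncomputable abbrev singleD : GrMod 𝒜 ⥤ DerivedBounded 𝒜 :=
  single 𝒜 ⋙ toK 𝒜 ⋙ DerivedBounded.Q 𝒜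

lemma isZero_single_X (M : GrMod 𝒜) (i : ℤ) (hi : i ≠ 0) : IsZero (((single 𝒜).obj M).obj.X i) :=
  HomologicalComplex.isZero_single_obj_X (ComplexShape.up ℤ) 0 M i hi

/-- A family of morphisms generating the complement of the truncation `τ_{≥ c}`. -/
def truncGEGens (Z : Bounded 𝒜) (c i : ℤ) :
    (Z.obj.X (i - 1)).dsum (Z.obj.X i) ⟶ Z.obj.X i :=
  desc (if i ≤ c then Z.obj.d (i - 1) i else 0) (if i < c then 𝟙 _ else 0)

lemma truncGEGens_eq_zero (Z : Bounded 𝒜) (c i : ℤ) (h : c < i) : truncGEGens Z c i = 0 := by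
  rw [truncGEGens, if_neg (by lia), if_neg (by lia), desc, comp_zero, comp_zero, add_zero]

lemma truncGEGens_surjective (Z : Bounded 𝒜) (c i : ℤ) (h : i < c) :
    Function.Surjective (truncGEGens Z c i).lin := by
  intro x
  refine ⟨(0, x), ?_⟩
  rw [truncGEGens, desc_lin, map_zero, zero_add, if_pos h, id_lin]

lemma truncGEGens_self (Z : Bounded 𝒜) (c : ℤ) :
    truncGEGens Z c c = fst _ _ ≫ Z.obj.d (c - 1) c := by
  rw [truncGEGens, if_pos le_rfl, if_neg (lt_irrefl _), desc, comp_zero, add_zero]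

/-- The images are everything below degree `c`, the boundaries in degree `c`, and zero above; they
form a subcomplex. The truncation is thus defined by cokernels alone and stays finitely generated.
-/
lemma truncGEGens_comp (Z : Bounded 𝒜) (c i j : ℤ) :
    truncGEGens Z c i ≫ Z.obj.d i j ≫ cokerπ (truncGEGens Z c j) = 0 := by
  by_cases hij : i + 1 = j
  · obtain rfl : i = j - 1 := by lia
    rcases lt_trichotomy j c with hj | rfl | hj
    · refine hom_ext fun x => (cokerπ_eq_zero_iff _ _).2 (truncGEGens_surjective Z c j hj _)
    · refine hom_ext fun x => (cokerπ_eq_zero_iff _ _).2 ?_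
      rw [truncGEGens_self]
      exact ⟨((truncGEGens Z j (j - 1)).lin x, 0), rfl⟩
    · by_cases hj' : j - 1 = c
      · subst hj'
        rw [truncGEGens_self, Category.assoc, Z.obj.d_comp_d_assoc, zero_comp, comp_zero]
      · rw [truncGEGens_eq_zero Z c (j - 1) (by lia), zero_comp]
  · rw [Z.obj.shape i j hij, zero_comp, comp_zero]

/-- The truncation `τ_{≥ c}` of a bounded complex. -/
def truncGE (Z : Bounded 𝒜) (c : ℤ) : Bounded 𝒜 := quot Z (truncGEGens Z c) (truncGEGens_comp Z c)

/-- The projection to the truncation. -/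
def truncGEπ (Z : Bounded 𝒜) (c : ℤ) : Z ⟶ Z.truncGE c :=
  ObjectProperty.homMk (quotComplexπ Z.obj (truncGEGens Z c) (truncGEGens_comp Z c))

lemma isZero_truncGE_X (Z : Bounded 𝒜) (c i : ℤ) (hi : i < c) :
    IsZero ((Z.truncGE c).obj.X i) :=
  isZero_coker_of_surjective (truncGEGens_surjective Z c i hi)

/-- In degrees `≥ c` nothing is divided out one degree higher, so a cycle of the quotient lifts to a
cycle of `Z`, which is a boundary. -/
lemma truncGE_acyclic (Z : Bounded 𝒜) (c : ℤ) (hZ : acyclicComplexes 𝒜 ((toK 𝒜).obj Z)) :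
    acyclicComplexes 𝒜 ((toK 𝒜).obj (Z.truncGE c)) := by
  refine acyclic_of_exact _ fun i z hz => ?_
  by_cases hi : i < c
  · exact ⟨0, (map_zero _).trans (eq_zero_of_isZero (isZero_truncGE_X Z c i hi) z).symm⟩
  · obtain ⟨y, rfl⟩ := cokerπ_surjective (truncGEGens Z c i) z
    have hy : (cokerπ (truncGEGens Z c (i + 1))).lin ((Z.obj.d i (i + 1)).lin y) = 0 := hz
    rw [cokerπ_eq_zero_iff, truncGEGens_eq_zero Z c _ (by lia)] at hy
    obtain ⟨t, ht⟩ := hy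
    obtain ⟨w, rfl⟩ := acyclic_exact Z hZ i y (ht.symm.trans (zero_lin _))
    exact ⟨(cokerπ (truncGEGens Z c (i - 1))).lin w, rfl⟩

lemma exists_truncGEπ_comp {Z Y : Bounded 𝒜} (c : ℤ) (hY : ∀ i, i < c → IsZero (Y.obj.X i))
    (f : Z ⟶ Y) : ∃ g : Z.truncGE c ⟶ Y, truncGEπ Z c ≫ g = f := by
  have h : ∀ i, truncGEGens Z c i ≫ f.hom.f i = 0 := by
    intro i
    rcases lt_trichotomy i c with hi | rfl | hi
    · exact (hY i hi).eq_of_tgt _ _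
    · rw [truncGEGens_self, Category.assoc, ← f.hom.comm, (hY (i - 1) (by lia)).eq_of_tgt
        (f.hom.f (i - 1)) 0, zero_comp, comp_zero]
    · rw [truncGEGens_eq_zero Z c i hi, zero_comp]
  exact ⟨ObjectProperty.homMk (quotComplexDesc Z.obj _ (truncGEGens_comp Z c) f.hom h),
    ObjectProperty.hom_ext _ (quotComplexπ_desc Z.obj _ (truncGEGens_comp Z c) f.hom h)⟩

lemma toK_map_eq_zero {X Y : Bounded 𝒜} (f : X ⟶ Y) (h : Nonempty (Homotopy f.hom 0)) :
    (toK 𝒜).map f = 0 := by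
  obtain ⟨h⟩ := h
  exact ObjectProperty.hom_ext _ ((HomotopyCategory.eq_of_homotopy _ _ h).trans
    (Functor.map_zero (HomotopyCategory.quotient _ _) _ _))

/-- With nothing below degree `-1`, exactness makes the differential from degree `-1` to `0`
injective, with image the cycles. A chain map from `M` takes values in these cycles, so it lifts
uniquely to degree `-1`, and the lift is a null-homotopy. -/
lemma hom_single_eq_zero (M : GrMod 𝒜) (Z : Bounded 𝒜)
    (hZ : acyclicComplexes 𝒜 ((toK 𝒜).obj Z)) (hZ' : ∀ i, i < -1 → IsZero (Z.obj.X i))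
    (f : (toK 𝒜).obj ((single 𝒜).obj M) ⟶ (toK 𝒜).obj Z) : f = 0 := by
  obtain ⟨f, rfl⟩ := (toK 𝒜).map_surjective f
  have hinj : Function.Injective (Z.obj.d (0 - 1) 0).lin := by
    refine (injective_iff_map_eq_zero _).2 fun x hx => ?_
    obtain ⟨y, rfl⟩ := acyclic_exact Z hZ (0 - 1) x (by simpa using hx)
    rw [eq_zero_of_isZero (hZ' (0 - 1 - 1) (by norm_num)) y, map_zero]
  obtain ⟨l, hl⟩ := exists_lift_of_injective (Z.obj.d (0 - 1) 0) hinj (f.hom.f 0) (fun x => by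
    refine acyclic_exact Z hZ 0 _ ?_
    exact congr_lin ((f.hom.comm 0 (0 + 1)).trans zero_comp) x)
  exact toK_map_eq_zero f (homotopic_zero_of_factors f.hom 0
    (fun i hi => (isZero_single_X M i hi).eq_of_src _ _) l hl fun i => zero_comp)

instance : (single 𝒜).Full where
  map_surjective {M N} f := by
    obtain ⟨g, hg⟩ := (HomologicalComplex.single (GrMod 𝒜) (ComplexShape.up ℤ) 0).map_surjective
      f.hom
    exact ⟨g, ObjectProperty.hom_ext _ hg⟩

/-- All differentials of these complexes vanish, so a homotopy contributes nothing. -/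
lemma eq_of_toK_map_eq {M N : GrMod 𝒜} (f g : (single 𝒜).obj M ⟶ (single 𝒜).obj N)
    (h : (toK 𝒜).map f = (toK 𝒜).map g) : f = g := by
  have e := HomotopyCategory.homotopyOfEq f.hom g.hom (congrArg (fun t => t.hom) h)
  refine ObjectProperty.hom_ext _ (HomologicalComplex.from_single_hom_ext ?_)
  have e' := e.comm 0
  rw [dNext_eq _ (show (ComplexShape.up ℤ).Rel 0 1 by simp),
    prevD_eq _ (show (ComplexShape.up ℤ).Rel (-1) 0 by simp)] at e'
  refine e'.trans ?_
  refine (congrArg₂ (· + ·) (congrArg₂ (· + ·) zero_comp comp_zero) rfl).trans ?_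
  rw [add_zero, zero_add]

/-- The term in degree `0` of a complex concentrated in degree `0`. -/
noncomputable def singleXIso (M : GrMod 𝒜) : ((single 𝒜).obj M).obj.X 0 ≅ M :=
  HomologicalComplex.singleObjXSelf (ComplexShape.up ℤ) 0 M

lemma single_map_f {M N : GrMod 𝒜} (f : M ⟶ N) : ((single 𝒜).map f).hom.f 0 =
    (singleXIso M).hom ≫ f ≫ (singleXIso N).inv :=
  HomologicalComplex.single_map_f_self _ _ _

lemma eq_singleXIso_conj {M N : GrMod 𝒜} (f : M ⟶ N) :
    f = (singleXIso M).inv ≫ ((single 𝒜).map f).hom.f 0 ≫ (singleXIso N).hom := by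
  rw [single_map_f, Category.assoc, Category.assoc, Iso.inv_hom_id, Category.comp_id,
    Iso.inv_hom_id_assoc]

instance : (single 𝒜).Additive where
  map_add := ObjectProperty.hom_ext _
    (Functor.map_add (HomologicalComplex.single (GrMod 𝒜) (ComplexShape.up ℤ) 0))

/-- The criterion `exists_map_eq_of_factors` applies: `N⟦1⟧` lives in degree `-1`, so a morphism to
it from an acyclic complex factors through the truncation at `-1`, still acyclic, which receives no
nonzero morphism from `M`. -/
lemma singleD_map_surjective {M N : GrMod 𝒜} (f : singleD.obj M ⟶ singleD.obj N) :
    ∃ g : M ⟶ N, singleD.map g = f := by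
  obtain ⟨g, hg⟩ := exists_map_eq_of_factors (acyclicComplexes 𝒜) (DerivedBounded.Q 𝒜)
    (M := (toK 𝒜).obj ((single 𝒜).obj M)) (N := (toK 𝒜).obj ((single 𝒜).obj N)) (fun E hE v => by
      obtain ⟨Z, rfl⟩ := toK_obj_surjective E
      obtain ⟨w, hw⟩ := (toK 𝒜).map_surjective (v ≫ (((single 𝒜).obj N).toKShiftIso 1).inv)
      obtain ⟨w', hw'⟩ := exists_truncGEπ_comp (-1) (fun i hi => isZero_single_X N (i + 1)
        (by lia)) w
      refine ⟨(toK 𝒜).obj (Z.truncGE (-1)), truncGE_acyclic Z _ hE, (toK 𝒜).map (truncGEπ Z _),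
        (toK 𝒜).map w' ≫ (((single 𝒜).obj N).toKShiftIso 1).hom, ?_, fun f =>
          hom_single_eq_zero M _ (truncGE_acyclic Z _ hE) (isZero_truncGE_X Z _) f⟩
      rw [← Category.assoc, ← Functor.map_comp, hw', hw, Category.assoc, Iso.inv_hom_id,
        Category.comp_id]) f
  obtain ⟨g, rfl⟩ := (toK 𝒜).map_surjective g
  obtain ⟨g, rfl⟩ := (single 𝒜).map_surjective g
  exact ⟨g, hg⟩

/-- Such an `f` factors through an acyclic complex already at the level of chain maps. The first
factor takes values in cycles, which are boundaries, and the second kills boundaries. -/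
lemma singleD_map_eq_zero {M N : GrMod 𝒜} (f : M ⟶ N) (hf : singleD.map f = 0) : f = 0 := by
  obtain ⟨E, hE, a, b, hab⟩ := exists_factorization_of_map_eq_zero (acyclicComplexes 𝒜)
    (DerivedBounded.Q 𝒜) _ hf
  obtain ⟨Z, rfl⟩ := toK_obj_surjective E
  obtain ⟨a, rfl⟩ := (toK 𝒜).map_surjective a
  obtain ⟨b, rfl⟩ := (toK 𝒜).map_surjective b
  rw [← Functor.map_comp] at hab
  rw [eq_singleXIso_conj f, ← eq_of_toK_map_eq _ _ hab]
  have h : (a ≫ b).hom.f 0 = 0 := hom_ext fun x => by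
    obtain ⟨y, hy⟩ := acyclic_exact Z hE 0 ((a.hom.f 0).lin x)
      (congr_lin ((a.hom.comm 0 (0 + 1)).trans zero_comp) x)
    change (b.hom.f 0).lin ((a.hom.f 0).lin x) = 0
    rw [← hy]
    exact (congr_lin ((b.hom.comm (0 - 1) 0).symm.trans comp_zero) y)
  rw [h, zero_comp, comp_zero]

/-- Morphisms out of a bounded complex of projective objects can be computed on complexes. -/
lemma Q_map_toK_surjective {X Y : Bounded 𝒜} (hX : ∀ i, Projective (X.obj.X i))
    (f : (DerivedBounded.Q 𝒜).obj ((toK 𝒜).obj X) ⟶ (DerivedBounded.Q 𝒜).obj ((toK 𝒜).obj Y)) :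
    ∃ g : X ⟶ Y, (DerivedBounded.Q 𝒜).map ((toK 𝒜).map g) = f := by
  obtain ⟨g, hg⟩ := exists_map_eq_of_factors (acyclicComplexes 𝒜) (DerivedBounded.Q 𝒜)
    (fun E hE v => ⟨E, hE, 𝟙 _, v, Category.id_comp _, fun w =>
      hom_eq_zero 𝒜 _ _ ⟨_, ⟨X.property, hX⟩, ⟨Iso.refl _⟩⟩ hE w⟩) f
  obtain ⟨g, rfl⟩ := (toK 𝒜).map_surjective g
  exact ⟨g, hg⟩

lemma hom_eq_zero_of_isZero {X Y : Bounded 𝒜} (hX : ∀ i, Projective (X.obj.X i))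
    (h : ∀ i, IsZero (X.obj.X i) ∨ IsZero (Y.obj.X i))
    (f : (DerivedBounded.Q 𝒜).obj ((toK 𝒜).obj X) ⟶ (DerivedBounded.Q 𝒜).obj ((toK 𝒜).obj Y)) :
    f = 0 := by
  obtain ⟨g, rfl⟩ := Q_map_toK_surjective hX f
  have : g = 0 := ObjectProperty.hom_ext _ (HomologicalComplex.hom_ext _ _ fun i =>
    (h i).elim (fun h => h.eq_of_src _ _) (fun h => h.eq_of_tgt _ _))
  rw [this, Functor.map_zero, Functor.map_zero]

end Bounded
end GradedBranes

/-! ### Stupid truncations, and morphisms in the singularity category. -/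

namespace GradedBranes

open Pretriangulated

variable {k : Type v} [Field k] {R : Type u} [Ring R] [Algebra k R] {𝒜 : ℕ → Submodule k R}

open GrMod

namespace Bounded

/-- A family of morphisms generating the terms of degree at least `c`. -/
def stupidGens (Z : Bounded 𝒜) (c i : ℤ) : Z.obj.X i ⟶ Z.obj.X i := if c ≤ i then 𝟙 _ else 0

lemma stupidGens_surjective (Z : Bounded 𝒜) (c i : ℤ) (h : c ≤ i) :
    Function.Surjective (stupidGens Z c i).lin := by
  rw [stupidGens, if_pos h]
  exact Function.surjective_id

lemma stupidGens_eq_zero (Z : Bounded 𝒜) (c i : ℤ) (h : i < c) : stupidGens Z c i = 0 :=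
  if_neg (by lia)

lemma stupidGens_comp (Z : Bounded 𝒜) (c i j : ℤ) :
    stupidGens Z c i ≫ Z.obj.d i j ≫ cokerπ (stupidGens Z c j) = 0 := by
  by_cases hi : i < c
  · rw [stupidGens_eq_zero Z c i hi, zero_comp]
  · by_cases hij : i + 1 = j
    · exact (isZero_coker_of_surjective (stupidGens_surjective Z c j (by lia))).eq_of_tgt _ _
    · rw [Z.obj.shape i j hij, zero_comp, comp_zero]

/-- The short exact sequence relating the stupid truncations of a bounded complex. -/
def stupid (Z : Bounded 𝒜) (c : ℤ) : ShortComplex (Bounded 𝒜) :=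
  subQuot Z (stupidGens Z c) (stupidGens_comp Z c)

lemma stupid_isShortExact (Z : Bounded 𝒜) (c : ℤ) : IsShortExact (stupid Z c) :=
  subQuot_isShortExact Z _ _

lemma isZero_stupid_X₁ (Z : Bounded 𝒜) (c i : ℤ) (h : i < c) :
    IsZero ((stupid Z c).X₁.obj.X i) :=
  isZero_image_of_eq_zero (stupidGens_eq_zero Z c i h)

lemma isZero_stupid_X₃ (Z : Bounded 𝒜) (c i : ℤ) (h : c ≤ i) :
    IsZero ((stupid Z c).X₃.obj.X i) :=
  isZero_coker_of_surjective (stupidGens_surjective Z c i h)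

lemma isZero_stupid_X₃' (Z : Bounded 𝒜) (c i : ℤ) (h : IsZero (Z.obj.X i)) :
    IsZero ((stupid Z c).X₃.obj.X i) :=
  isZero_coker_of_surjective fun x => ⟨0, by rw [eq_zero_of_isZero h x, map_zero]⟩

lemma isZero_stupid_X₁' (Z : Bounded 𝒜) (c i : ℤ) (h : IsZero (Z.obj.X i)) :
    IsZero ((stupid Z c).X₁.obj.X i) :=
  isZero_image_of_eq_zero (h.eq_of_tgt _ _)

lemma projective_stupid_X₁ (Z : Bounded 𝒜) (c i : ℤ) (h : Projective (Z.obj.X i)) :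
    Projective ((stupid Z c).X₁.obj.X i) := by
  by_cases hi : c ≤ i
  · have := isIso_imageι (stupidGens_surjective Z c i hi)
    exact Projective.of_iso (asIso (imageι (stupidGens Z c i))).symm h
  · exact projective_of_isZero (isZero_stupid_X₁ Z c i (by lia))

lemma projective_stupid_X₃ (Z : Bounded 𝒜) (c i : ℤ) (h : Projective (Z.obj.X i)) :
    Projective ((stupid Z c).X₃.obj.X i) := by
  by_cases hi : c ≤ i
  · exact projective_of_isZero (isZero_stupid_X₃ Z c i hi)
  · have := isIso_cokerπ (stupidGens_eq_zero Z c i (by lia))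
    exact Projective.of_iso (@asIso _ _ _ _ (cokerπ (stupidGens Z c i)) this) h

lemma exists_iso_of_perfectComplexes {E : DerivedBounded 𝒜} (hE : perfectComplexes 𝒜 E) :
    ∃ X : Bounded 𝒜, (∀ i, Projective (X.obj.X i)) ∧
      Nonempty ((DerivedBounded.Q 𝒜).obj ((toK 𝒜).obj X) ≅ E) := by
  obtain ⟨Y, ⟨K, ⟨hK, hK'⟩, ⟨e⟩⟩, ⟨e'⟩⟩ := hE
  exact ⟨⟨K.as, hK⟩, hK', ⟨(DerivedBounded.Q 𝒜).mapIso
    ((boundedComplexes 𝒜).fullyFaithfulι.preimageIso e.symm) ≪≫ e'⟩⟩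

lemma perfectComplexes_of_projective (X : Bounded 𝒜) (hX : ∀ i, Projective (X.obj.X i)) :
    perfectComplexes 𝒜 ((DerivedBounded.Q 𝒜).obj ((toK 𝒜).obj X)) :=
  ⟨_, ⟨_, ⟨X.property, hX⟩, ⟨Iso.refl _⟩⟩, ⟨Iso.refl _⟩⟩

lemma projective_single_X {M : GrMod 𝒜} (hM : Projective M) (i : ℤ) :
    Projective (((single 𝒜).obj M).obj.X i) := by
  by_cases hi : i = 0
  · subst hi
    exact Projective.of_iso (singleXIso M).symm hM
  · exact projective_of_isZero (isZero_single_X M i hi)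

lemma isZero_toSingularityCategory_obj {M : GrMod 𝒜} (hM : Projective M) :
    IsZero ((toSingularityCategory 𝒜).obj M) := by
  exact isZero_obj_of_prop (perfectComplexes 𝒜) (SingularityCategory.Q 𝒜)
    (perfectComplexes_of_projective _ (projective_single_X hM))

section

variable {M : GrMod 𝒜} (hM : ∀ X : Bounded 𝒜, (∀ i, Projective (X.obj.X i)) →
  (∀ i, -1 < i → IsZero (X.obj.X i)) →
  ∀ f : singleD.obj M ⟶ (DerivedBounded.Q 𝒜).obj ((toK 𝒜).obj X), f = 0)

include hM

/-- The hypothesis `hM` says that `M` has no morphisms to complexes of projectives in negative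
degrees. A perfect cone `E` may be replaced by its part in negative degrees, because the part in
degrees `≥ 0` has no morphisms to `N⟦1⟧`, which lives in degree `-1`. -/
lemma toSingularityCategory_map_surjective {N : GrMod 𝒜}
    (f : (toSingularityCategory 𝒜).obj M ⟶ (toSingularityCategory 𝒜).obj N) :
    ∃ g, (toSingularityCategory 𝒜).map g = f := by
  obtain ⟨g, hg⟩ := exists_map_eq_of_factors (perfectComplexes 𝒜) (SingularityCategory.Q 𝒜)
    (M := singleD.obj M) (N := singleD.obj N) (fun E hE v => by
      obtain ⟨X, hX, ⟨e : (DerivedBounded.Q 𝒜).obj ((toK 𝒜).obj (stupid X 0).X₂) ≅ E⟩⟩ :=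
        exists_iso_of_perfectComplexes hE
      have h0 : (DerivedBounded.Q 𝒜).map ((toK 𝒜).map (stupid X 0).f) ≫ e.hom ≫ v = 0 := by
        rw [← cancel_mono (((single 𝒜).obj N).toDShiftIso 1).inv, zero_comp]
        refine hom_eq_zero_of_isZero (fun i => projective_stupid_X₁ X 0 i (hX i)) (fun i => ?_) _
        by_cases hi : i < 0
        · exact Or.inl (isZero_stupid_X₁ X 0 i hi)
        · exact Or.inr (isZero_single_X N (i + 1) (by lia))
      obtain ⟨v', hv'⟩ := Triangle.yoneda_exact₂ _ (stupid_isShortExact X 0).distinguished _ h0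
      refine ⟨(DerivedBounded.Q 𝒜).obj ((toK 𝒜).obj (stupid X 0).X₃),
        perfectComplexes_of_projective _ fun i => projective_stupid_X₃ X 0 i (hX i),
        e.inv ≫ (DerivedBounded.Q 𝒜).map ((toK 𝒜).map (stupid X 0).g), v', ?_, fun w => hM _
          (fun i => projective_stupid_X₃ X 0 i (hX i))
          (fun i hi => isZero_stupid_X₃ X 0 i (by lia)) w⟩
      exact (Category.assoc _ _ _).trans <|
        (congrArg (e.inv ≫ ·) hv'.symm).trans (e.inv_hom_id_assoc v)) f
  obtain ⟨g, rfl⟩ := singleD_map_surjective g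
  exact ⟨g, hg⟩

/-- The morphism `f` factors through a perfect complex and, by `hM`, through its subcomplex in
degrees `≥ 0`. From there, morphisms to `N` are chain maps, which see only the projective term of
degree `0`. -/
lemma exists_factorization_of_toSingularityCategory_map_eq_zero {N : GrMod 𝒜} (f : M ⟶ N)
    (hf : (toSingularityCategory 𝒜).map f = 0) :
    ∃ (E : GrMod 𝒜) (_ : Projective E) (a : M ⟶ E) (b : E ⟶ N), a ≫ b = f := by
  obtain ⟨E, hE, a, b, hab⟩ := exists_factorization_of_map_eq_zero (perfectComplexes 𝒜)
    (SingularityCategory.Q 𝒜) (singleD.map f) hf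
  obtain ⟨X, hX, ⟨e : (DerivedBounded.Q 𝒜).obj ((toK 𝒜).obj (stupid X 0).X₂) ≅ E⟩⟩ :=
    exists_iso_of_perfectComplexes hE
  have h0 : (a ≫ e.inv) ≫ (DerivedBounded.Q 𝒜).map ((toK 𝒜).map (stupid X 0).g) = 0 :=
    hM _ (fun i => projective_stupid_X₃ X 0 i (hX i))
      (fun i hi => isZero_stupid_X₃ X 0 i (by lia)) _
  obtain ⟨a', ha'⟩ : ∃ a', a ≫ e.inv =
      a' ≫ (DerivedBounded.Q 𝒜).map ((toK 𝒜).map (stupid X 0).f) :=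
    Triangle.coyoneda_exact₂ _ (stupid_isShortExact X 0).distinguished _ h0
  have hX' := fun i => projective_stupid_X₁ X 0 i (hX i)
  obtain ⟨β, hβ⟩ := Q_map_toK_surjective (Y := (single 𝒜).obj N) hX'
    ((DerivedBounded.Q 𝒜).map ((toK 𝒜).map (stupid X 0).f) ≫ e.hom ≫ b)
  let E₀ := (stupid X 0).X₁.obj.X 0
  have hd : ∀ i, (ComplexShape.up ℤ).Rel i 0 → (stupid X 0).X₁.obj.d i 0 ≫ 𝟙 E₀ = 0 := fun i hi =>
    (isZero_stupid_X₁ X 0 i (by simp only [ComplexShape.up_Rel] at hi; lia)).eq_of_src _ _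
  -- Projection to the lowest term is a chain map because nothing lies in degree `-1`.
  let γ : (stupid X 0).X₁ ⟶ (single 𝒜).obj E₀ := ObjectProperty.homMk
    (HomologicalComplex.mkHomToSingle (𝟙 E₀) hd)
  have hγ : γ.hom.f 0 = (singleXIso E₀).inv :=
    (HomologicalComplex.mkHomToSingle_f (𝟙 E₀) hd).trans (Category.id_comp _)
  have hγβ : γ ≫ (single 𝒜).map (β.hom.f 0 ≫ (singleXIso N).hom) = β := by
    refine ObjectProperty.hom_ext _ (HomologicalComplex.to_single_hom_ext ?_)
    change γ.hom.f 0 ≫ ((single 𝒜).map (β.hom.f 0 ≫ (singleXIso N).hom)).hom.f 0 = β.hom.f 0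
    rw [hγ, single_map_f, Iso.inv_hom_id_assoc, Category.assoc, Iso.hom_inv_id, Category.comp_id]
  -- Composing with `γ` gives a derived morphism between modules, hence a morphism of modules `h`;
  -- the factorization is then checked in the derived category.
  obtain ⟨h, hh⟩ := singleD_map_surjective (M := M) (N := E₀)
    (a' ≫ (DerivedBounded.Q 𝒜).map ((toK 𝒜).map γ))
  refine ⟨E₀, hX' 0, h, β.hom.f 0 ≫ (singleXIso N).hom, ?_⟩
  rw [← sub_eq_zero]
  apply singleD_map_eq_zero
  rw [Functor.map_sub, sub_eq_zero, Functor.map_comp, hh, Category.assoc]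
  have e₁ : (DerivedBounded.Q 𝒜).map ((toK 𝒜).map γ) ≫
      singleD.map (β.hom.f 0 ≫ (singleXIso N).hom) =
        (DerivedBounded.Q 𝒜).map ((toK 𝒜).map (stupid X 0).f) ≫ e.hom ≫ b := by
    rw [← hβ]
    exact ((toK 𝒜 ⋙ DerivedBounded.Q 𝒜).map_comp _ _).symm.trans
      (congrArg (toK 𝒜 ⋙ DerivedBounded.Q 𝒜).map hγβ)
  refine (congrArg (a' ≫ ·) e₁).trans ?_
  refine (Category.assoc _ _ _).symm.trans ((congrArg (· ≫ e.hom ≫ b) ha'.symm).trans ?_)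
  refine (Category.assoc _ _ _).trans ?_
  rw [e.inv_hom_id_assoc, hab]

end

end Bounded
end GradedBranes

/-! ### Vanishing of morphisms from cokernels to projectives in negative degrees. -/

namespace GradedBranes

open Pretriangulated

namespace Bounded

section

variable {k : Type v} [Field k] {R : Type u} [Ring R] [Algebra k R] {𝒜 : ℕ → Submodule k R}

open GrMod

lemma single_isShortExact (S : ShortComplex (GrMod 𝒜)) (h₁ : Function.Injective S.f.lin)
    (h₂ : ∀ x, S.g.lin x = 0 → ∃ y, S.f.lin y = x) (h₃ : Function.Surjective S.g.lin) :
    IsShortExact (S.map (single 𝒜)) := by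
  have hf := single_map_f S.f
  have hg := single_map_f S.g
  have key : ∀ (M : GrMod 𝒜) (x : M), (singleXIso M).hom.lin ((singleXIso M).inv.lin x) = x :=
    fun M => congr_lin (singleXIso M).inv_hom_id
  have key' : ∀ (M : GrMod 𝒜) (x : ((single 𝒜).obj M).obj.X 0),
      (singleXIso M).inv.lin ((singleXIso M).hom.lin x) = x :=
    fun M => congr_lin (singleXIso M).hom_inv_id
  refine ⟨fun i => ?_, fun i x hx => ?_, fun i x => ?_⟩
  · by_cases hi : i = 0
    · subst hi
      change Function.Injective (((single 𝒜).map S.f).hom.f 0).lin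
      rw [hf]
      exact (Function.LeftInverse.injective (key _)).comp
        (h₁.comp (Function.LeftInverse.injective (key' _)))
    · exact fun x y _ => (eq_zero_of_isZero (isZero_single_X _ i hi) x).trans
        (eq_zero_of_isZero (isZero_single_X _ i hi) y).symm
  · by_cases hi : i = 0
    · subst hi
      change (((single 𝒜).map S.g).hom.f 0).lin x = 0 at hx
      rw [hg] at hx
      obtain ⟨y, hy⟩ := h₂ ((singleXIso S.X₂).hom.lin x)
        (Function.LeftInverse.injective (key _) (hx.trans (map_zero _).symm))
      refine ⟨(singleXIso S.X₁).inv.lin y, ?_⟩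
      change (((single 𝒜).map S.f).hom.f 0).lin _ = _
      rw [hf]
      change (singleXIso S.X₂).inv.lin (S.f.lin ((singleXIso S.X₁).hom.lin _)) = _
      rw [key, hy]
      exact key' _ x
    · exact ⟨0, (map_zero _).trans (eq_zero_of_isZero (isZero_single_X _ i hi) x).symm⟩
  · by_cases hi : i = 0
    · subst hi
      obtain ⟨y, hy⟩ := h₃ ((singleXIso S.X₃).hom.lin x)
      refine ⟨(singleXIso S.X₂).inv.lin y, ?_⟩
      change (((single 𝒜).map S.g).hom.f 0).lin _ = _
      rw [hg]
      change (singleXIso S.X₃).inv.lin (S.g.lin ((singleXIso S.X₂).hom.lin _)) = _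
      rw [key, hy]
      exact key' _ x
    · exact ⟨0, (map_zero _).trans (eq_zero_of_isZero (isZero_single_X _ i hi) x).symm⟩

lemma exists_iso_single {X : Bounded 𝒜} (hX : Projective (X.obj.X 0))
    (h : ∀ i, i ≠ 0 → IsZero (X.obj.X i)) :
    ∃ E : GrMod 𝒜, Projective E ∧ Nonempty (X ≅ (single 𝒜).obj E) := by
  have : CochainComplex.IsStrictlyGE X.obj 0 :=
    (CochainComplex.isStrictlyGE_iff _ _).2 fun i hi => h i (by lia)
  have : CochainComplex.IsStrictlyLE X.obj 0 :=
    (CochainComplex.isStrictlyLE_iff _ _).2 fun i hi => h i (by lia)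
  obtain ⟨E, ⟨e⟩⟩ := CochainComplex.exists_iso_single X.obj 0
  have e₀ : X.obj.X 0 ≅ ((single 𝒜).obj E).obj.X 0 :=
    (HomologicalComplex.eval _ _ 0).mapIso e
  exact ⟨E, Projective.of_iso (e₀ ≪≫ singleXIso E) hX,
    ⟨(ObjectProperty.fullyFaithfulι _).preimageIso e⟩⟩

end

end Bounded

open Bounded

section

variable {k : Type v} [Field k] {B : Type u} [Ring B] [Algebra k B] {ℬ : ℕ → Submodule k B}

namespace GrPair

variable {n : ℕ} {W : B}

/-- The sequence `Cok Q ⟶ Cok C(f) ⟶ Cok P[1]`. -/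
def coneSequence {P Q : GrPair ℬ n W} (f : P ⟶ Q) : ShortComplex (GrMod (quotGrading ℬ W)) :=
  ShortComplex.mk ((Cok ℬ n W).map (toCone f)) ((Cok ℬ n W).map (coneπ f))
    (Cok_toCone_comp_coneπ f)

variable (hreg : ∀ b : B, b * W = 0 → b = 0)

include hreg

lemma coneSequence_isShortExact {P Q : GrPair ℬ n W} (f : P ⟶ Q) :
    IsShortExact ((coneSequence f).map (single (quotGrading ℬ W))) :=
  single_isShortExact _ (Cok_toCone_injective hreg f) (Cok_cone_exact f) (Cok_coneπ_surjective f)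

/-- The connecting morphism `Cok P[1] ⟶ (Cok Q)⟦1⟧` in the derived category. -/
noncomputable def coneδ {P Q : GrPair ℬ n W} (f : P ⟶ Q) :
    singleD.obj ((Cok ℬ n W).obj (shift.obj P)) ⟶
      (singleD.obj ((Cok ℬ n W).obj Q))⟦(1 : ℤ)⟧ :=
  (coneSequence_isShortExact hreg f).δ

lemma coneδ_distinguished {P Q : GrPair ℬ n W} (f : P ⟶ Q) :
    Triangle.mk (singleD.map ((Cok ℬ n W).map (toCone f)))
      (singleD.map ((Cok ℬ n W).map (coneπ f))) (coneδ hreg f) ∈ distinguishedTriangles :=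
  (coneSequence_isShortExact hreg f).distinguished

lemma coneδ_naturality {P Q P' Q' : GrPair ℬ n W} (f : P ⟶ Q) (f' : P' ⟶ Q') (φ : P ⟶ P')
    (ψ : Q ⟶ Q') (h : f ≫ ψ = φ ≫ f') :
    coneδ hreg f ≫ (singleD.map ((Cok ℬ n W).map ψ))⟦(1 : ℤ)⟧' =
      singleD.map ((Cok ℬ n W).map (shift.map φ)) ≫ coneδ hreg f' :=
  IsShortExact.δ_naturality (coneSequence_isShortExact hreg f) (coneSequence_isShortExact hreg f')
    ((single (quotGrading ℬ W)).mapShortComplex.map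
      { τ₁ := (Cok ℬ n W).map ψ
        τ₂ := (Cok ℬ n W).map (coneMap f f' φ ψ h)
        τ₃ := (Cok ℬ n W).map (shift.map φ)
        comm₁₂ := ((Cok ℬ n W).map_comp _ _).symm.trans
          ((congrArg (Cok ℬ n W).map (toCone_coneMap f f' φ ψ h).symm).trans
            ((Cok ℬ n W).map_comp _ _))
        comm₂₃ := ((Cok ℬ n W).map_comp _ _).symm.trans
          ((congrArg (Cok ℬ n W).map (coneMap_coneπ f f' φ ψ h)).trans
            ((Cok ℬ n W).map_comp _ _)) })

/-- Dimension shifting: write `P` as `P[-1][1]` and use the triangle of `𝟙` on `P[-1]`. By `h₂` the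
morphism dies on the cone term, so it factors through the connecting morphism by some `g⟦1⟧`. By
`h₁` the map `g` extends to the cone term, and two consecutive maps of the triangle compose to zero.
-/
lemma hom_shift_eq_zero (Y : DerivedBounded (quotGrading ℬ W))
    (h₁ : ∀ (P : GrPair ℬ n W) (ψ : singleD.obj ((Cok ℬ n W).obj P) ⟶ Y),
      ∃ h, singleD.map ((Cok ℬ n W).map (toCone (𝟙 P))) ≫ h = ψ)
    (h₂ : ∀ (P : GrPair ℬ n W)
      (h : singleD.obj ((Cok ℬ n W).obj (cone (𝟙 P))) ⟶ Y⟦(1 : ℤ)⟧), h = 0)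
    (P : GrPair ℬ n W) (f : singleD.obj ((Cok ℬ n W).obj P) ⟶ Y⟦(1 : ℤ)⟧) : f = 0 := by
  let e := singleD.mapIso ((Cok ℬ n W).mapIso (shiftUnshiftIso P))
  have hT := coneδ_distinguished hreg (𝟙 (unshift P))
  obtain ⟨g, hg⟩ : ∃ g, e.hom ≫ f = coneδ hreg (𝟙 (unshift P)) ≫ g :=
    Triangle.yoneda_exact₃ _ hT (e.hom ≫ f) (h₂ _ _)
  obtain ⟨g, rfl⟩ := (shiftFunctor (DerivedBounded (quotGrading ℬ W)) (1 : ℤ)).map_surjective g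
  obtain ⟨h, rfl⟩ := h₁ _ g
  have h0 : coneδ hreg (𝟙 (unshift P)) ≫
      (singleD.map ((Cok ℬ n W).map (toCone (𝟙 (unshift P)))))⟦(1 : ℤ)⟧' = 0 :=
    comp_distTriang_mor_zero₃₁ _ hT
  rw [← cancel_epi e.hom, hg, Functor.map_comp, ← Category.assoc]
  exact (congrArg (· ≫ h⟦(1 : ℤ)⟧') h0).trans (zero_comp.trans comp_zero.symm)

variable [GradedAlgebra ℬ] (hcentral : ∀ b : B, W * b = b * W) (hWn : W ∈ ℬ n)

include hcentral hWn

/-- Induction on the length of the interval `[-m, -1]` containing `X`, each step being one dimension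
shift applied to `X = X'⟦1⟧`. -/
lemma hom_eq_zero_of_le (m : ℕ) : ∀ (X : Bounded (quotGrading ℬ W)),
    (∀ i, Projective (X.obj.X i)) → (∀ i, -1 < i → IsZero (X.obj.X i)) →
    (∀ i : ℤ, i < -m → IsZero (X.obj.X i)) → ∀ (P : GrPair ℬ n W)
    (f : singleD.obj ((Cok ℬ n W).obj P) ⟶
      (DerivedBounded.Q (quotGrading ℬ W)).obj ((toK (quotGrading ℬ W)).obj X)), f = 0 := by
  induction m with
  | zero =>
    intro X _ hX hX' P f
    have h : 𝟙 X = 0 := ObjectProperty.hom_ext _ (HomologicalComplex.hom_ext _ _ fun i => by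
      by_cases hi : -1 < i
      · exact (hX i hi).eq_of_src _ _
      · exact (hX' i (by push_cast; lia)).eq_of_src _ _)
    rw [← Category.comp_id f, ← CategoryTheory.Functor.map_id, ← CategoryTheory.Functor.map_id, h,
      Functor.map_zero, Functor.map_zero, comp_zero]
  | succ m ih =>
    intro X hP hX hX' P f
    -- When `X` lives in degrees `[-(m+1), -1]`, the complex `X'` lives in `[-m, 0]`; its part below
    -- degree `0` falls under the induction hypothesis.
    let X' := X.shiftObj (-1)
    have hP' : ∀ i, Projective (X'.obj.X i) := fun i => hP (i + -1)
    let e : (DerivedBounded.Q (quotGrading ℬ W)).obj ((toK (quotGrading ℬ W)).obj X) ≅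
        ((DerivedBounded.Q (quotGrading ℬ W)).obj ((toK (quotGrading ℬ W)).obj X'))⟦(1 : ℤ)⟧ :=
      (shiftEquiv (DerivedBounded (quotGrading ℬ W)) (1 : ℤ)).counitIso.symm.app _ ≪≫
        (shiftFunctor _ (1 : ℤ)).mapIso (X.toDShiftIso (-1)).symm
    rw [← cancel_mono e.hom, zero_comp]
    refine hom_shift_eq_zero hreg _ (fun Q ψ => ?_) (fun Q h => ?_) P (f ≫ e.hom)
    · have h0 : ψ ≫ (DerivedBounded.Q _).map ((toK _).map (stupid X' 0).g) = 0 :=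
        ih _ (fun i => projective_stupid_X₃ X' 0 i (hP' i))
          (fun i hi => isZero_stupid_X₃ X' 0 i (by lia))
          (fun i hi => isZero_stupid_X₃' X' 0 i (hX' (i + -1) (by push_cast; lia))) Q _
      obtain ⟨ψ', hψ'⟩ : ∃ ψ', ψ = ψ' ≫ (DerivedBounded.Q _).map ((toK _).map (stupid X' 0).f) :=
        Triangle.coyoneda_exact₂ _ (stupid_isShortExact X' 0).distinguished ψ h0
      -- Once `ψ` dies on the negative part, it comes from the part in degree `0`, a single
      -- projective module, and extends by `exists_extension_to_projective`.
      obtain ⟨E, hE, ⟨ε⟩⟩ := exists_iso_single (projective_stupid_X₁ X' 0 0 (hP' 0)) fun i hi => by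
        by_cases hi' : i < 0
        · exact isZero_stupid_X₁ X' 0 i hi'
        · exact isZero_stupid_X₁' X' 0 i (hX (i + -1) (by lia))
      let ε' := (toK _ ⋙ DerivedBounded.Q _).mapIso ε
      obtain ⟨t, ht⟩ := singleD_map_surjective (N := E) (ψ' ≫ ε'.hom)
      obtain ⟨h, hh⟩ := exists_extension_to_projective hcentral hWn hreg Q E t
      refine ⟨singleD.map h ≫ ε'.inv ≫
        (DerivedBounded.Q _).map ((toK _).map (stupid X' 0).f), ?_⟩
      rw [← Functor.map_comp_assoc, hh, ht, hψ', Category.assoc]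
      exact congrArg (ψ' ≫ ·) (ε'.hom_inv_id_assoc _)
    -- The cone term is a projective module in degree `0` while `X` has no term there, so every
    -- morphism, being a chain map, is zero.
    · rw [← cancel_mono e.inv, zero_comp]
      refine hom_eq_zero_of_isZero (projective_single_X (projective_cok (cone_id_contractible Q)))
        (fun i => ?_) (h ≫ e.inv)
      by_cases hi : i = 0
      · exact Or.inr (hX i (by lia))
      · exact Or.inl (isZero_single_X _ i hi)

lemma hom_eq_zero_of_projective (P : GrPair ℬ n W) (X : Bounded (quotGrading ℬ W))
    (hP : ∀ i, Projective (X.obj.X i)) (hX : ∀ i, -1 < i → IsZero (X.obj.X i))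
    (f : singleD.obj ((Cok ℬ n W).obj P) ⟶
      (DerivedBounded.Q (quotGrading ℬ W)).obj ((toK (quotGrading ℬ W)).obj X)) : f = 0 := by
  obtain ⟨a, b, ha, -⟩ := X.property
  change CochainComplex.IsStrictlyGE X.obj a at ha
  exact hom_eq_zero_of_le hreg hcentral hWn a.natAbs X hP hX
    (fun i hi => CochainComplex.isZero_of_isStrictlyGE X.obj a i (by lia)) P f

end GrPair

end

end GradedBranes

/-! ### The functor from `DGrB(W)` to the singularity category and its properties. -/

namespace GradedBranes

open Pretriangulated Bounded

instance {k : Type v} [Field k] {R : Type u} [Ring R] [Algebra k R] (𝒜 : ℕ → Submodule k R) :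
    (toSingularityCategory 𝒜).Additive :=
  inferInstanceAs (single 𝒜 ⋙ toK 𝒜 ⋙ DerivedBounded.Q 𝒜 ⋙ SingularityCategory.Q 𝒜).Additive

section

variable {k : Type v} [Field k] {B : Type u} [Ring B] [Algebra k B] {ℬ : ℕ → Submodule k B}
  {n : ℕ} {W : B}

namespace GrPair

variable (ℬ n W) in
/-- The cokernel functor with values in the singularity category. -/
noncomputable abbrev CokSg : GrPair ℬ n W ⥤ SingularityCategory (quotGrading ℬ W) :=
  Cok ℬ n W ⋙ toSingularityCategory (quotGrading ℬ W)

section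

variable (hreg : ∀ b : B, b * W = 0 → b = 0)

/-- The connecting morphism `Cok P[1] ⟶ (Cok Q)⟦1⟧` in the singularity category. -/
noncomputable def sgδ {P Q : GrPair ℬ n W} (f : P ⟶ Q) :
    (CokSg ℬ n W).obj (shift.obj P) ⟶ ((CokSg ℬ n W).obj Q)⟦(1 : ℤ)⟧ :=
  (SingularityCategory.Q _).map (coneδ hreg f) ≫
    ((SingularityCategory.Q (quotGrading ℬ W)).commShiftIso (1 : ℤ)).hom.app
      (singleD.obj ((Cok ℬ n W).obj Q))

lemma sgδ_distinguished {P Q : GrPair ℬ n W} (f : P ⟶ Q) :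
    Triangle.mk ((CokSg ℬ n W).map (toCone f)) ((CokSg ℬ n W).map (coneπ f)) (sgδ hreg f) ∈
      distinguishedTriangles :=
  (SingularityCategory.Q (quotGrading ℬ W)).map_distinguished _ (coneδ_distinguished hreg f)

lemma sgδ_naturality {P Q P' Q' : GrPair ℬ n W} (f : P ⟶ Q) (f' : P' ⟶ Q') (φ : P ⟶ P')
    (ψ : Q ⟶ Q') (h : f ≫ ψ = φ ≫ f') :
    sgδ hreg f ≫ ((CokSg ℬ n W).map ψ)⟦(1 : ℤ)⟧' =
      (CokSg ℬ n W).map (shift.map φ) ≫ sgδ hreg f' := by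
  have e₁ := congrArg (SingularityCategory.Q (quotGrading ℬ W)).map
    (coneδ_naturality hreg f f' φ ψ h)
  rw [Functor.map_comp, Functor.map_comp] at e₁
  have e₂ := (SingularityCategory.Q (quotGrading ℬ W)).commShiftIso_hom_naturality
    (singleD.map ((Cok ℬ n W).map ψ)) (1 : ℤ)
  refine (Category.assoc _ _ _).trans ?_
  refine (congrArg ((SingularityCategory.Q _).map (coneδ hreg f) ≫ ·) e₂.symm).trans ?_
  refine (Category.assoc _ _ _).symm.trans ?_
  refine (congrArg (· ≫ ((SingularityCategory.Q (quotGrading ℬ W)).commShiftIso (1 : ℤ)).hom.app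
      (singleD.obj ((Cok ℬ n W).obj Q'))) e₁).trans ?_
  exact Category.assoc _ _ _

end

variable [GradedAlgebra ℬ]

lemma isZero_CokSg_cone_id (P : GrPair ℬ n W) : IsZero ((CokSg ℬ n W).obj (cone (𝟙 P))) :=
  isZero_toSingularityCategory_obj (projective_cok (cone_id_contractible P))

/-- A null-homotopic morphism factors through `C(𝟙)`, whose cokernel is projective and so vanishes
in the singularity category. -/
lemma CokSg_map_eq_zero {P Q : GrPair ℬ n W} {f : P ⟶ Q} (hf : NullHomotopic f) :
    (CokSg ℬ n W).map f = 0 := by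
  obtain ⟨g, rfl⟩ := hf.exists_extension
  rw [Functor.map_comp, (isZero_CokSg_cone_id P).eq_of_src ((CokSg ℬ n W).map g) 0, comp_zero]

/-- The compatibility of the cokernel functor with the translation functors. -/
noncomputable def shiftIso (hreg : ∀ b : B, b * W = 0 → b = 0) (P : GrPair ℬ n W) :
    (CokSg ℬ n W).obj (shift.obj P) ≅ ((CokSg ℬ n W).obj P)⟦(1 : ℤ)⟧ :=
  haveI : IsIso (sgδ hreg (𝟙 P)) :=
    (Triangle.isZero₂_iff_isIso₃ _ (sgδ_distinguished hreg (𝟙 P))).1 (isZero_CokSg_cone_id P)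
  asIso (sgδ hreg (𝟙 P))

lemma shiftIso_hom_naturality (hreg : ∀ b : B, b * W = 0 → b = 0) {P Q : GrPair ℬ n W}
    (f : P ⟶ Q) : (CokSg ℬ n W).map (shift.map f) ≫ (shiftIso hreg Q).hom =
      (shiftIso hreg P).hom ≫ ((CokSg ℬ n W).map f)⟦(1 : ℤ)⟧' :=
  (sgδ_naturality hreg (𝟙 P) (𝟙 Q) f f (by rw [Category.id_comp, Category.comp_id])).symm

/-- The square with sides `𝟙 P`, `f`, `𝟙 P`, `f` maps the sequence of `𝟙 P` to that of `f`;
naturality of the connecting morphism gives the formula. -/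
lemma sgδ_eq (hreg : ∀ b : B, b * W = 0 → b = 0) {P Q : GrPair ℬ n W} (f : P ⟶ Q) :
    sgδ hreg f = (shiftIso hreg P).hom ≫ ((CokSg ℬ n W).map f)⟦(1 : ℤ)⟧' := by
  refine Eq.trans ?_ (sgδ_naturality hreg (𝟙 P) f (𝟙 P) f rfl).symm
  rw [CategoryTheory.Functor.map_id, CategoryTheory.Functor.map_id, Category.id_comp]

lemma CokSg_cone_distinguished (hreg : ∀ b : B, b * W = 0 → b = 0) {P Q : GrPair ℬ n W}
    (f : P ⟶ Q) :
    Triangle.mk ((CokSg ℬ n W).map f) ((CokSg ℬ n W).map (toCone f))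
      ((CokSg ℬ n W).map (fromCone f) ≫ (shiftIso hreg P).hom) ∈ distinguishedTriangles := by
  rw [rotate_distinguished_triangle]
  refine isomorphic_distinguished _ (sgδ_distinguished hreg f) _ (Iso.symm ?_)
  -- Rotation introduces `-f⟦1⟧`, while the exact sequence uses `coneπ = -fromCone`. The sign on the
  -- third isomorphism cancels both.
  refine Triangle.isoMk _ _ (Iso.refl _) (Iso.refl _) (-(shiftIso hreg P)) ?_ ?_ ?_
  · exact (Category.comp_id _).trans (Category.id_comp _).symm
  · refine Eq.trans ?_ (Category.id_comp _).symm
    change (CokSg ℬ n W).map (-fromCone f) ≫ (-(shiftIso hreg P).hom) =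
      (CokSg ℬ n W).map (fromCone f) ≫ (shiftIso hreg P).hom
    rw [Functor.map_neg, Preadditive.neg_comp_neg]
  · change sgδ hreg f ≫ (𝟙 _)⟦(1 : ℤ)⟧' =
      (-(shiftIso hreg P).hom) ≫ (-((CokSg ℬ n W).map f)⟦(1 : ℤ)⟧')
    rw [CategoryTheory.Functor.map_id, Category.comp_id, Preadditive.neg_comp_neg, sgδ_eq]

end GrPair

namespace DGrB

open GrPair

variable [GradedAlgebra ℬ]

variable (ℬ n W) in
/-- The functor induced by the cokernel functor. -/
noncomputable def toSingularity : DGrB ℬ n W ⥤ SingularityCategory (quotGrading ℬ W) :=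
  CategoryTheory.Quotient.lift _ (CokSg ℬ n W) fun P Q f g h => by
    rw [← sub_eq_zero, ← Functor.map_sub]
    exact CokSg_map_eq_zero h

lemma quotient_comp_toSingularity :
    quotient ℬ n W ⋙ toSingularity ℬ n W = CokSg ℬ n W :=
  CategoryTheory.Quotient.lift_spec _ _ _

instance : (toSingularity ℬ n W).Additive where
  map_add {X Y f g} := by
    obtain ⟨f, rfl⟩ := (quotient ℬ n W).map_surjective f
    obtain ⟨g, rfl⟩ := (quotient ℬ n W).map_surjective g
    exact (CokSg ℬ n W).map_add

/-- The compatibility of `toSingularity` with the translation functors. -/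
noncomputable def toSingularityShiftIso (hreg : ∀ b : B, b * W = 0 → b = 0) :
    shift ℬ n W ⋙ toSingularity ℬ n W ≅ toSingularity ℬ n W ⋙ shiftFunctor _ (1 : ℤ) :=
  NatIso.ofComponents (fun X => shiftIso hreg X.as) fun {X Y} f => by
    obtain ⟨f, rfl⟩ := (quotient ℬ n W).map_surjective f
    exact shiftIso_hom_naturality hreg f

lemma toSingularity_isExact (hreg : ∀ b : B, b * W = 0 → b = 0) :
    IsExact (toSingularity ℬ n W) := by
  refine ⟨toSingularityShiftIso hreg, fun X Y Z u v w ⟨P, Q, f, a, b, c, hu, hv, hw⟩ => ?_⟩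
  let F := toSingularity ℬ n W
  refine isomorphic_distinguished _ (CokSg_cone_distinguished hreg f) _ ?_
  refine Triangle.isoMk _ _ (F.mapIso a) (F.mapIso b) (F.mapIso c) ?_ ?_ ?_
  · exact (F.map_comp _ _).symm.trans ((congrArg F.map hu).trans (F.map_comp _ _))
  · exact (F.map_comp _ _).symm.trans ((congrArg F.map hv).trans (F.map_comp _ _))
  · have e₁ := (toSingularityShiftIso hreg).hom.naturality a.hom
    have e₂ : F.map w ≫ F.map ((shift ℬ n W).map a.hom) =
        F.map c.hom ≫ F.map ((quotient ℬ n W).map (fromCone f)) :=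
      (F.map_comp _ _).symm.trans ((congrArg F.map hw).trans (F.map_comp _ _))
    refine (Category.assoc _ _ _).trans ?_
    refine (congrArg (F.map w ≫ ·) e₁.symm).trans ?_
    refine (Category.assoc _ _ _).symm.trans ?_
    refine (congrArg (· ≫ (toSingularityShiftIso hreg).hom.app _) e₂).trans ?_
    exact Category.assoc _ _ _

lemma toSingularity_full (hreg : ∀ b : B, b * W = 0 → b = 0)
    (hcentral : ∀ b : B, W * b = b * W) (hWn : W ∈ ℬ n) : (toSingularity ℬ n W).Full where
  map_surjective {X Y} f := by
    have := Cok_full (ℬ := ℬ) (n := n) hreg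
    obtain ⟨g, hg⟩ := toSingularityCategory_map_surjective (M := (Cok ℬ n W).obj X.as)
      (N := (Cok ℬ n W).obj Y.as)
      (fun Z h h' => hom_eq_zero_of_projective hreg hcentral hWn X.as Z h h') f
    obtain ⟨g, rfl⟩ := (Cok ℬ n W).map_surjective g
    exact ⟨(quotient ℬ n W).map g, hg⟩

/-- A difference that vanishes in the singularity category factors through a projective module after
applying `Cok`, and is therefore null-homotopic. -/
lemma toSingularity_faithful (hreg : ∀ b : B, b * W = 0 → b = 0)
    (hcentral : ∀ b : B, W * b = b * W) (hWn : W ∈ ℬ n) : (toSingularity ℬ n W).Faithful where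
  map_injective {X Y f g} h := by
    obtain ⟨f, rfl⟩ := (quotient ℬ n W).map_surjective f
    obtain ⟨g, rfl⟩ := (quotient ℬ n W).map_surjective g
    refine CategoryTheory.Quotient.sound _ ?_
    have h' : (CokSg ℬ n W).map (f - g) = 0 :=
      (Functor.map_sub _).trans (sub_eq_zero.2 h)
    obtain ⟨E, hE, a, b, hab⟩ := exists_factorization_of_toSingularityCategory_map_eq_zero
      (fun Z h h' => hom_eq_zero_of_projective hreg hcentral hWn X.as Z h h')
      ((Cok ℬ n W).map (f - g)) h'
    exact nullHomotopic_of_Cok_map_eq hcentral hWn hreg (f - g) E a b hab.symm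

end DGrB

end

end GradedBranes

open GradedBranes
theorem mainTheorem3 {k : Type v} [Field k] {B : Type u} [Ring B] [Algebra k B]
    (ℬ : ℕ → Submodule k B) [GradedAlgebra ℬ] (hB : IsConnectedGraded ℬ) (n : ℕ) (W : B)
    (hWn : W ∈ ℬ n) (hcentral : ∀ b : B, W * b = b * W) (hreg : ∀ b : B, b * W = 0 → b = 0) :
    ∃ F : DGrB ℬ n W ⥤ SingularityCategory (quotGrading ℬ W),
      DGrB.quotient ℬ n W ⋙ F = GrPair.Cok ℬ n W ⋙ toSingularityCategory (quotGrading ℬ W) ∧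
        DGrB.IsExact F ∧ F.Additive ∧ F.Full ∧ F.Faithful :=
  ⟨DGrB.toSingularity ℬ n W, DGrB.quotient_comp_toSingularity, DGrB.toSingularity_isExact hreg,
    inferInstance, DGrB.toSingularity_full hreg hcentral hWn,
    DGrB.toSingularity_faithful hreg hcentral hWn⟩
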